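/- **Setting.** Let $H^n=H^n(\mathbb R)$ be the real Sobolev spaces over $L^2(\mathbb R)$, with $\|f\|_{H^1}^2=\|f\|_{L^2}^2+\|f'\|_{L^2}^2$ and $\|f\|_{H^2}^2=\|f\|_{H^1}^2+\|f'\|_{H^1}^2$, and let $Q=(1-\partial_x^2)^{1/2}$ (Fourier multiplier). For $w\in H^1$ put $A(w)f=a\,\partial_xf+b\,f$, $f\in H^2$, with $a=Q^{-2}w$ and $b=2\,\partial_xQ^{-2}w$. Let $\xi\in C_b^4(\mathbb R)$ and $\eta\in C_b^3(\mathbb R)$ be real functions ($C_b^n$: $n$ times continuously differentiable, all derivatives up to order $n$ bounded), let $\varphi_t$ be the flow of the vector field $\xi\partial_x$, and let $U_t$, $t\in\mathbb R$, be the one-parameter group $$[U_tf](x)=e^{c(t,x)}f(\varphi_{-t}(x)),\qquad c(t,x)=\int_0^t\eta(\varphi_{s-t}(x))\,ds,\qquad U_t^{-1}=U_{-t}.$$ For $t\in\mathbb R$ and $v\in H^2$ let $\widehat A(t,v)$ be the closure in $H^1$ of the operator $U_tA(U_t^{-1}v)U_t^{-1}$ with domain $H^2$. **Theorem.** Let $\tau,R>0$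 and $I=[-\tau,\tau]$. The family $\widehat A(t,v)$, $t\in I$, $v\in H^2$, satisfies Kato's condition with $X=H^1$, $Y=H^2$, radius $R$ and the above $Q$; that is, $H^2$ is densely embedded in $H^1$ and contained in the domain of every $\widehat A(t,v)$, $Q:H^2\to H^1$ is an isomorphism, and: 1. for all $t\in I$, $v\in H^2$ the operator $-\widehat A(t,v)$ generates a $C_0$-semigroup $e^{-s\widehat A(t,v)}$ in $H^1$, and there is $\beta\in\mathbb R$ such that $\|e^{-s\widehat A(t,v)}\|_{\mathcal L(H^1)}\le e^{\beta s}$ for all $s\ge0$, $t\in I$ and $\|v\|_{H^2}\le R$; 2. there are $B(t,v)\in\mathcal L(H^1)$ such that $Q\widehat A(t,v)Q^{-1}=\widehat A(t,v)+B(t,v)$ for all $t\in I$, $v\in H^2$ (equality of unbounded operators in $H^1$, including their domains), the map $I\ni t\mapsto B(t,v)\in\mathcal L(H^1)$ is strongly measurable for every $v\in H^2$, and $\sup_{t\in I}\sup_{\|v\|_{H^2}\le R}\|B(t,v)\|_{\mathcal L(H^1)}<\infty$; 3. for all $v\in H^2$ one has $\widehat A(t,v)\in\mathcal L(H^2,H^1)$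 for $t\in I$, and $I\ni t\mapsto\widehat A(t,v)\in\mathcal L(H^2,H^1)$ is continuous in the operator norm; 4. there is $\mu$ such that $\|(\widehat A(t,v_1)-\widehat A(t,v_2))u\|_{H^1}\le\mu\,\|v_1-v_2\|_{H^1}\|u\|_{H^2}$ for all $t\in I$, $u\in H^2$ and $\|v_1\|_{H^2},\|v_2\|_{H^2}\le R$. -/

import Mathlib

open MeasureTheory Filter Topology Set
open scoped ContDiff FourierTransform

noncomputable section

namespace StochCH

/-! ### Real Sobolev spaces on the line -/

/-- The real Hilbert space `L²(ℝ)`. -/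
abbrev L2 : Type := Lp ℝ 2 (volume : Measure ℝ)

/-- `g` is the weak derivative of `f`. -/
def IsWeakDeriv (f g : L2) : Prop :=
  ∀ θ : ℝ → ℝ, ContDiff ℝ ∞ θ → HasCompactSupport θ →
    ∫ x, f x * deriv θ x = -∫ x, g x * θ x

theorem integrable_mul_test (f : L2) {θ : ℝ → ℝ} (h : Continuous θ) (hc : HasCompactSupport θ) :
    Integrable (fun x => f x * θ x) :=
  (Lp.memLp f).integrable_mul (q := 2) (h.memLp_of_hasCompactSupport hc)

theorem continuous_deriv_test {θ : ℝ → ℝ} (h : ContDiff ℝ ∞ θ) : Continuous (deriv θ) :=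
  h.continuous_deriv (by simp)

theorem IsWeakDeriv.zero : IsWeakDeriv 0 0 := by
  intro θ _ _
  have h0 : ((0 : L2) : ℝ → ℝ) =ᵐ[volume] 0 := Lp.coeFn_zero _ _ _
  have h1 : ∀ ψ : ℝ → ℝ, ∫ x, (0 : L2) x * ψ x = 0 := by
    intro ψ
    rw [integral_congr_ae (g := fun _ => (0 : ℝ))]
    · simp
    · filter_upwards [h0] with x hx
      rw [hx, Pi.zero_apply, zero_mul]
  rw [h1, h1, neg_zero]

theorem IsWeakDeriv.add {f g f' g' : L2} (h : IsWeakDeriv f f') (k : IsWeakDeriv g g') :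
    IsWeakDeriv (f + g) (f' + g') := by
  intro θ hθ hc
  have key : ∀ (p q : L2) (ψ : ℝ → ℝ), Continuous ψ → HasCompactSupport ψ →
      ∫ x, (p + q : L2) x * ψ x = (∫ x, p x * ψ x) + ∫ x, q x * ψ x := by
    intro p q ψ h1 h2
    rw [← integral_add (integrable_mul_test p h1 h2) (integrable_mul_test q h1 h2)]
    refine integral_congr_ae ?_
    filter_upwards [Lp.coeFn_add p q] with x hx
    rw [hx, Pi.add_apply, add_mul]
  rw [key f g _ (continuous_deriv_test hθ) hc.deriv, key f' g' _ hθ.continuous hc,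
    h θ hθ hc, k θ hθ hc]
  ring

theorem IsWeakDeriv.smul {f f' : L2} (c : ℝ) (h : IsWeakDeriv f f') :
    IsWeakDeriv (c • f) (c • f') := by
  intro θ hθ hc
  have key : ∀ (p : L2) (ψ : ℝ → ℝ), ∫ x, (c • p : L2) x * ψ x = c * ∫ x, p x * ψ x := by
    intro p ψ
    rw [← integral_const_mul]
    refine integral_congr_ae ?_
    filter_upwards [Lp.coeFn_smul c p] with x hx
    rw [hx, Pi.smul_apply, smul_eq_mul, mul_assoc]
  rw [key, key, h θ hθ hc]
  ring

/-- The pairs `(f, f')` of an `L²` function and its weak derivative in `L²`. -/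
def H1sub : Submodule ℝ (WithLp 2 (L2 × L2)) where
  carrier := {p | IsWeakDeriv p.fst p.snd}
  zero_mem' := IsWeakDeriv.zero
  add_mem' h k := IsWeakDeriv.add h k
  smul_mem' c _ h := IsWeakDeriv.smul c h

/-- The Sobolev space `H¹(ℝ)`: an element is an `L²` function `f` together with its weak derivative
`f'` in `L²`; the norm is `‖f‖² = ‖f‖_{L²}² + ‖f'‖_{L²}²`. -/
def H1 : Type := H1sub

instance : NormedAddCommGroup H1 := inferInstanceAs (NormedAddCommGroup H1sub)

instance : InnerProductSpace ℝ H1 := inferInstanceAs (InnerProductSpace ℝ H1sub)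

/-- The pairs `(f, f')` of elements of `H¹` such that `f'` is the weak derivative of `f`. -/
def H2sub : Submodule ℝ (WithLp 2 (H1 × H1)) where
  carrier := {p | p.fst.1.snd = p.snd.1.fst}
  zero_mem' := rfl
  add_mem' {p q} h k := by
    change p.fst.1.snd + q.fst.1.snd = p.snd.1.fst + q.snd.1.fst
    rw [show p.fst.1.snd = p.snd.1.fst from h, show q.fst.1.snd = q.snd.1.fst from k]
  smul_mem' c p h := by
    change c • p.fst.1.snd = c • p.snd.1.fst
    rw [show p.fst.1.snd = p.snd.1.fst from h]

/-- The Sobolev space `H²(ℝ)`: an element is an `f ∈ H¹` together with its weak derivative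
`f' ∈ H¹`; the norm is `‖f‖² = ‖f‖_{H¹}² + ‖f'‖_{H¹}²`, that is
`‖f‖_{L²}² + 2 ‖f'‖_{L²}² + ‖f''‖_{L²}²`, for which `(1 - ∂ₓ²)^{1/2} : H² → H¹` is isometric. -/
def H2 : Type := H2sub

instance : NormedAddCommGroup H2 := inferInstanceAs (NormedAddCommGroup H2sub)

instance : InnerProductSpace ℝ H2 := inferInstanceAs (InnerProductSpace ℝ H2sub)

/-- The embedding of `H²` into `H¹`. -/
def incl : H2 →L[ℝ] H1 :=
  (WithLp.fstL 2 ℝ H1 H1).comp H2sub.subtypeL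

/-- Differentiation `∂ₓ : H² → H¹`. -/
def dx : H2 →L[ℝ] H1 :=
  (WithLp.sndL 2 ℝ H1 H1).comp H2sub.subtypeL

theorem locallyIntegrable_L2 (f : L2) : LocallyIntegrable f volume :=
  (Lp.memLp f).locallyIntegrable (by norm_num)

theorem integral_primitive_mul_deriv (g : L2) {θ : ℝ → ℝ} (hθ : ContDiff ℝ ∞ θ)
    (hc : HasCompactSupport θ) :
    ∫ x, (∫ y in (0 : ℝ)..x, g y) * deriv θ x = -∫ x, g x * θ x := by
  have hloc := locallyIntegrable_L2 g
  have hint : ∀ a b, IntervalIntegrable g volume a b := fun a b =>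
    intervalIntegrable_iff.mpr
      ((hloc.integrableOn_isCompact isCompact_uIcc).mono_set uIoc_subset_uIcc)
  obtain ⟨M, hM⟩ : ∃ M : ℝ, ∀ x, M ≤ |x| → θ x = 0 := by
    obtain ⟨M, hM⟩ := hc.isCompact.isBounded.subset_closedBall (0 : ℝ)
    refine ⟨M + 1, fun x hx => ?_⟩
    by_contra h
    have := hM (subset_tsupport θ h)
    rw [Metric.mem_closedBall, dist_zero_right, Real.norm_eq_abs] at this
    linarith
  set N : ℝ := |M| + 1 with hN
  have hN0 : 0 ≤ N := by positivity
  have hMN : M < N := lt_of_le_of_lt (le_abs_self M) (by linarith)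
  have hθ0 : ∀ x, x ∉ Ioc (-N) N → θ x = 0 := by
    intro x hx
    apply hM
    by_contra h
    push Not at h
    obtain ⟨h1, h2⟩ := abs_lt.1 (h.trans hMN)
    exact hx ⟨h1, h2.le⟩
  have hθ'0 : ∀ x, x ∉ Ioc (-N) N → deriv θ x = 0 := by
    intro x hx
    have hMx : M < |x| := by
      by_contra h
      push Not at h
      obtain ⟨h1, h2⟩ := abs_lt.1 (h.trans_lt hMN)
      exact hx ⟨h1, h2.le⟩
    have : θ =ᶠ[𝓝 x] fun _ => 0 := by
      filter_upwards [continuous_abs.continuousAt.eventually (lt_mem_nhds hMx)] with y hy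
      exact hM y (le_of_lt hy)
    rw [this.deriv_eq, deriv_const]
  have hG : AbsolutelyContinuousOnInterval (fun x => ∫ y in (0 : ℝ)..x, g y) (-N) N :=
    (hint (-N) N).absolutelyContinuousOnInterval_intervalIntegral
      (by rw [uIcc_of_le (by linarith)]; exact ⟨by linarith, hN0⟩)
  have hT : AbsolutelyContinuousOnInterval θ (-N) N :=
    ContDiffOn.absolutelyContinuousOnInterval ((hθ.of_le (by simp)).contDiffOn)
  have hparts := hG.integral_mul_deriv_eq_deriv_mul hT
  have e1 : θ N = 0 := hM N (by rw [abs_of_nonneg hN0]; exact hMN.le)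
  have e2 : θ (-N) = 0 := hM (-N) (by rw [abs_neg, abs_of_nonneg hN0]; exact hMN.le)
  rw [e1, e2, mul_zero, mul_zero, sub_zero, zero_sub] at hparts
  have hle : -N ≤ N := by linarith
  rw [intervalIntegral.integral_of_le hle, intervalIntegral.integral_of_le hle,
    setIntegral_eq_integral_of_forall_compl_eq_zero (fun x hx => by rw [hθ'0 x hx, mul_zero]),
    setIntegral_eq_integral_of_forall_compl_eq_zero (fun x hx => by rw [hθ0 x hx, mul_zero])]
    at hparts
  rw [hparts]
  congr 1
  refine integral_congr_ae ?_
  filter_upwards [LocallyIntegrable.ae_hasDerivAt_integral hloc] with x hx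
  rw [(hx 0).deriv]

/-- A locally integrable function with zero weak derivative is a.e. constant. -/
theorem ae_const_of_weakDeriv_zero {u : ℝ → ℝ} (hu : LocallyIntegrable u volume)
    (h : ∀ θ : ℝ → ℝ, ContDiff ℝ ∞ θ → HasCompactSupport θ → ∫ x, u x * deriv θ x = 0) :
    ∃ c : ℝ, ∀ᵐ x, u x = c := by
  obtain ⟨ρ⟩ : Nonempty (ContDiffBump (0 : ℝ)) := ⟨default⟩
  set r : ℝ → ℝ := ρ.normed volume with hr
  have hr1 : ∫ x, r x = 1 := ρ.integral_normed
  have hrs : ContDiff ℝ ∞ r := ρ.contDiff_normed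
  have hrc : HasCompactSupport r := ρ.hasCompactSupport_normed
  have hui : ∀ ψ : ℝ → ℝ, Continuous ψ → HasCompactSupport ψ →
      Integrable (fun x => u x * ψ x) := by
    intro ψ h1 h2
    simpa [mul_comm] using hu.integrable_smul_left_of_hasCompactSupport h1 h2
  refine ⟨∫ x, u x * r x, ?_⟩
  set c := ∫ x, u x * r x with hcdef
  refine ae_eq_of_integral_contDiff_smul_eq hu (locallyIntegrable_const c) ?_
  intro θ hθ hc
  set m := ∫ x, θ x with hm
  -- the primitive of `θ - m r` is a test function
  set ψ : ℝ → ℝ := fun x => θ x - m * r x with hψ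
  have hψs : ContDiff ℝ ∞ ψ := hθ.sub (contDiff_const.mul hrs)
  have hψc : HasCompactSupport ψ := by
    have : HasCompactSupport fun x => m * r x := hrc.mul_left
    exact hc.sub this
  have hψi : Integrable ψ := hψs.continuous.integrable_of_hasCompactSupport hψc
  have hψ0 : ∫ x, ψ x = 0 := by
    rw [hψ, integral_sub (hθ.continuous.integrable_of_hasCompactSupport hc)
      ((hrs.continuous.integrable_of_hasCompactSupport hrc).const_mul m), integral_const_mul, hr1]
    simp [hm]
  obtain ⟨N, hN⟩ : ∃ N : ℝ, ∀ x, N ≤ |x| → ψ x = 0 := by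
    obtain ⟨M, hM⟩ := hψc.isCompact.isBounded.subset_closedBall (0 : ℝ)
    refine ⟨M + 1, fun x hx => ?_⟩
    by_contra h
    have := hM (subset_tsupport ψ h)
    rw [Metric.mem_closedBall, dist_zero_right, Real.norm_eq_abs] at this
    linarith
  set P : ℝ → ℝ := fun x => ∫ y in (-|N|)..x, ψ y with hP
  have hPd : ∀ x, HasDerivAt P (ψ x) x := fun x =>
    intervalIntegral.integral_hasDerivAt_right (hψs.continuous.intervalIntegrable _ _)
      hψs.continuous.stronglyMeasurable.stronglyMeasurableAtFilter hψs.continuous.continuousAt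
  have hPderiv : deriv P = ψ := funext fun x => (hPd x).deriv
  have hPs : ContDiff ℝ ∞ P := by
    rw [contDiff_infty_iff_deriv]
    exact ⟨fun x => (hPd x).differentiableAt, by rw [hPderiv]; exact hψs⟩
  have hPc : HasCompactSupport P := by
    refine HasCompactSupport.intro (K := Icc (-|N|) |N|) isCompact_Icc ?_
    intro x hx
    rcases lt_or_ge x (-|N|) with h1 | h1
    · rw [hP]
      dsimp only
      rw [intervalIntegral.integral_symm, neg_eq_zero]
      refine intervalIntegral.integral_zero_ae (ae_of_all _ fun y hy => hN y ?_)
      rw [uIoc_of_le h1.le] at hy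
      have := hy.2
      rw [abs_of_nonpos (by linarith [abs_nonneg N])]
      linarith [le_abs_self N]
    · have h2 : |N| < x := by
        by_contra h2
        exact hx ⟨h1, not_lt.1 h2⟩
      rw [hP]
      dsimp only
      rw [intervalIntegral.integral_of_le h1,
        setIntegral_eq_integral_of_forall_compl_eq_zero, hψ0]
      intro y hy
      apply hN
      by_contra h3
      push Not at h3
      obtain ⟨h4, h5⟩ := abs_lt.1 (h3.trans_le (le_abs_self N))
      exact hy ⟨h4, (h5.trans h2).le⟩
  have hz := h P hPs hPc
  rw [hPderiv] at hz
  have hsplit : ∫ x, u x * ψ x = (∫ x, u x * θ x) - m * c := by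
    rw [hcdef, ← integral_const_mul, ← integral_sub (hui θ hθ.continuous hc)
      ((hui r hrs.continuous hrc).const_mul m)]
    refine integral_congr_ae (ae_of_all _ fun x => ?_)
    simp only [hψ]
    ring
  rw [hsplit, sub_eq_zero] at hz
  calc ∫ x, θ x • u x = ∫ x, u x * θ x := by simp only [smul_eq_mul, mul_comm]
    _ = m * c := hz
    _ = ∫ x, θ x • c := by simp only [smul_eq_mul, integral_mul_const, hm]

/-- Every element of `H¹` has a continuous representative. -/
theorem exists_continuous_rep (f : H1) :
    ∃ F : ℝ → ℝ, Continuous F ∧ F =ᵐ[volume] f.1.fst := by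
  set g : L2 := f.1.snd with hg
  have hloc := locallyIntegrable_L2 g
  have hint : ∀ a b, IntervalIntegrable g volume a b := fun a b =>
    intervalIntegrable_iff.mpr
      ((hloc.integrableOn_isCompact isCompact_uIcc).mono_set uIoc_subset_uIcc)
  set G : ℝ → ℝ := fun x => ∫ y in (0 : ℝ)..x, g y with hGdef
  have hG : Continuous G := intervalIntegral.continuous_primitive hint 0
  obtain ⟨c, hc⟩ := ae_const_of_weakDeriv_zero (u := fun x => f.1.fst x - G x)
    ((locallyIntegrable_L2 f.1.fst).sub hG.locallyIntegrable) (by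
      intro θ hθ hcs
      have h1 := f.2 θ hθ hcs
      have h2 := integral_primitive_mul_deriv g hθ hcs
      have i1 := integrable_mul_test f.1.fst (continuous_deriv_test hθ) hcs.deriv
      have i2 : Integrable (fun x => G x * deriv θ x) :=
        (hG.mul (continuous_deriv_test hθ)).integrable_of_hasCompactSupport hcs.deriv.mul_left
      calc ∫ x, (f.1.fst x - G x) * deriv θ x
          = ∫ x, (f.1.fst x * deriv θ x - G x * deriv θ x) := by simp only [sub_mul]
        _ = 0 := by rw [integral_sub i1 i2, h1, h2, sub_self])
  refine ⟨fun x => G x + c, hG.add continuous_const, ?_⟩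
  filter_upwards [hc] with x hx
  linarith

/-- The continuous representative of an element of `H¹`. -/
def rep (f : H1) : ℝ → ℝ := (exists_continuous_rep f).choose

theorem rep_continuous (f : H1) : Continuous (rep f) := (exists_continuous_rep f).choose_spec.1

theorem rep_ae_eq (f : H1) : rep f =ᵐ[volume] f.1.fst := (exists_continuous_rep f).choose_spec.2

theorem rep_eq_of_ae_eq {f : H1} {F : ℝ → ℝ} (hF : Continuous F) (h : F =ᵐ[volume] f.1.fst) :
    rep f = F :=
  ((rep_continuous f).ae_eq_iff_eq volume hF).1 ((rep_ae_eq f).trans h.symm)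

theorem rep_zero : rep 0 = 0 :=
  rep_eq_of_ae_eq continuous_zero (Lp.coeFn_zero ℝ 2 (volume : Measure ℝ)).symm

theorem rep_add (f g : H1) : rep (f + g) = rep f + rep g := by
  refine rep_eq_of_ae_eq ((rep_continuous f).add (rep_continuous g)) ?_
  exact ((rep_ae_eq f).add (rep_ae_eq g)).trans (Lp.coeFn_add f.1.fst g.1.fst).symm

theorem rep_smul (c : ℝ) (f : H1) : rep (c • f) = c • rep f := by
  refine rep_eq_of_ae_eq ((rep_continuous f).const_smul c) ?_
  exact ((rep_ae_eq f).const_smul c).trans (Lp.coeFn_smul c f.1.fst).symm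

/-- Weak derivatives are unique, so an element of `H¹` is determined by its representative. -/
theorem rep_eq_zero {f : H1} (h : rep f = 0) : f = 0 := by
  have h0 : (f.1.fst : ℝ → ℝ) =ᵐ[volume] 0 := by
    have := rep_ae_eq f
    rw [h] at this
    exact this.symm
  have h1 : (f.1.snd : ℝ → ℝ) =ᵐ[volume] 0 := by
    refine ae_eq_zero_of_integral_contDiff_smul_eq_zero (locallyIntegrable_L2 f.1.snd) ?_
    intro θ hθ hc
    have := f.2 θ hθ hc
    rw [integral_congr_ae (g := fun _ => (0 : ℝ)) (by
      filter_upwards [h0] with x hx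
      rw [hx, Pi.zero_apply, zero_mul]), integral_zero] at this
    calc ∫ x, θ x • f.1.snd x = ∫ x, f.1.snd x * θ x := by simp only [smul_eq_mul, mul_comm]
      _ = 0 := by linarith
  apply Subtype.ext
  apply WithLp.ofLp_injective
  exact Prod.ext ((Lp.eq_zero_iff_ae_eq_zero).2 h0) ((Lp.eq_zero_iff_ae_eq_zero).2 h1)

theorem incl_injective : Function.Injective incl := by
  intro f g h
  have h1 : f.1.fst = g.1.fst := h
  have h2 : f.1.snd = g.1.snd := by
    rw [← sub_eq_zero]
    apply rep_eq_zero
    refine rep_eq_of_ae_eq continuous_zero ?_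
    have : (f.1.snd - g.1.snd : H1).1.fst = 0 := by
      change f.1.snd.1.fst - g.1.snd.1.fst = 0
      rw [← show f.1.fst.1.snd = f.1.snd.1.fst from f.2,
        ← show g.1.fst.1.snd = g.1.snd.1.fst from g.2, h1, sub_self]
    rw [this]
    exact (Lp.coeFn_zero ℝ 2 (volume : Measure ℝ)).symm
  exact Subtype.ext (WithLp.ofLp_injective 2 (Prod.ext h1 h2))

/-! ### The operator `Q = (1 - ∂ₓ²)^{1/2}` -/

/-- The Fourier transform of a real square integrable function, as an element of complex `L²`
(zero for functions which are not square integrable). -/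
def fourierL2 (w : ℝ → ℝ) : Lp ℂ 2 (volume : Measure ℝ) :=
  open Classical in
  if h : MemLp (fun x => (w x : ℂ)) 2 volume then 𝓕 (h.toLp (fun x => (w x : ℂ))) else 0

/-- The symbol of `1 - ∂ₓ²`, for the Fourier transform `∫ e^{-2πi x k} f(x) dx`. -/
def symb (k : ℝ) : ℝ := 1 + (2 * Real.pi * k) ^ 2

/-- `g = Q f`, where `Q = (1 - ∂ₓ²)^{1/2}` is understood as a Fourier multiplier. -/
def IsQ (f g : ℝ → ℝ) : Prop :=
  ∀ᵐ k, fourierL2 g k = (Real.sqrt (symb k) : ℂ) * fourierL2 f k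

/-- `Q⁻² w = (1 - ∂ₓ²)⁻¹ w` for `w ∈ L²`. The inverse Fourier transform is the one given by an
integral, as the product of `symb⁻¹` and an `L²` function is integrable. -/
def invQsq (w : ℝ → ℝ) : ℝ → ℝ :=
  fun x => (𝓕⁻ (fun k : ℝ => ((symb k)⁻¹ : ℂ) * fourierL2 w k) x).re

/-! ### The operators of the Camassa-Holm equation -/

/-- `A(w) f = a ∂ₓ f + b f`, `f ∈ H²`, where `a = Q⁻² w` and `b = 2 ∂ₓ Q⁻² w`. -/
def opA (w : ℝ → ℝ) (f : H2) : ℝ → ℝ :=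
  fun x => invQsq w x * rep (dx f) x + 2 * deriv (invQsq w) x * rep (incl f) x

theorem opA_zero (w : ℝ → ℝ) : opA w 0 = 0 := by
  funext x
  simp [opA, rep_zero]

theorem opA_add (w : ℝ → ℝ) (f g : H2) : opA w (f + g) = opA w f + opA w g := by
  funext x
  simp only [opA, map_add, rep_add, Pi.add_apply]
  ring

theorem opA_smul (w : ℝ → ℝ) (c : ℝ) (f : H2) : opA w (c • f) = c • opA w f := by
  funext x
  simp only [opA, map_smul, rep_smul, Pi.smul_apply, smul_eq_mul]
  ring

/-- The space `C_b^n` of `n` times continuously differentiable functions which are bounded together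
with their derivatives up to order `n`. -/
def MemCb (n : ℕ) (f : ℝ → ℝ) : Prop :=
  ContDiff ℝ n f ∧ ∀ m ≤ n, ∃ C : ℝ, ∀ x, |iteratedDeriv m f x| ≤ C

/-- The flow `φ_t` of the vector field `ξ ∂ₓ`: `t ↦ φ_t(x)` is the solution of `γ' = ξ(γ)`,
`γ(0) = x`, on the whole line, which exists and is unique for bounded Lipschitz `ξ`. -/
def flow (ξ : ℝ → ℝ) (t x : ℝ) : ℝ :=
  open Classical in
  if h : ∃ γ : ℝ → ℝ, γ 0 = x ∧ ∀ s, HasDerivAt γ (ξ (γ s)) s then h.choose t else x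

/-- The one-parameter group `[U_t f](x) = exp(c(t,x)) f(φ_{-t}(x))` with
`c(t,x) = ∫₀ᵗ η(φ_{s-t}(x)) ds`. -/
def U (ξ η : ℝ → ℝ) (t : ℝ) (f : ℝ → ℝ) : ℝ → ℝ :=
  fun x => Real.exp (∫ s in (0 : ℝ)..t, η (flow ξ (s - t) x)) * f (flow ξ (-t) x)

theorem U_zero (ξ η : ℝ → ℝ) (t : ℝ) : U ξ η t 0 = 0 := by
  funext x
  simp [U]

theorem U_add (ξ η : ℝ → ℝ) (t : ℝ) (f g : ℝ → ℝ) :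
    U ξ η t (f + g) = U ξ η t f + U ξ η t g := by
  funext x
  simp only [U, Pi.add_apply]
  ring

theorem U_smul (ξ η : ℝ → ℝ) (t c : ℝ) (f : ℝ → ℝ) : U ξ η t (c • f) = c • U ξ η t f := by
  funext x
  simp only [U, Pi.smul_apply, smul_eq_mul]
  ring

/-- The graph in `H¹ × H¹` of `U_t A(U_t⁻¹ v) U_t⁻¹`, where `U_t⁻¹ = U_{-t}` and `A(w)` has the
domain `H²`: pairs `(x, y)` such that `f := U_t⁻¹ x` lies in `H²` and `y = U_t A(U_t⁻¹ v) f`. -/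
def conjGraph (ξ η : ℝ → ℝ) (t : ℝ) (v : H2) : Submodule ℝ (H1 × H1) where
  carrier := {p | ∃ f : H2, rep (incl f) = U ξ η (-t) (rep p.1) ∧
    rep p.2 = U ξ η t (opA (U ξ η (-t) (rep (incl v))) f)}
  zero_mem' := ⟨0, by simp [rep_zero, U_zero], by simp [rep_zero, opA_zero, U_zero]⟩
  add_mem' := by
    rintro p q ⟨f, hf, hf'⟩ ⟨g, hg, hg'⟩
    refine ⟨f + g, ?_, ?_⟩
    · rw [map_add, rep_add, hf, hg, Prod.fst_add, rep_add, U_add]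
    · rw [Prod.snd_add, rep_add, hf', hg', opA_add, U_add]
  smul_mem' := by
    rintro c p ⟨f, hf, hf'⟩
    refine ⟨c • f, ?_, ?_⟩
    · rw [map_smul, rep_smul, hf, Prod.smul_fst, rep_smul, U_smul]
    · rw [Prod.smul_snd, rep_smul, hf', opA_smul, U_smul]

theorem conjGraph_single_valued (ξ η : ℝ → ℝ) (t : ℝ) (v : H2) (p : H1 × H1)
    (hp : p ∈ conjGraph ξ η t v) (h : p.1 = 0) : p.2 = 0 := by
  obtain ⟨f, hf, hf'⟩ := hp
  rw [h, rep_zero, U_zero] at hf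
  have h0 : f = 0 := incl_injective (by rw [rep_eq_zero hf, map_zero])
  rw [h0, opA_zero, U_zero] at hf'
  exact rep_eq_zero hf'

/-- The operator `Â(t,v)` in `H¹`: the closure in `H¹` of the operator `U_t A(U_t⁻¹ v) U_t⁻¹` with
domain `H²`. If minus this closure generates a `C₀`-semigroup in `H¹`, then no other extension of the
operator on `H²` does so. -/
def hatA (ξ η : ℝ → ℝ) (t : ℝ) (v : H2) : H1 →ₗ.[ℝ] H1 :=
  (conjGraph ξ η t v).toLinearPMap.closure

/-! ### Semigroups and Kato's condition -/

section Kato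

variable {X Y : Type*} [NormedAddCommGroup X] [NormedSpace ℝ X]
  [NormedAddCommGroup Y] [NormedSpace ℝ Y]

/-- `T s`, `s ≥ 0`, is a strongly continuous semigroup of bounded operators in `X`
(the values for `s < 0` play no role). -/
structure IsC0Semigroup (T : ℝ → X →L[ℝ] X) : Prop where
  zero : T 0 = ContinuousLinearMap.id ℝ X
  add : ∀ s r, 0 ≤ s → 0 ≤ r → T (s + r) = (T s).comp (T r)
  strong_cont : ∀ x, ContinuousOn (fun s => T s x) (Ici 0)

/-- `G` is the infinitesimal generator of `T`: `x` is in the domain of `G` and `G x = y` exactly when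
`(T(h) x - x) / h` tends to `y` as `h` decreases to `0`. -/
def IsGenerator (G : X →ₗ.[ℝ] X) (T : ℝ → X →L[ℝ] X) : Prop :=
  ∀ x y : X, (x, y) ∈ G.graph ↔
    Tendsto (fun h : ℝ => h⁻¹ • (T h x - x)) (𝓝[>] 0) (𝓝 y)

/-- Kato's condition with radius `R` and isomorphism `Q` for a family `A t v`, `t ∈ I`, `v ∈ Y`, of
linear operators in `X`, where `Y` is embedded in `X` by `ι`. -/
structure KatoCondition (ι : Y →L[ℝ] X) (Q : Y ≃L[ℝ] X) (I : Set ℝ) (R : ℝ)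
    (A : ℝ → Y → (X →ₗ.[ℝ] X)) : Prop where
  embedding : Function.Injective ι
  dense : DenseRange ι
  domain : ∀ t ∈ I, ∀ v y : Y, ι y ∈ (A t v).domain
  /-- `-A(t,v)` generates a semigroup, and `‖e^{-sA(t,v)}‖ ≤ e^{βs}` for `‖v‖ ≤ R`. -/
  quasi_accretive : ∃ β : ℝ, ∀ t ∈ I, ∀ v : Y, ∃ T : ℝ → X →L[ℝ] X,
    IsC0Semigroup T ∧ IsGenerator (-(A t v)) T ∧
      (‖v‖ ≤ R → ∀ s, 0 ≤ s → ‖T s‖ ≤ Real.exp (β * s))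
  /-- `Q A(t,v) Q⁻¹ = A(t,v) + B(t,v)` as unbounded operators, including equality of the domains. -/
  commutator : ∃ B : ℝ → Y → (X →L[ℝ] X),
    (∀ t ∈ I, ∀ v : Y, ∀ x z : X,
      (∃ y : Y, (ι (Q.symm x), ι y) ∈ (A t v).graph ∧ Q y = z) ↔
        (x, z - B t v x) ∈ (A t v).graph) ∧
    (∀ v : Y, StronglyMeasurable (fun t : I => B t v)) ∧
    ∃ l : ℝ, ∀ t ∈ I, ∀ v : Y, ‖v‖ ≤ R → ‖B t v‖ ≤ l
  /-- `A(t,v) ∈ L(Y,X)`, continuously in `t` for the operator norm. -/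
  continuity : ∀ v : Y, ∃ S : ℝ → (Y →L[ℝ] X),
    (∀ t ∈ I, ∀ y : Y, (ι y, S t y) ∈ (A t v).graph) ∧ ContinuousOn S I
  lipschitz : ∃ μ : ℝ, ∀ t (ht : t ∈ I), ∀ v₁ v₂ u : Y, ‖v₁‖ ≤ R → ‖v₂‖ ≤ R →
    ‖A t v₁ ⟨ι u, domain t ht v₁ u⟩ - A t v₂ ⟨ι u, domain t ht v₂ u⟩‖ ≤
      μ * ‖ι (v₁ - v₂)‖ * ‖u‖

end Kato

end StochCH

end

/-! Conjugation by `U` does not leave the class of first order operators. Substituting f = U_{-t} g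
and applying the chain rule gives U_t A(U_t⁻¹ v) U_t⁻¹ g = α g' + β g. Here a = Q⁻² U_{-t} v, c is
the exponent of `U`, and α = (φ_t' a) ∘ φ_{-t}, β = (2a' + ∂ₓc(-t,·) a) ∘ φ_{-t} (`rep_opL_conj`,
`conjGraph_eq`). The pair (α, β) is linear in v and bounded from H¹ to H³ × H², locally uniformly
and strongly continuously in t (`sobFamily_coefA`, `sobFamily_coefB`). For v ∈ H² both coefficients
are also of class C_b². Everything else concerns one operator L = α ∂ₓ + β with such coefficients.

Generation. The semigroup of -L is explicit: transport along the characteristics of α with weight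
exp(-∫ β). This is the construction of `U` with (α, -β) in place of (ξ, η), so `UH` is used twice.
Differentiation along characteristics gives `UH_incl_sub` on H², and density extends it, as an
identity in L², to every x ∈ H¹ with Lx ∈ H¹. The semigroup preserves the dense subspace H², so the
means h⁻¹ ∫₀ʰ T_s x of any x lie in the domain of the closure of L. Hence three operators coincide:
the closure of L on H², the maximal operator {x ∈ H¹ : Lx ∈ H¹}, and minus the generator
(`mem_closure_graphL_iff`, `mem_closure_graphL_iff_tendsto`). The bound e^{βs} without a prefactor
is `norm_UH_apply_le`; it involves only bounds of α', β and β', and these come from the Sobolev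
embedding.

Commutator. Formally Q L Q⁻¹ - L = [Q, α] ∂ₓ Q⁻¹ + (Q β Q⁻¹ - β). The second term is bounded in H¹
because H² is an algebra. For the first, let q denote the symbol of Q. On the Fourier side [Q, α]
has the kernel (q(k) - q(k-m)) α̂(m), and q(k) |q(k) - q(k-m)| ≤ 2 q(m)² q(k-m)
(`qs_mul_abs_qs_sub_le`). Young's inequality L¹ * L² ⊂ L² then bounds it in H¹ by the L¹ norm of the
transform of (1 - ∂ₓ²)α, which is finite for α ∈ H³ (`norm_commQ_le`). Equality of the domains
follows from the maximal description of the closure: the identity Q L Q⁻¹ x = Lx + Bx holds in L²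
for all x ∈ H¹, and Q is injective from H¹ to L² (`commutator_iff`).

Dependence on t and v. B depends linearly and boundedly on (α, β) ∈ H³ × H², and L : H² → H¹ does so
on (α, β) ∈ H¹ × H¹. Strong continuity of v ↦ (α, β) therefore gives norm continuity in t for fixed
v, and linearity in v gives the Lipschitz estimate. -/

noncomputable section

open scoped ENNReal NNReal

namespace StochCH

/-! ### Components of elements of `H¹` and `H²` -/

/-- The underlying `L²` function of an element of `H¹`. -/
def val : H1 →L[ℝ] L2 := (WithLp.fstL 2 ℝ L2 L2).comp H1sub.subtypeL

/-- The weak derivative of an element of `H¹`. -/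
def der : H1 →L[ℝ] L2 := (WithLp.sndL 2 ℝ L2 L2).comp H1sub.subtypeL

theorem isWeakDeriv_val_der (f : H1) : IsWeakDeriv (val f) (der f) := f.2

theorem rep_ae (f : H1) : rep f =ᵐ[volume] val f := rep_ae_eq f

theorem rep_eq {f : H1} {F : ℝ → ℝ} (hF : Continuous F) (h : F =ᵐ[volume] val f) : rep f = F :=
  rep_eq_of_ae_eq hF h

theorem norm_sq_H1 (f : H1) : ‖f‖ ^ 2 = ‖val f‖ ^ 2 + ‖der f‖ ^ 2 :=
  WithLp.prod_norm_sq_eq_of_L2 f.1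

theorem norm_sq_H2 (f : H2) : ‖f‖ ^ 2 = ‖incl f‖ ^ 2 + ‖dx f‖ ^ 2 :=
  WithLp.prod_norm_sq_eq_of_L2 f.1

theorem norm_val_le (f : H1) : ‖val f‖ ≤ ‖f‖ :=
  abs_le_of_sq_le_sq' (by rw [norm_sq_H1]; nlinarith [sq_nonneg ‖der f‖]) (norm_nonneg _) |>.2

theorem norm_der_le (f : H1) : ‖der f‖ ≤ ‖f‖ :=
  abs_le_of_sq_le_sq' (by rw [norm_sq_H1]; nlinarith [sq_nonneg ‖val f‖]) (norm_nonneg _) |>.2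

theorem norm_incl_le (f : H2) : ‖incl f‖ ≤ ‖f‖ :=
  abs_le_of_sq_le_sq' (by rw [norm_sq_H2]; nlinarith [sq_nonneg ‖dx f‖]) (norm_nonneg _) |>.2

theorem norm_dx_le (f : H2) : ‖dx f‖ ≤ ‖f‖ :=
  abs_le_of_sq_le_sq' (by rw [norm_sq_H2]; nlinarith [sq_nonneg ‖incl f‖]) (norm_nonneg _) |>.2

theorem norm_H1_le (f : H1) : ‖f‖ ≤ ‖val f‖ + ‖der f‖ := by
  refine abs_le_of_sq_le_sq' ?_ (by positivity) |>.2
  rw [norm_sq_H1]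
  nlinarith [norm_nonneg (val f), norm_nonneg (der f)]

theorem norm_H2_le (f : H2) : ‖f‖ ≤ ‖incl f‖ + ‖dx f‖ := by
  refine abs_le_of_sq_le_sq' ?_ (by positivity) |>.2
  rw [norm_sq_H2]
  nlinarith [norm_nonneg (incl f), norm_nonneg (dx f)]

theorem inner_H1 (f g : H1) : inner ℝ f g = inner ℝ (val f) (val g) + inner ℝ (der f) (der g) :=
  WithLp.prod_inner_apply f.1 g.1

theorem der_incl (f : H2) : der (incl f) = val (dx f) := f.2

/-- The element of `H¹` with given function and weak derivative. -/
def H1.mk (f g : L2) (h : IsWeakDeriv f g) : H1 := ⟨WithLp.toLp 2 (f, g), h⟩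

@[simp] theorem val_mk (f g : L2) (h : IsWeakDeriv f g) : val (H1.mk f g h) = f := rfl

@[simp] theorem der_mk (f g : L2) (h : IsWeakDeriv f g) : der (H1.mk f g h) = g := rfl

/-- The element of `H²` with given function and weak derivative. -/
def H2.mk (f g : H1) (h : der f = val g) : H2 := ⟨WithLp.toLp 2 (f, g), h⟩

@[simp] theorem incl_mk (f g : H1) (h : der f = val g) : incl (H2.mk f g h) = f := rfl

@[simp] theorem dx_mk (f g : H1) (h : der f = val g) : dx (H2.mk f g h) = g := rfl

theorem H1.ext_rep {f g : H1} (h : rep f = rep g) : f = g := by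
  rw [← sub_eq_zero]
  apply rep_eq_zero
  rw [sub_eq_add_neg, rep_add, ← neg_one_smul ℝ, rep_smul, h]
  simp

theorem H1.ext_val {f g : H1} (h : val f = val g) : f = g := by
  apply H1.ext_rep
  refine rep_eq (rep_continuous g) ?_
  rw [h]
  exact rep_ae g

theorem H2.ext_incl {f g : H2} (h : incl f = incl g) : f = g := incl_injective h

theorem rep_neg (f : H1) : rep (-f) = -rep f := by
  rw [← neg_one_smul ℝ, rep_smul]; simp

theorem rep_sub (f g : H1) : rep (f - g) = rep f - rep g := by
  rw [sub_eq_add_neg, rep_add, rep_neg, sub_eq_add_neg]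

theorem integrable_deriv_test (f : L2) {θ : ℝ → ℝ} (h : ContDiff ℝ ∞ θ)
    (hc : HasCompactSupport θ) : Integrable (fun x => f x * deriv θ x) :=
  integrable_mul_test f (continuous_deriv_test h) hc.deriv

theorem inner_L2 (f g : L2) : inner ℝ f g = ∫ x, f x * g x := by
  rw [L2.inner_def]
  refine integral_congr_ae (ae_of_all _ fun x => ?_)
  simp [mul_comm]

theorem integral_mul_test_eq_inner (f : L2) {θ : ℝ → ℝ} (h : Continuous θ)
    (hc : HasCompactSupport θ) :
    ∫ x, f x * θ x = inner ℝ f ((h.memLp_of_hasCompactSupport (p := 2) hc).toLp θ) := by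
  rw [inner_L2]
  refine integral_congr_ae ?_
  filter_upwards [(h.memLp_of_hasCompactSupport (p := 2) (μ := volume) hc).coeFn_toLp] with x hx
  rw [hx]

/-- Each test function contributes one equation between continuous functionals. Besides completeness
of H¹, this is what allows product and chain rules to be proved on the dense subspace H², where
representatives are C¹, and then extended to H¹ by continuity. -/
theorem isClosed_isWeakDeriv : IsClosed {p : L2 × L2 | IsWeakDeriv p.1 p.2} := by
  have : {p : L2 × L2 | IsWeakDeriv p.1 p.2} = ⋂ (θ : ℝ → ℝ) (h : ContDiff ℝ ∞ θ)
      (hc : HasCompactSupport θ), {p : L2 × L2 |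
        inner ℝ p.1 (((continuous_deriv_test h).memLp_of_hasCompactSupport (p := 2)
          hc.deriv).toLp (deriv θ)) =
        - inner ℝ p.2 ((h.continuous.memLp_of_hasCompactSupport (p := 2) hc).toLp θ)} := by
    ext p
    simp only [mem_iInter, mem_ofPred_eq, IsWeakDeriv]
    refine forall_congr' fun θ => forall_congr' fun h => forall_congr' fun hc => ?_
    rw [integral_mul_test_eq_inner _ (continuous_deriv_test h) hc.deriv,
      integral_mul_test_eq_inner _ h.continuous hc]
  rw [this]
  refine isClosed_iInter fun θ => isClosed_iInter fun h => isClosed_iInter fun hc => ?_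
  exact isClosed_eq (by fun_prop) (by fun_prop)

instance : CompleteSpace H1 := by
  have : IsClosed (H1sub : Set (WithLp 2 (L2 × L2))) := by
    have := isClosed_isWeakDeriv.preimage
      ((WithLp.fstL 2 ℝ L2 L2).continuous.prodMk (WithLp.sndL 2 ℝ L2 L2).continuous)
    exact this
  exact this.completeSpace_coe

/-- A continuous linear map into `H¹` given by its two components. -/
def liftH1 {X : Type*} [NormedAddCommGroup X] [NormedSpace ℝ X] (S T : X →L[ℝ] L2)
    (h : ∀ x, IsWeakDeriv (S x) (T x)) : X →L[ℝ] H1 :=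
  ((WithLp.prodContinuousLinearEquiv 2 ℝ L2 L2).symm.toContinuousLinearMap.comp
    (S.prod T)).codRestrict H1sub h

section lift

variable {X : Type*} [NormedAddCommGroup X] [NormedSpace ℝ X]

/-- A continuous linear map into `H²` given by its two components. -/
def liftH2 (S T : X →L[ℝ] H1) (h : ∀ x, der (S x) = val (T x)) : X →L[ℝ] H2 :=
  ((WithLp.prodContinuousLinearEquiv 2 ℝ H1 H1).symm.toContinuousLinearMap.comp
    (S.prod T)).codRestrict H2sub h

end lift

/-- A family in `H¹` is continuous if its two components are. -/
theorem continuousOn_H1 {X : Type*} [TopologicalSpace X] {f : X → H1} {s : Set X}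
    (h0 : ContinuousOn (fun x => val (f x)) s) (h1 : ContinuousOn (fun x => der (f x)) s) :
    ContinuousOn f s := by
  have : ContinuousOn (fun x => (f x).1) s :=
    (WithLp.prodContinuousLinearEquiv 2 ℝ L2 L2).symm.continuous.comp_continuousOn (h0.prodMk h1)
  exact continuousOn_iff_continuous_domRestrict.2
    ((continuousOn_iff_continuous_domRestrict.1 this).subtype_mk fun x => (f x).2)

theorem continuous_H1 {X : Type*} [TopologicalSpace X] {f : X → H1}
    (h0 : Continuous (fun x => val (f x))) (h1 : Continuous (fun x => der (f x))) :
    Continuous f := by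
  rw [← continuousOn_univ] at *
  exact continuousOn_H1 h0 h1

/-! ### Classical and weak derivatives -/

/-- A classical derivative in `L²` is a weak derivative. -/
theorem isWeakDeriv_of_hasDerivAt {F G : ℝ → ℝ} {f g : L2} (h : ∀ x, HasDerivAt F (G x) x)
    (hf : F =ᵐ[volume] f) (hg : G =ᵐ[volume] g) : IsWeakDeriv f g := by
  intro θ hθ hc
  have e1 : ∫ x, f x * deriv θ x = ∫ x, F x * deriv θ x :=
    integral_congr_ae (by filter_upwards [hf] with x hx; rw [hx])
  have e2 : ∫ x, g x * θ x = ∫ x, G x * θ x :=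
    integral_congr_ae (by filter_upwards [hg] with x hx; rw [hx])
  rw [e1, e2]
  refine integral_mul_deriv_eq_deriv_mul_of_integrable (fun x _ => h x)
    (fun x _ => (hθ.differentiable (by simp) x).hasDerivAt) ?_ ?_ ?_
  · refine (integrable_deriv_test f hθ hc).congr ?_
    filter_upwards [hf] with x hx
    simp [hx]
  · refine (integrable_mul_test g hθ.continuous hc).congr ?_
    filter_upwards [hg] with x hx
    simp [hx]
  · refine (integrable_mul_test f hθ.continuous hc).congr ?_
    filter_upwards [hf] with x hx
    simp [hx]

theorem intervalIntegrable_L2 (g : L2) (a b : ℝ) : IntervalIntegrable g volume a b :=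
  intervalIntegrable_iff.mpr
    (((locallyIntegrable_L2 g).integrableOn_isCompact isCompact_uIcc).mono_set uIoc_subset_uIcc)

/-- The fundamental theorem of calculus in `H¹`. -/
theorem rep_eq_integral (f : H1) (x : ℝ) : rep f x = rep f 0 + ∫ y in (0 : ℝ)..x, der f y := by
  set G : ℝ → ℝ := fun x => ∫ y in (0 : ℝ)..x, der f y with hGdef
  have hG : Continuous G := intervalIntegral.continuous_primitive (intervalIntegrable_L2 _) 0
  obtain ⟨c, hc⟩ := ae_const_of_weakDeriv_zero (u := fun x => val f x - G x)
    ((locallyIntegrable_L2 (val f)).sub hG.locallyIntegrable) (by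
      intro θ hθ hcs
      have h1 := isWeakDeriv_val_der f θ hθ hcs
      have h2 := integral_primitive_mul_deriv (der f) hθ hcs
      have i1 := integrable_deriv_test (val f) hθ hcs
      have i2 : Integrable (fun x => G x * deriv θ x) :=
        (hG.mul (continuous_deriv_test hθ)).integrable_of_hasCompactSupport hcs.deriv.mul_left
      calc ∫ x, (val f x - G x) * deriv θ x
          = ∫ x, (val f x * deriv θ x - G x * deriv θ x) := by simp only [sub_mul]
        _ = 0 := by rw [integral_sub i1 i2, h1, h2, sub_self])
  have key : rep f = fun x => G x + c := by
    refine rep_eq (hG.add continuous_const) ?_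
    filter_upwards [hc] with x hx
    linarith
  have h0 : rep f 0 = c := by rw [key]; simp [hGdef]
  rw [h0, key]
  simp only [hGdef]
  ring

/-- The continuous representative of `f ∈ H¹` is differentiable if `f'` is continuous. -/
theorem hasDerivAt_rep {f : H1} {G : ℝ → ℝ} (hG : Continuous G) (h : G =ᵐ[volume] der f) (x : ℝ) :
    HasDerivAt (rep f) (G x) x := by
  have e : rep f = fun x => rep f 0 + ∫ y in (0 : ℝ)..x, G y := by
    funext x
    rw [rep_eq_integral f x]
    congr 1
    refine intervalIntegral.integral_congr_ae ?_
    filter_upwards [h] with y hy _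
    exact hy.symm
  rw [e]
  exact (intervalIntegral.integral_hasDerivAt_right (hG.intervalIntegrable _ _)
      hG.stronglyMeasurable.stronglyMeasurableAtFilter hG.continuousAt).const_add _

theorem hasDerivAt_rep_incl (f : H2) (x : ℝ) : HasDerivAt (rep (incl f)) (rep (dx f) x) x :=
  hasDerivAt_rep (rep_continuous _) (by rw [der_incl]; exact rep_ae _) x

theorem deriv_rep_incl (f : H2) : deriv (rep (incl f)) = rep (dx f) :=
  funext fun x => (hasDerivAt_rep_incl f x).deriv

/-! ### Multiplication by bounded functions in `L²` -/

/-- `m` is measurable and bounded by `C`. -/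
def IsBddBy {𝕜 : Type*} [RCLike 𝕜] (m : ℝ → 𝕜) (C : ℝ) : Prop :=
  AEStronglyMeasurable m volume ∧ ∀ x, ‖m x‖ ≤ C

section mulLp

variable {𝕜 : Type*} [RCLike 𝕜]

theorem IsBddBy.memLp {m : ℝ → 𝕜} {C : ℝ} (h : IsBddBy m C) (f : Lp 𝕜 2 (volume : Measure ℝ)) :
    MemLp (fun x => m x * f x) 2 volume :=
  (Lp.memLp f).of_le_mul (c := C) (h.1.mul (Lp.aestronglyMeasurable f)) (ae_of_all _ fun x => by
    rw [norm_mul]; gcongr; exact h.2 x)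

theorem norm_le_of_ae_le {f g : Lp 𝕜 2 (volume : Measure ℝ)} {C : ℝ}
    (h : ∀ᵐ x, ‖f x‖ ≤ C * ‖g x‖) : ‖f‖ ≤ C * ‖g‖ :=
  Lp.norm_le_mul_norm_of_ae_le_mul h

open Classical in
/-- Multiplication by a bounded measurable function in `L²` (zero if the function is not such). -/
def mulLp (m : ℝ → 𝕜) : Lp 𝕜 2 (volume : Measure ℝ) →L[𝕜] Lp 𝕜 2 (volume : Measure ℝ) :=
  if h : ∃ C, IsBddBy m C then
    LinearMap.mkContinuous
      { toFun := fun f => (h.choose_spec.memLp f).toLp _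
        map_add' := fun f g => by
          apply Lp.ext
          filter_upwards [(h.choose_spec.memLp (f + g)).coeFn_toLp,
            (h.choose_spec.memLp f).coeFn_toLp, (h.choose_spec.memLp g).coeFn_toLp,
            Lp.coeFn_add f g, Lp.coeFn_add ((h.choose_spec.memLp f).toLp _)
              ((h.choose_spec.memLp g).toLp _)] with x h1 h2 h3 h4 h5
          rw [h1, h5, Pi.add_apply, h2, h3, h4, Pi.add_apply, mul_add]
        map_smul' := fun c f => by
          apply Lp.ext
          filter_upwards [(h.choose_spec.memLp (c • f)).coeFn_toLp,
            (h.choose_spec.memLp f).coeFn_toLp,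
            Lp.coeFn_smul c f, Lp.coeFn_smul c ((h.choose_spec.memLp f).toLp _)] with x h1 h2 h3 h4
          rw [RingHom.id_apply, h1, h4, Pi.smul_apply, h2, h3, Pi.smul_apply, smul_eq_mul,
            smul_eq_mul, mul_left_comm] }
      h.choose (fun f => by
        apply norm_le_of_ae_le
        filter_upwards [(h.choose_spec.memLp f).coeFn_toLp] with x hx
        change ‖(h.choose_spec.memLp f).toLp _ x‖ ≤ _
        rw [hx, norm_mul]
        gcongr
        exact h.choose_spec.2 x)
  else 0

theorem mulLp_ae {m : ℝ → 𝕜} {C : ℝ} (h : IsBddBy m C) (f : Lp 𝕜 2 (volume : Measure ℝ)) :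
    mulLp m f =ᵐ[volume] fun x => m x * f x := by
  have h' : ∃ C, IsBddBy m C := ⟨C, h⟩
  rw [mulLp, dif_pos h']
  exact (h'.choose_spec.memLp f).coeFn_toLp

theorem norm_mulLp_apply_le {m : ℝ → 𝕜} {C : ℝ} (h : IsBddBy m C)
    (f : Lp 𝕜 2 (volume : Measure ℝ)) : ‖mulLp m f‖ ≤ C * ‖f‖ := by
  apply norm_le_of_ae_le
  filter_upwards [mulLp_ae h f] with x hx
  rw [hx, norm_mul]
  gcongr
  exact h.2 x

end mulLp

/-! ### The Fourier transform of real functions -/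

/-- The complex space `L²(ℝ)`. -/
abbrev LC : Type := Lp ℂ 2 (volume : Measure ℝ)

/-- The inclusion of real into complex `L²`. -/
def toC : L2 →L[ℝ] LC := Complex.ofRealCLM.compLpL 2 volume

/-- The real part of a complex `L²` function. -/
def reL : LC →L[ℝ] L2 := Complex.reCLM.compLpL 2 volume

theorem toC_ae (f : L2) : toC f =ᵐ[volume] fun x => (f x : ℂ) :=
  ContinuousLinearMap.coeFn_compLpL Complex.ofRealCLM f

theorem reL_ae (f : LC) : reL f =ᵐ[volume] fun x => (f x).re :=
  ContinuousLinearMap.coeFn_compLpL Complex.reCLM f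

theorem norm_toC (f : L2) : ‖toC f‖ = ‖f‖ := by
  apply le_antisymm <;> refine Lp.norm_le_norm_of_ae_le ?_ <;>
  · filter_upwards [toC_ae f] with x hx
    rw [hx]; simp

/-- The Fourier transform on complex `L²` as a real continuous linear map. -/
def fourC : LC →L[ℝ] LC :=
  ((Lp.fourierTransformₗᵢ ℝ ℂ).toContinuousLinearEquiv : LC →L[ℂ] LC).restrictScalars ℝ

/-- The inverse Fourier transform on complex `L²` as a real continuous linear map. -/
def fourInvC : LC →L[ℝ] LC :=
  ((Lp.fourierTransformₗᵢ ℝ ℂ).symm.toContinuousLinearEquiv : LC →L[ℂ] LC).restrictScalars ℝ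

theorem fourInvC_apply (f : LC) : fourInvC f = 𝓕⁻ f := rfl

/-- The Fourier transform of a real `L²` function. -/
def FT : L2 →L[ℝ] LC := fourC.comp toC

theorem FT_apply (f : L2) : FT f = 𝓕 (toC f) := rfl

theorem norm_FT (f : L2) : ‖FT f‖ = ‖f‖ := by
  rw [FT_apply, Lp.norm_fourier_eq, norm_toC]

theorem FT_injective : Function.Injective FT := by
  rw [injective_iff_map_eq_zero]
  intro f hf
  rw [← norm_eq_zero, ← norm_FT, hf, norm_zero]

theorem inner_FT (f g : L2) : inner ℝ f g = (inner ℂ (FT f) (FT g)).re := by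
  rw [FT_apply, FT_apply, Lp.inner_fourier_eq, L2.inner_def, L2.inner_def]
  have : ∫ a, inner ℂ (toC f a) (toC g a) = ((∫ a, f a * g a : ℝ) : ℂ) := by
    rw [← integral_complex_ofReal]
    refine integral_congr_ae ?_
    filter_upwards [toC_ae f, toC_ae g] with x h1 h2
    rw [h1, h2]
    simp [mul_comm]
  rw [this, Complex.ofReal_re]
  refine integral_congr_ae (ae_of_all _ fun x => ?_)
  simp [mul_comm]

theorem fourierL2_eq {w : ℝ → ℝ} {f : L2} (h : w =ᵐ[volume] f) : fourierL2 w = FT f := by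
  have h1 : (fun x => (w x : ℂ)) =ᵐ[volume] toC f := by
    filter_upwards [h, toC_ae f] with x h1 h2
    rw [h2, h1]
  have h2 : MemLp (fun x => (w x : ℂ)) 2 volume := (memLp_congr_ae h1).2 (Lp.memLp _)
  rw [fourierL2, dif_pos h2, FT_apply]
  congr 1
  apply Lp.ext
  exact h2.coeFn_toLp.trans h1

/-- The Plancherel transform on L² agrees with the transform of tempered distributions, so it moves
onto the Schwartz factor. Transforms of L² functions are identified below by testing with this
identity. -/
theorem integral_schwartz_mul_fourier (f : LC) (θ : SchwartzMap ℝ ℂ) :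
    ∫ x, θ x * (𝓕 f : LC) x = ∫ x, (𝓕 θ) x * f x := by
  have h := congrArg (fun T => T θ) (Lp.fourier_toTemperedDistribution_eq f)
  simp only [TemperedDistribution.fourier_apply, Lp.toTemperedDistribution_apply, smul_eq_mul] at h
  exact h.symm

/-- A compactly supported smooth real function as a Schwartz function. -/
def testSchwartz (θ : ℝ → ℝ) (h : ContDiff ℝ ∞ θ) (hc : HasCompactSupport θ) : SchwartzMap ℝ ℂ :=
  HasCompactSupport.toSchwartzMap (f := fun x => (θ x : ℂ)) (hc.comp_left (g := fun x : ℝ => (x : ℂ)) rfl)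
    (Complex.ofRealCLM.contDiff.comp h)

theorem testSchwartz_apply (θ : ℝ → ℝ) (h : ContDiff ℝ ∞ θ) (hc : HasCompactSupport θ) (x : ℝ) :
    testSchwartz θ h hc x = (θ x : ℂ) := rfl

theorem ae_eq_of_test {u v : ℝ → ℂ} (hu : LocallyIntegrable u volume)
    (hv : LocallyIntegrable v volume)
    (h : ∀ (θ : ℝ → ℝ) (_ : ContDiff ℝ ∞ θ) (_ : HasCompactSupport θ),
      ∫ x, (θ x : ℂ) * u x = ∫ x, (θ x : ℂ) * v x) : u =ᵐ[volume] v :=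
  ae_eq_of_integral_contDiff_smul_eq hu hv (fun θ h1 h2 => by
    simpa [Complex.real_smul] using h θ h1 h2)

theorem locallyIntegrable_LC (f : LC) : LocallyIntegrable f volume :=
  (Lp.memLp f).locallyIntegrable (by norm_num)

theorem ae_neg {p : ℝ → Prop} (h : ∀ᵐ x, p x) : ∀ᵐ x, p (-x) :=
  (Measure.measurePreserving_neg (volume : Measure ℝ)).quasiMeasurePreserving.ae h

/-- The Fourier transform and complex conjugation. -/
theorem fourier_conj {f g : LC} (h : g =ᵐ[volume] fun x => (starRingEnd ℂ) (f x)) :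
    (𝓕 g : LC) =ᵐ[volume] fun k => (starRingEnd ℂ) ((𝓕 f : LC) (-k)) := by
  have hl : LocallyIntegrable (fun k => (starRingEnd ℂ) ((𝓕 f : LC) (-k))) volume := by
    have : MemLp (fun k => (starRingEnd ℂ) ((𝓕 f : LC) (-k))) 2 volume := by
      have h1 : MemLp (fun k => (𝓕 f : LC) (-k)) 2 volume :=
        (Lp.memLp (𝓕 f : LC)).comp_measurePreserving (Measure.measurePreserving_neg _)
      exact h1.star
    exact this.locallyIntegrable (by norm_num)
  refine ae_eq_of_test (locallyIntegrable_LC _) hl ?_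
  intro θ hθ hc
  have hc' : HasCompactSupport (fun x => θ (-x)) := hc.comp_homeomorph (Homeomorph.neg ℝ)
  have hθ' : ContDiff ℝ ∞ (fun x => θ (-x)) := hθ.comp contDiff_neg
  have h1 := integral_schwartz_mul_fourier g (testSchwartz θ hθ hc)
  have h2 := integral_schwartz_mul_fourier f (testSchwartz _ hθ' hc')
  simp only [testSchwartz_apply] at h1 h2
  rw [h1]
  have h3 : ∀ x, (starRingEnd ℂ) ((𝓕 (testSchwartz θ hθ hc)) x) =
      (𝓕 (testSchwartz _ hθ' hc')) x := by
    intro x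
    rw [SchwartzMap.fourier_coe, SchwartzMap.fourier_coe, Real.fourier_real_eq_integral_exp_smul,
      Real.fourier_real_eq_integral_exp_smul, ← integral_conj]
    rw [← integral_neg_eq_self]
    refine integral_congr_ae (ae_of_all _ fun y => ?_)
    simp only [testSchwartz_apply, smul_eq_mul, map_mul, Complex.conj_ofReal]
    rw [← Complex.exp_conj]
    congr 2
    simp [Complex.conj_ofNat]
  have h4 : ∫ x, (𝓕 (testSchwartz θ hθ hc)) x * g x =
      (starRingEnd ℂ) (∫ x, (𝓕 (testSchwartz _ hθ' hc')) x * f x) := by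
    rw [← integral_conj]
    refine integral_congr_ae ?_
    filter_upwards [h] with x hx
    rw [hx, map_mul, ← h3, Complex.conj_conj]
  rw [h4, ← h2, ← integral_conj, ← integral_neg_eq_self]
  refine integral_congr_ae (ae_of_all _ fun y => ?_)
  simp

theorem FT_neg (f : L2) : ∀ᵐ k, FT f (-k) = (starRingEnd ℂ) (FT f k) := by
  have h : toC f =ᵐ[volume] fun x => (starRingEnd ℂ) (toC f x) := by
    filter_upwards [toC_ae f] with x hx
    rw [hx, Complex.conj_ofReal]
  filter_upwards [fourier_conj h] with k hk
  rw [FT_apply, hk, Complex.conj_conj]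

/-- Square integrable functions with a hermitian Fourier transform are real. -/
theorem FT_reL_fourierInv {h : LC} (hh : ∀ᵐ k, h (-k) = (starRingEnd ℂ) (h k)) :
    FT (reL (fourInvC h)) = h := by
  have key : toC (reL (fourInvC h)) = fourInvC h := by
    set f : LC := fourInvC h with hf
    have hF : (𝓕 f : LC) = h := by rw [hf, fourInvC_apply, FourierTransform.fourier_fourierInv_eq]
    -- The hermitian symmetry of h makes the conjugate of f have the same transform as f, so f is
    -- real.
    have hm : MemLp (fun x => (starRingEnd ℂ) (f x)) 2 volume := (Lp.memLp f).star
    set g : LC := hm.toLp _ with hg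
    have h1 : (𝓕 g : LC) = 𝓕 f := by
      apply Lp.ext
      filter_upwards [fourier_conj hm.coeFn_toLp, hh] with k h1 h2
      rw [← hg] at h1
      rw [h1, hF, h2, Complex.conj_conj]
    have h2 : g = f := (Lp.fourierTransformₗᵢ ℝ ℂ).injective h1
    apply Lp.ext
    filter_upwards [toC_ae (reL f), reL_ae f, hm.coeFn_toLp] with x e1 e2 e3
    rw [← hg, h2] at e3
    rw [e1, e2]
    exact Complex.conj_eq_iff_re.1 e3.symm
  rw [FT_apply, key, fourInvC_apply, FourierTransform.fourier_fourierInv_eq]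

/-- The Fourier multiplier with the symbol `m`, acting on real functions. -/
def multiplier (m : ℝ → ℂ) : L2 →L[ℝ] L2 :=
  (reL.comp fourInvC).comp (((mulLp m).restrictScalars ℝ).comp FT)

theorem FT_multiplier {m : ℝ → ℂ} {C : ℝ} (hm : IsBddBy m C)
    (h : ∀ k, m (-k) = (starRingEnd ℂ) (m k)) (f : L2) :
    FT (multiplier m f) =ᵐ[volume] fun k => m k * FT f k := by
  have : FT (multiplier m f) = mulLp m (FT f) := by
    refine FT_reL_fourierInv ?_
    filter_upwards [mulLp_ae hm (FT f), ae_neg (mulLp_ae hm (FT f)), FT_neg f] with k h1 h2 h3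
    change mulLp m (FT f) (-k) = (starRingEnd ℂ) (mulLp m (FT f) k)
    rw [h1, h2, h, h3, map_mul]
  rw [this]
  exact mulLp_ae hm _

/-! ### The Fourier transform and weak derivatives -/

/-- Enlarges the class of test functions from compact support to smooth θ with θ, θ' ∈ L². Cutoffs
χ(x/(n+1)) are inserted; their derivatives are O(1/n) and disappear in the limit by dominated
convergence. Schwartz functions become admissible, as the Fourier characterization requires. -/
theorem IsWeakDeriv.integral_mul_deriv {f g : L2} (h : IsWeakDeriv f g) {θ : ℝ → ℝ}
    (hθ : ContDiff ℝ ∞ θ) (h0 : MemLp θ 2 volume) (h1 : MemLp (deriv θ) 2 volume) :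
    ∫ x, f x * deriv θ x = -∫ x, g x * θ x := by
  let χ : ContDiffBump (0 : ℝ) := ⟨1, 2, one_pos, one_lt_two⟩
  obtain ⟨C, hC⟩ : ∃ C, ∀ x, ‖deriv χ x‖ ≤ C :=
    χ.hasCompactSupport.deriv.exists_bound_of_continuous
      (χ.contDiff (n := 1) |>.continuous_deriv le_rfl)
  have hC0 : 0 ≤ C := (norm_nonneg _).trans (hC 0)
  let c : ℕ → ℝ → ℝ := fun n x => χ ((n + 1 : ℝ)⁻¹ * x)
  have hcd : ∀ n x, HasDerivAt (c n) ((n + 1 : ℝ)⁻¹ * deriv χ ((n + 1 : ℝ)⁻¹ * x)) x := by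
    intro n x
    have h1 : HasDerivAt χ (deriv χ ((n + 1 : ℝ)⁻¹ * x)) ((n + 1 : ℝ)⁻¹ * x) :=
      (χ.contDiff (n := 1) |>.differentiable one_ne_zero _).hasDerivAt
    have h2 := h1.comp x ((hasDerivAt_id x).const_mul ((n + 1 : ℝ)⁻¹))
    simpa [c, Function.comp_def, mul_comm] using h2
  have hcs : ∀ n, ContDiff ℝ ∞ (c n) := fun n => χ.contDiff.comp (contDiff_const.mul contDiff_id)
  have hcc : ∀ n, HasCompactSupport (c n) := by
    intro n
    have hn : ((n + 1 : ℝ)⁻¹) ≠ 0 := by positivity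
    exact χ.hasCompactSupport.comp_homeomorph (Homeomorph.mulLeft₀ _ hn)
  have hlim : ∀ x, Tendsto (fun n => c n x) atTop (𝓝 1) := by
    intro x
    have h1 : Tendsto (fun n : ℕ => ((n : ℝ) + 1)⁻¹ * x) atTop (𝓝 (0 * x)) :=
      (tendsto_inv_atTop_zero.comp
        (tendsto_atTop_add_const_right _ 1 tendsto_natCast_atTop_atTop)).mul_const x
    rw [zero_mul] at h1
    have h2 := (χ.continuous.tendsto 0).comp h1
    rwa [χ.one_of_mem_closedBall (Metric.mem_closedBall_self χ.rIn_pos.le)] at h2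
  have hlim' : ∀ x, Tendsto (fun n => deriv (c n) x) atTop (𝓝 0) := by
    intro x
    refine squeeze_zero_norm (a := fun n : ℕ => ((n : ℝ) + 1)⁻¹ * C) ?_ ?_
    · intro n
      rw [(hcd n x).deriv, norm_mul, Real.norm_of_nonneg (by positivity)]
      gcongr
      exact hC _
    · simpa using (tendsto_inv_atTop_zero.comp
        (tendsto_atTop_add_const_right _ (1 : ℝ) tendsto_natCast_atTop_atTop)).mul_const C
  have hb' : ∀ n x, ‖deriv (c n) x‖ ≤ C := by
    intro n x
    rw [(hcd n x).deriv, norm_mul, Real.norm_of_nonneg (by positivity)]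
    calc ((n : ℝ) + 1)⁻¹ * ‖deriv χ (((n : ℝ) + 1)⁻¹ * x)‖ ≤ 1 * C := by
          gcongr
          · exact inv_le_one_of_one_le₀ (by linarith [(Nat.cast_nonneg n : (0 : ℝ) ≤ n)])
          · exact hC _
      _ = C := one_mul C
  have hb : ∀ n x, ‖c n x‖ ≤ 1 := by
    intro n x
    rw [Real.norm_of_nonneg χ.nonneg]
    exact χ.le_one
  have i1 : Integrable (fun x => f x * deriv θ x) := (Lp.memLp f).integrable_mul (q := 2) h1
  have i2 : Integrable (fun x => f x * θ x) := (Lp.memLp f).integrable_mul (q := 2) h0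
  have i3 : Integrable (fun x => g x * θ x) := (Lp.memLp g).integrable_mul (q := 2) h0
  have hd : ∀ n x, deriv (fun x => θ x * c n x) x = deriv θ x * c n x + θ x * deriv (c n) x :=
    fun n x => deriv_fun_mul (hθ.differentiable (by simp) x) ((hcs n).differentiable (by simp) x)
  have key : ∀ n, ∫ x, f x * (deriv θ x * c n x + θ x * deriv (c n) x) =
      -∫ x, g x * (θ x * c n x) := by
    intro n
    have := h (fun x => θ x * c n x) (hθ.mul (hcs n)) (hcc n).mul_left
    simpa only [hd] using this
  have t1 : Tendsto (fun n => ∫ x, f x * (deriv θ x * c n x + θ x * deriv (c n) x)) atTop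
      (𝓝 (∫ x, f x * deriv θ x)) := by
    refine tendsto_integral_of_dominated_convergence
      (fun x => ‖f x * deriv θ x‖ + C * ‖f x * θ x‖) ?_ (i1.norm.add (i2.norm.const_mul C)) ?_ ?_
    · intro n
      exact (Lp.aestronglyMeasurable f).mul ((((continuous_deriv_test hθ).mul
        (hcs n).continuous).add (hθ.continuous.mul
          (continuous_deriv_test (hcs n)))).aestronglyMeasurable)
    · intro n
      refine ae_of_all _ fun x => ?_
      calc ‖f x * (deriv θ x * c n x + θ x * deriv (c n) x)‖
          = ‖(f x * deriv θ x) * c n x + deriv (c n) x * (f x * θ x)‖ := by ring_nf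
        _ ≤ ‖f x * deriv θ x‖ * 1 + C * ‖f x * θ x‖ := by
            refine (norm_add_le _ _).trans ?_
            rw [norm_mul (f x * deriv θ x), norm_mul (deriv (c n) x)]
            gcongr
            · exact hb n x
            · exact hb' n x
        _ = _ := by ring
    · refine ae_of_all _ fun x => ?_
      have := (((hlim x).const_mul (deriv θ x)).add ((hlim' x).const_mul (θ x))).const_mul (f x)
      simpa using this
  have t2 : Tendsto (fun n => -∫ x, g x * (θ x * c n x)) atTop (𝓝 (-∫ x, g x * θ x)) := by
    refine (tendsto_integral_of_dominated_convergence
      (fun x => ‖g x * θ x‖) ?_ i3.norm ?_ ?_).neg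
    · intro n
      exact (Lp.aestronglyMeasurable g).mul
        ((hθ.continuous.mul (hcs n).continuous).aestronglyMeasurable)
    · intro n
      refine ae_of_all _ fun x => ?_
      rw [← mul_assoc, norm_mul (g x * θ x)]
      exact mul_le_of_le_one_right (norm_nonneg _) (hb n x)
    · refine ae_of_all _ fun x => ?_
      simpa using ((hlim x).const_mul (θ x)).const_mul (g x)
  simp only [key] at t1
  exact tendsto_nhds_unique t1 t2

theorem integral_schwartz_mul_toC (h : L2) (F : SchwartzMap ℝ ℂ) :
    ∫ x, F x * toC h x =
      ((∫ x, h x * (F x).re : ℝ) : ℂ) + ((∫ x, h x * (F x).im : ℝ) : ℂ) * Complex.I := by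
  have hi : Integrable (fun x => F x * toC h x) :=
    (F.memLp 2 volume).integrable_mul (Lp.memLp (toC h))
  rw [← integral_re_add_im (𝕜 := ℂ) hi]
  have e1 : ∀ᵐ x, F x * toC h x = F x * (h x : ℂ) := by
    filter_upwards [toC_ae h] with x hx
    rw [hx]
  have r1 : ∫ x, RCLike.re (F x * toC h x) = ∫ x, h x * (F x).re := by
    refine integral_congr_ae ?_
    filter_upwards [e1] with x hx
    simp only [hx]
    simp [mul_comm]
  have r2 : ∫ x, RCLike.im (F x * toC h x) = ∫ x, h x * (F x).im := by
    refine integral_congr_ae ?_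
    filter_upwards [e1] with x hx
    simp only [hx]
    simp [mul_comm]
  rw [r1, r2]
  rfl

open LineDeriv in
theorem hasDerivAt_schwartz (F : SchwartzMap ℝ ℂ) (x : ℝ) :
    HasDerivAt F ((∂_{(1 : ℝ)} F : SchwartzMap ℝ ℂ) x) x := by
  rw [SchwartzMap.lineDerivOp_apply_eq_fderiv]
  exact F.differentiableAt.hasFDerivAt.hasDerivAt

open LineDeriv in
theorem isWeakDeriv_iff_schwartz (f g : L2) : IsWeakDeriv f g ↔ ∀ F : SchwartzMap ℝ ℂ,
    ∫ x, (∂_{(1 : ℝ)} F : SchwartzMap ℝ ℂ) x * toC f x = -∫ x, F x * toC g x := by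
  constructor
  · intro h F
    have hre : ∀ x, HasDerivAt (fun x => (F x).re) ((∂_{(1 : ℝ)} F : SchwartzMap ℝ ℂ) x).re x :=
      fun x => Complex.reCLM.hasFDerivAt.comp_hasDerivAt x (hasDerivAt_schwartz F x)
    have him : ∀ x, HasDerivAt (fun x => (F x).im) ((∂_{(1 : ℝ)} F : SchwartzMap ℝ ℂ) x).im x :=
      fun x => Complex.imCLM.hasFDerivAt.comp_hasDerivAt x (hasDerivAt_schwartz F x)
    have dre := funext fun x => (hre x).deriv
    have dim := funext fun x => (him x).deriv
    have h1 := h.integral_mul_deriv (Complex.reCLM.contDiff.comp (F.smooth ⊤))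
      ((F.memLp 2 volume).re) (by
        change MemLp (deriv fun x => (F x).re) 2 volume
        rw [dre]; exact ((∂_{(1 : ℝ)} F : SchwartzMap ℝ ℂ).memLp 2 volume).re)
    have h2 := h.integral_mul_deriv (Complex.imCLM.contDiff.comp (F.smooth ⊤))
      ((F.memLp 2 volume).im) (by
        change MemLp (deriv fun x => (F x).im) 2 volume
        rw [dim]; exact ((∂_{(1 : ℝ)} F : SchwartzMap ℝ ℂ).memLp 2 volume).im)
    change ∫ x, f x * deriv (fun x => (F x).re) x = -∫ x, g x * (F x).re at h1
    change ∫ x, f x * deriv (fun x => (F x).im) x = -∫ x, g x * (F x).im at h2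
    rw [dre] at h1
    rw [dim] at h2
    rw [integral_schwartz_mul_toC, integral_schwartz_mul_toC, h1, h2]
    push_cast
    ring
  · intro h θ hθ hc
    have h1 := h (testSchwartz θ hθ hc)
    rw [integral_schwartz_mul_toC, integral_schwartz_mul_toC] at h1
    have h2 := congrArg Complex.re h1
    have hd : ∀ x, (∂_{(1 : ℝ)} (testSchwartz θ hθ hc) : SchwartzMap ℝ ℂ) x = ((deriv θ x : ℝ) : ℂ) :=
      fun x => (hasDerivAt_schwartz _ x).unique
        ((hθ.differentiable (by simp) x).hasDerivAt.ofReal_comp)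
    simpa [hd, testSchwartz_apply] using h2

open LineDeriv in
-- The derivative of 𝓕 G is the transform of -2πik G(k); moving 𝓕 back onto f turns ∂ₓ into the
-- multiplier 2πik.
theorem integral_deriv_fourier_mul (f : L2) (G : SchwartzMap ℝ ℂ) :
    ∫ x, (∂_{(1 : ℝ)} (𝓕 G) : SchwartzMap ℝ ℂ) x * toC f x =
      -∫ k, G k * ((2 * Real.pi * k : ℝ) * Complex.I * FT f k) := by
  have htg : (fun x : ℝ => inner ℝ x (1 : ℝ)).HasTemperateGrowth := by fun_prop
  rw [SchwartzMap.lineDerivOp_fourier_eq, ← integral_schwartz_mul_fourier, ← integral_neg]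
  refine integral_congr_ae (ae_of_all _ fun k => ?_)
  simp only [smul_apply, SchwartzMap.smulLeftCLM_apply_apply htg]
  simp [FT_apply]
  ring

/-- Weak derivatives in terms of the Fourier transform. -/
theorem isWeakDeriv_iff (f g : L2) : IsWeakDeriv f g ↔
    ∀ᵐ k, FT g k = (2 * Real.pi * k : ℝ) * Complex.I * FT f k := by
  rw [isWeakDeriv_iff_schwartz]
  constructor
  · intro h
    refine ae_eq_of_test (locallyIntegrable_LC _) ?_ ?_
    · have : Continuous fun k : ℝ => ((2 * Real.pi * k : ℝ) * Complex.I : ℂ) := by fun_prop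
      exact LocallyIntegrable.continuous_mul this (locallyIntegrable_LC (FT f))
    intro θ hθ hc
    have h1 := h (𝓕 (testSchwartz θ hθ hc))
    rw [integral_deriv_fourier_mul, ← integral_schwartz_mul_fourier, neg_inj] at h1
    exact h1.symm
  · intro h F
    obtain ⟨G, rfl⟩ : ∃ G : SchwartzMap ℝ ℂ, F = 𝓕 G :=
      ⟨𝓕⁻ F, (FourierTransform.fourier_fourierInv_eq F).symm⟩
    rw [integral_deriv_fourier_mul, ← integral_schwartz_mul_fourier, neg_inj]
    refine integral_congr_ae ?_
    filter_upwards [h] with k hk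
    rw [← FT_apply, hk]

/-! ### The inverse Fourier integral -/

/-- Fubini for the transform defined by an integral. Combined with the same duality in L², it shows
in the next lemmas that the two kinds of transform agree when both make sense. -/
theorem integral_schwartz_mul_fourierInv {h : ℝ → ℂ} (hh : Integrable h) (θ : SchwartzMap ℝ ℂ) :
    ∫ x, θ x * 𝓕⁻ h x = ∫ k, (𝓕⁻ θ) k * h k := by
  have h1 : ∫ x, 𝓕 (θ : ℝ → ℂ) x • h (-x) = ∫ x, θ x • 𝓕 (fun y => h (-y)) x := by
    simpa using! VectorFourier.integral_fourierIntegral_smul_eq_flip (L := innerₗ ℝ) (f := θ)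
      (g := fun y => h (-y)) Real.continuous_fourierChar continuous_inner θ.integrable hh.comp_neg
  rw [Real.fourierInv_eq_fourier_comp_neg]
  simp only [smul_eq_mul] at h1
  rw [← h1, ← integral_neg_eq_self]
  refine integral_congr_ae (ae_of_all _ fun x => ?_)
  simp only [neg_neg]
  congr 1

theorem continuous_fourierInv {h : ℝ → ℂ} (hh : Integrable h) : Continuous (𝓕⁻ h) := by
  rw [Real.fourierInv_eq_fourier_comp_neg]
  exact VectorFourier.fourierIntegral_continuous Real.continuous_fourierChar
    (innerSL ℝ).continuous₂ hh.comp_neg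

theorem norm_fourierInv_le (h : ℝ → ℂ) (x : ℝ) : ‖𝓕⁻ h x‖ ≤ ∫ k, ‖h k‖ := by
  rw [Real.fourierInv_eq]
  refine (norm_integral_le_integral_norm _).trans_eq ?_
  simp_rw [Circle.norm_smul]

theorem fourier_ae_eq_of_fourierInv {g : LC} {h : ℝ → ℂ} (hh : Integrable h)
    (hg : g =ᵐ[volume] 𝓕⁻ h) : (𝓕 g : LC) =ᵐ[volume] h := by
  refine ae_eq_of_test (locallyIntegrable_LC _) hh.locallyIntegrable fun θ hθ hc => ?_
  have h1 := integral_schwartz_mul_fourier g (testSchwartz θ hθ hc)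
  have h2 := integral_schwartz_mul_fourierInv hh (𝓕 (testSchwartz θ hθ hc))
  rw [FourierTransform.fourierInv_fourier_eq] at h2
  simp only [testSchwartz_apply] at h1 h2
  rw [h1, ← h2]
  refine integral_congr_ae ?_
  filter_upwards [hg] with x hx
  rw [hx]

theorem ae_eq_fourierInv_of_fourier {g : LC} {h : ℝ → ℂ} (hh : Integrable h)
    (hg : (𝓕 g : LC) =ᵐ[volume] h) : g =ᵐ[volume] 𝓕⁻ h := by
  refine ae_eq_of_test (locallyIntegrable_LC _)
    (continuous_fourierInv hh).locallyIntegrable fun θ hθ hc => ?_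
  have h1 := integral_schwartz_mul_fourier g (𝓕⁻ (testSchwartz θ hθ hc))
  have h2 := integral_schwartz_mul_fourierInv hh (testSchwartz θ hθ hc)
  rw [FourierTransform.fourier_fourierInv_eq] at h1
  simp only [testSchwartz_apply] at h1 h2
  rw [h2, ← h1]
  refine integral_congr_ae ?_
  filter_upwards [hg] with x hx
  rw [hx]

/-! ### The operator `Q` -/

/-- The symbol of `Q`. -/
def qs (k : ℝ) : ℝ := Real.sqrt (symb k)

theorem symb_pos (k : ℝ) : 0 < symb k := by unfold symb; positivity

theorem qs_pos (k : ℝ) : 0 < qs k := Real.sqrt_pos.2 (symb_pos k)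

theorem qs_sq (k : ℝ) : qs k ^ 2 = 1 + (2 * Real.pi * k) ^ 2 := Real.sq_sqrt (symb_pos k).le

theorem one_le_qs (k : ℝ) : 1 ≤ qs k := by
  have := qs_sq k
  nlinarith [qs_pos k, sq_nonneg (2 * Real.pi * k)]

theorem abs_le_qs (k : ℝ) : |2 * Real.pi * k| ≤ qs k := by
  rw [← sq_le_sq₀ (abs_nonneg _) (qs_pos k).le, sq_abs, qs_sq]
  linarith

theorem continuous_qs : Continuous qs := by unfold qs symb; fun_prop

theorem qs_neg (k : ℝ) : qs (-k) = qs k := by simp [qs, symb]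

theorem qs_ne (k : ℝ) : (qs k : ℂ) ≠ 0 := by exact_mod_cast (qs_pos k).ne'

theorem qs_sq' (k : ℝ) : (qs k : ℂ) ^ 2 = 1 + (2 * Real.pi * k) ^ 2 := by exact_mod_cast qs_sq k

/-- The symbol of `Q⁻¹`. -/
def symP (k : ℝ) : ℂ := ((qs k)⁻¹ : ℝ)

/-- The symbol of `∂ₓ Q⁻¹`. -/
def symD (k : ℝ) : ℂ := (2 * Real.pi * k / qs k : ℝ) * Complex.I

theorem isBddBy_symP : IsBddBy symP 1 := by
  refine ⟨?_, fun k => ?_⟩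
  · refine Continuous.aestronglyMeasurable ?_
    exact Complex.continuous_ofReal.comp (continuous_qs.inv₀ fun k => (qs_pos k).ne')
  · rw [symP, Complex.norm_real, Real.norm_of_nonneg (inv_nonneg.2 (qs_pos k).le)]
    exact inv_le_one_of_one_le₀ (one_le_qs k)

theorem isBddBy_symD : IsBddBy symD 1 := by
  refine ⟨?_, fun k => ?_⟩
  · refine Continuous.aestronglyMeasurable ?_
    have : Continuous fun k : ℝ => 2 * Real.pi * k / qs k :=
      (by fun_prop : Continuous fun k : ℝ => 2 * Real.pi * k).div continuous_qs
        fun k => (qs_pos k).ne'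
    exact (Complex.continuous_ofReal.comp this).mul continuous_const
  · rw [symD, norm_mul, Complex.norm_I, mul_one, Complex.norm_real, Real.norm_eq_abs, abs_div,
      abs_of_pos (qs_pos k)]
    exact (div_le_one (qs_pos k)).2 (abs_le_qs k)

/-- `Q⁻¹` in `L²`. -/
def opP : L2 →L[ℝ] L2 := multiplier symP

/-- `∂ₓ Q⁻¹` in `L²`. -/
def opD : L2 →L[ℝ] L2 := multiplier symD

theorem FT_opP (f : L2) : ∀ᵐ k, FT (opP f) k = (qs k : ℂ)⁻¹ * FT f k := by
  filter_upwards [FT_multiplier isBddBy_symP (fun k => by simp [symP, qs_neg]) f] with k hk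
  rw [opP, hk, symP, Complex.ofReal_inv]

theorem FT_opD (f : L2) : ∀ᵐ k, FT (opD f) k = (2 * Real.pi * k / qs k) * Complex.I * FT f k := by
  filter_upwards [FT_multiplier isBddBy_symD
    (fun k => by simp [symD, qs_neg, neg_div, Complex.conj_ofNat]) f] with k hk
  rw [opD, hk, symD]
  push_cast
  rfl

theorem ext_FT {f g : L2} (h : ∀ᵐ k, FT f k = FT g k) : f = g := FT_injective (Lp.ext h)

theorem FT_sub_ae (f g : L2) : ∀ᵐ k, FT (f - g) k = FT f k - FT g k := by
  rw [map_sub]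
  filter_upwards [Lp.coeFn_sub (FT f) (FT g)] with k hk
  rw [hk, Pi.sub_apply]

/-- This is Q⁻²(1 - ∂ₓ²) = 1: the symbols add up to (1 + (2πk)²)/q² = 1, the sign coming from I² =
-1. -/
theorem opP_opP_sub_opD_opD (f : L2) : opP (opP f) - opD (opD f) = f := by
  apply ext_FT
  filter_upwards [FT_sub_ae (opP (opP f)) (opD (opD f)), FT_opP (opP f), FT_opP f,
    FT_opD (opD f), FT_opD f] with k h1 h2 h3 h4 h5
  rw [h1, h2, h3, h4, h5]
  have := qs_ne k
  field_simp
  rw [qs_sq', Complex.I_sq]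
  ring

theorem opP_opD (f : L2) : opP (opD f) = opD (opP f) := by
  apply ext_FT
  filter_upwards [FT_opP (opD f), FT_opP f, FT_opD (opP f), FT_opD f] with k h2 h3 h4 h5
  rw [h2, h4, h3, h5]
  ring

theorem isWeakDeriv_opP (f : L2) : IsWeakDeriv (opP f) (opD f) := by
  rw [isWeakDeriv_iff]
  filter_upwards [FT_opP f, FT_opD f] with k h1 h2
  rw [h1, h2]
  push_cast
  ring

theorem IsWeakDeriv.opP {f g : L2} (h : IsWeakDeriv f g) : IsWeakDeriv (opP f) (opP g) := by
  rw [isWeakDeriv_iff] at *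
  filter_upwards [FT_opP f, FT_opP g, h] with k h1 h2 h3
  rw [h1, h2, h3]
  ring

theorem IsWeakDeriv.opD {f g : L2} (h : IsWeakDeriv f g) : IsWeakDeriv (opD f) (opD g) := by
  rw [isWeakDeriv_iff] at *
  filter_upwards [FT_opD f, FT_opD g, h] with k h1 h2 h3
  rw [h1, h2, h3]
  ring

theorem IsWeakDeriv.unique {f g g' : L2} (h : IsWeakDeriv f g) (h' : IsWeakDeriv f g') :
    g = g' := by
  rw [isWeakDeriv_iff] at *
  apply ext_FT
  filter_upwards [h, h'] with k h1 h2
  rw [h1, h2]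

theorem IsWeakDeriv.opD_eq {f g : L2} (h : IsWeakDeriv f g) : StochCH.opD f = StochCH.opP g :=
  (isWeakDeriv_opP f).unique h.opP

theorem IsWeakDeriv.sub {f g f' g' : L2} (h : IsWeakDeriv f f') (k : IsWeakDeriv g g') :
    IsWeakDeriv (f - g) (f' - g') := by
  have := h.add (k.smul (-1))
  simpa [sub_eq_add_neg] using this

/-- `Q : H¹ → L²`. -/
def QL2 : H1 →L[ℝ] L2 := opP.comp val - opD.comp der

theorem QL2_apply (f : H1) : QL2 f = opP (val f) - opD (der f) := rfl

/-- Since Q = Q⁻¹(1 - ∂ₓ²), the operator `QL2` is built from bounded multipliers and one weak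
derivative, so no unbounded symbol has to be handled. That it inverts Q⁻¹ reduces to
`opP_opP_sub_opD_opD`. -/
theorem opP_QL2 (f : H1) : opP (QL2 f) = val f := by
  rw [QL2_apply, map_sub, opP_opD, ← (isWeakDeriv_val_der f).opD_eq, opP_opP_sub_opD_opD]

theorem QL2_injective : Function.Injective QL2 := by
  rw [injective_iff_map_eq_zero]
  intro f hf
  apply H1.ext_val
  rw [← opP_QL2, hf, map_zero, map_zero]

/-- `Q : H² → H¹`. -/
def QH : H2 →L[ℝ] H1 :=
  liftH1 (QL2.comp incl) (QL2.comp dx) (fun f => by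
    have h1 := (isWeakDeriv_val_der (incl f)).opP
    have h2 := (isWeakDeriv_val_der (dx f)).opD
    simp only [ContinuousLinearMap.comp_apply, QL2_apply, der_incl] at *
    exact h1.sub h2)

/-- `Q⁻¹ : H¹ → H²`. -/
def QinvH : H1 →L[ℝ] H2 :=
  liftH2 (liftH1 (opP.comp val) (opD.comp val) fun _ => isWeakDeriv_opP _)
    (liftH1 (opD.comp val) (opD.comp der) fun f => (isWeakDeriv_val_der f).opD) fun _ => rfl

theorem val_QH (f : H2) : val (QH f) = QL2 (incl f) := rfl

theorem val_incl_QinvH (f : H1) : val (incl (QinvH f)) = opP (val f) := rfl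

theorem val_dx_QinvH (f : H1) : val (dx (QinvH f)) = opD (val f) := rfl

theorem der_incl_QinvH (f : H1) : der (incl (QinvH f)) = opD (val f) := rfl

theorem QL2_incl_QinvH (f : H1) : QL2 (incl (QinvH f)) = val f := by
  rw [QL2_apply, val_incl_QinvH, der_incl_QinvH, opP_opP_sub_opD_opD]

/-- `Q` as an isomorphism of `H²` onto `H¹`. -/
def QE : H2 ≃L[ℝ] H1 :=
  ContinuousLinearEquiv.equivOfInverse QH QinvH
    (fun f => by
      apply H2.ext_incl
      apply H1.ext_val
      rw [val_incl_QinvH, val_QH, opP_QL2])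
    (fun f => by
      apply H1.ext_val
      rw [val_QH, QL2_incl_QinvH])

theorem QE_apply (f : H2) : QE f = QH f := rfl

theorem FT_QL2 (f : H1) : ∀ᵐ k, FT (QL2 f) k = (qs k : ℂ) * FT (val f) k := by
  have h := FT_opP (QL2 f)
  rw [opP_QL2] at h
  filter_upwards [h] with k hk
  rw [hk, mul_inv_cancel_left₀ (qs_ne k)]

theorem isQ_QE (f : H2) : IsQ (rep (incl f)) (rep (QE f)) := by
  rw [IsQ, fourierL2_eq (rep_ae (incl f)), fourierL2_eq (rep_ae (QE f)), QE_apply, val_QH]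
  exact FT_QL2 _

/-- `Q⁻¹` commutes with `∂ₓ`. -/
theorem dx_QinvH_incl (f : H2) : dx (QinvH (incl f)) = incl (QinvH (dx f)) := by
  apply H1.ext_val
  rw [val_dx_QinvH, val_incl_QinvH, ← der_incl, (isWeakDeriv_val_der (incl f)).opD_eq]

/-- The norm of `H¹` in terms of `Q`. -/
theorem norm_QL2 (f : H1) : ‖QL2 f‖ = ‖f‖ := by
  have key : ‖QL2 f‖ ^ 2 = ‖f‖ ^ 2 := by
    have hs : ∀ g : L2, ‖g‖ ^ 2 = ∫ k, ‖FT g k‖ ^ 2 := by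
      intro g
      rw [← norm_FT, ← @inner_self_eq_norm_sq ℂ, L2.inner_def]
      have : ∀ k, inner ℂ (FT g k) (FT g k) = ((‖FT g k‖ ^ 2 : ℝ) : ℂ) := by
        intro k
        rw [inner_self_eq_norm_sq_to_K]
        push_cast
        rfl
      simp_rw [this]
      rw [integral_complex_ofReal]
      exact Complex.ofReal_re _
    rw [norm_sq_H1, hs, hs, hs, ← integral_add]
    · refine integral_congr_ae ?_
      filter_upwards [FT_QL2 f, (isWeakDeriv_iff _ _).1 (isWeakDeriv_val_der f)] with k h1 h2
      rw [h1, h2]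
      simp only [norm_mul, mul_pow, Complex.norm_real, Complex.norm_I, Real.norm_eq_abs, sq_abs,
        qs_sq]
      ring
    · exact (Lp.memLp (FT (val f))).integrable_norm_pow (by norm_num)
    · exact (Lp.memLp (FT (der f))).integrable_norm_pow (by norm_num)
  exact (sq_eq_sq₀ (norm_nonneg _) (norm_nonneg _)).1 key

/-- The symbol 1/q is strictly positive, so Q⁻¹ is a strictly positive form on L². This serves the
density of H² in H¹. -/
theorem inner_opP_nonneg (f : L2) : 0 ≤ inner ℝ f (opP f) ∧ (inner ℝ f (opP f) = 0 → f = 0) := by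
  have e : inner ℝ f (opP f) = ∫ k, (qs k)⁻¹ * ‖FT f k‖ ^ 2 := by
    rw [inner_FT, L2.inner_def, ← Complex.ofReal_re (∫ k, (qs k)⁻¹ * ‖FT f k‖ ^ 2),
      ← integral_complex_ofReal]
    congr 1
    refine integral_congr_ae ?_
    filter_upwards [FT_opP f] with k hk
    rw [hk, ← smul_eq_mul, inner_smul_right, inner_self_eq_norm_sq_to_K]
    push_cast
    rfl
  have hn : ∀ k, 0 ≤ (qs k)⁻¹ * ‖FT f k‖ ^ 2 := fun k => by have := qs_pos k; positivity
  rw [e]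
  refine ⟨integral_nonneg hn, fun h0 => ?_⟩
  rw [integral_eq_zero_iff_of_nonneg hn] at h0
  · apply ext_FT
    rw [map_zero]
    filter_upwards [h0, Lp.coeFn_zero ℂ 2 (volume : Measure ℝ)] with k hk h2
    rw [h2]
    have : (qs k)⁻¹ ≠ 0 := inv_ne_zero (qs_pos k).ne'
    simpa [this] using hk
  · refine ((Lp.memLp (FT f)).integrable_norm_pow (by norm_num)).bdd_mul (c := 1)
      (continuous_qs.inv₀ fun k => (qs_pos k).ne').aestronglyMeasurable (ae_of_all _ fun k => ?_)
    rw [norm_inv, Real.norm_of_nonneg (qs_pos k).le]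
    exact inv_le_one_of_one_le₀ (one_le_qs k)

/-- If g is orthogonal to H² in H¹, pairing it with Q⁻¹ g ∈ H² gives ⟨g, Q⁻¹g⟩ + ⟨g', Q⁻¹g'⟩ = 0 in
L², and both terms are nonnegative. -/
theorem denseRange_incl : DenseRange incl := by
  have h : (LinearMap.range incl.toLinearMap).topologicalClosure = ⊤ := by
    rw [Submodule.topologicalClosure_eq_top_iff, Submodule.eq_bot_iff]
    intro g hg
    have h0 : inner ℝ (incl (QinvH g)) g = 0 := hg _ ⟨QinvH g, rfl⟩
    rw [real_inner_comm, inner_H1, val_incl_QinvH, der_incl_QinvH,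
      (isWeakDeriv_val_der g).opD_eq] at h0
    have h1 := inner_opP_nonneg (val g)
    have h2 := inner_opP_nonneg (der g)
    apply H1.ext_val
    rw [map_zero]
    exact h1.2 (by linarith [h1.1, h2.1])
  have := (Submodule.dense_iff_topologicalClosure_eq_top).2 h
  exact this

/-! ### The embedding of `H¹` into bounded functions -/

theorem integrable_qs_inv_sq : Integrable fun k => (qs k)⁻¹ ^ 2 := by
  have h := (integrable_inv_one_add_sq).comp_mul_left' (R := 2 * Real.pi) (by positivity)
  refine h.congr (ae_of_all _ fun k => ?_)
  simp only [inv_pow, qs_sq]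

theorem memLp_qs_inv : MemLp (fun k => (((qs k)⁻¹ : ℝ) : ℂ)) 2 volume := by
  rw [memLp_two_iff_integrable_sq_norm]
  · refine integrable_qs_inv_sq.congr (ae_of_all _ fun k => ?_)
    simp
  · exact isBddBy_symP.1

/-- The `L²` norm of the symbol of `Q⁻¹`. -/
def normSymP : ℝ := ‖memLp_qs_inv.toLp‖

/-- Cauchy-Schwarz for f̂ = q⁻¹ · (Qf)^, with q⁻¹ ∈ L² in dimension one and ‖Qf‖_{L²} = ‖f‖_{H¹}.
This is the source of the embedding of H¹ into bounded functions and of the L¹ factor in Young's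
inequality for the commutator. -/
theorem integrable_FT_and_integral_le (f : H1) :
    Integrable (FT (val f)) ∧ ∫ k, ‖FT (val f) k‖ ≤ normSymP * ‖f‖ := by
  have h : ∀ᵐ k, FT (val f) k = (((qs k)⁻¹ : ℝ) : ℂ) * FT (QL2 f) k := by
    filter_upwards [FT_QL2 f] with k hk
    rw [hk, Complex.ofReal_inv, inv_mul_cancel_left₀ (qs_ne k)]
  constructor
  · exact (memLp_qs_inv.integrable_mul (Lp.memLp (FT (QL2 f)))).congr
      (by filter_upwards [h] with k hk; rw [hk]; rfl)
  · have h1 : ∫ k, ‖FT (val f) k‖ = ∫ k, ‖(((qs k)⁻¹ : ℝ) : ℂ)‖ * ‖FT (QL2 f) k‖ :=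
      integral_congr_ae (by filter_upwards [h] with k hk; rw [hk, norm_mul])
    rw [h1]
    have h2 := integral_mul_norm_le_Lp_mul_Lq (μ := volume) (p := 2) (q := 2)
      (f := fun k => (((qs k)⁻¹ : ℝ) : ℂ)) (g := FT (QL2 f)) Real.HolderConjugate.two_two
      (by simpa using memLp_qs_inv) (by simpa using Lp.memLp (FT (QL2 f)))
    refine h2.trans_eq ?_
    have hn : ∀ g : LC, (∫ k, ‖g k‖ ^ (2 : ℝ)) ^ (1 / (2 : ℝ)) = ‖g‖ := by
      intro g
      rw [Lp.norm_def, (Lp.memLp g).eLpNorm_eq_integral_rpow_norm (by norm_num) (by norm_num),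
        ENNReal.toReal_ofReal (by positivity)]
      norm_num
    rw [hn, norm_FT, norm_QL2, normSymP, ← hn]
    congr 2
    refine (integral_congr_ae ?_)
    filter_upwards [memLp_qs_inv.coeFn_toLp] with k hk
    rw [hk]

theorem rep_eq_fourierInv (f : H1) (x : ℝ) : (rep f x : ℂ) = 𝓕⁻ (FT (val f) : ℝ → ℂ) x := by
  have hi := (integrable_FT_and_integral_le f).1
  have h := ae_eq_fourierInv_of_fourier (g := toC (val f)) hi (ae_eq_refl _)
  have h2 : (fun x => (rep f x : ℂ)) =ᵐ[volume] 𝓕⁻ (FT (val f) : ℝ → ℂ) := by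
    filter_upwards [h, toC_ae (val f), rep_ae f] with x h1 h2 h3
    rw [← h1, h2, h3]
  exact congrFun (((Complex.continuous_ofReal.comp (rep_continuous f)).ae_eq_iff_eq volume
    (continuous_fourierInv hi)).1 h2) x

theorem abs_rep_le (f : H1) (x : ℝ) : |rep f x| ≤ normSymP * ‖f‖ := by
  rw [← Real.norm_eq_abs, ← Complex.norm_real, rep_eq_fourierInv]
  exact (norm_fourierInv_le _ x).trans (integrable_FT_and_integral_le f).2

theorem normSymP_nonneg : 0 ≤ normSymP := norm_nonneg _

/-- `Q⁻²` maps `L²` into `H²`. -/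
def invQ2 : L2 →L[ℝ] H1 :=
  liftH1 (opP.comp opP) (opD.comp opP) fun _ => isWeakDeriv_opP _

/-- `∂ₓ Q⁻²` maps `L²` into `H¹`. -/
def dxInvQ2 : L2 →L[ℝ] H1 :=
  liftH1 (opD.comp opP) (opD.comp opD) fun f => (isWeakDeriv_opP f).opD

theorem der_invQ2 (w : L2) : der (invQ2 w) = val (dxInvQ2 w) := rfl

/-- ∂ₓ² Q⁻² = Q⁻² - 1. This identity drives the gain of two derivatives by Q⁻². -/
theorem der_dxInvQ2 (w : L2) : der (dxInvQ2 w) = val (invQ2 w) - w := by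
  have := opP_opP_sub_opD_opD w
  change opD (opD w) = opP (opP w) - w
  rw [← sub_eq_zero]
  rw [← sub_eq_zero] at this
  rw [← neg_eq_zero, ← this]
  abel

/-- The pointwise inverse integral is legitimate because Q⁻² f lies in H¹, so its transform is
integrable and inverts to the continuous representative. -/
theorem invQsq_eq {w : ℝ → ℝ} {f : L2} (h : w =ᵐ[volume] f) : invQsq w = rep (invQ2 f) := by
  funext x
  rw [invQsq, fourierL2_eq h, ← Complex.ofReal_re (rep (invQ2 f) x), rep_eq_fourierInv]
  congr 1
  refine Real.fourierInv_congr_ae ?_ x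
  filter_upwards [FT_opP (opP f), FT_opP f] with k h1 h2
  change _ = FT (opP (opP f)) k
  rw [h1, h2, ← mul_assoc, ← mul_inv, ← sq, qs_sq']
  simp [symb]

theorem deriv_invQsq_eq {w : ℝ → ℝ} {f : L2} (h : w =ᵐ[volume] f) :
    deriv (invQsq w) = rep (dxInvQ2 f) := by
  rw [invQsq_eq h]
  funext x
  exact (hasDerivAt_rep (rep_continuous _) (by rw [der_invQ2]; exact rep_ae _) x).deriv

/-! ### Multiplication in `H¹` and `H²` -/

theorem isBddBy_rep (f : H1) : IsBddBy (rep f) (normSymP * ‖f‖) :=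
  ⟨(rep_continuous f).aestronglyMeasurable, fun x => by
    rw [Real.norm_eq_abs]; exact abs_rep_le f x⟩

/-- Multiplication of an element of `L²` by an element of `H¹`. -/
def mulL : H1 →L[ℝ] L2 →L[ℝ] L2 :=
  LinearMap.mkContinuous₂
    (LinearMap.mk₂ ℝ (fun f g => mulLp (rep f) g)
      (fun f f' g => by
        apply Lp.ext
        filter_upwards [mulLp_ae (isBddBy_rep f) g, mulLp_ae (isBddBy_rep f') g,
          mulLp_ae (isBddBy_rep (f + f')) g,
          Lp.coeFn_add (mulLp (rep f) g) (mulLp (rep f') g)] with x h1 h2 h3 h4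
        rw [h3, h4, Pi.add_apply, h1, h2, rep_add, Pi.add_apply, add_mul])
      (fun c f g => by
        apply Lp.ext
        filter_upwards [mulLp_ae (isBddBy_rep f) g, mulLp_ae (isBddBy_rep (c • f)) g,
          Lp.coeFn_smul c (mulLp (rep f) g)] with x h1 h2 h3
        rw [h2, h3, Pi.smul_apply, h1, rep_smul, Pi.smul_apply, smul_eq_mul, smul_eq_mul,
          mul_assoc])
      (fun f g g' => map_add _ _ _) (fun c f g => map_smul _ _ _))
    normSymP (fun f g => norm_mulLp_apply_le (isBddBy_rep f) g)

theorem mulL_ae (f : H1) (g : L2) : mulL f g =ᵐ[volume] fun x => rep f x * g x :=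
  mulLp_ae (isBddBy_rep f) g

theorem norm_mulL_le (f : H1) (g : L2) : ‖mulL f g‖ ≤ normSymP * ‖f‖ * ‖g‖ :=
  norm_mulLp_apply_le (isBddBy_rep f) g

theorem mulL_val_comm (f g : H1) : mulL f (val g) = mulL g (val f) := by
  apply Lp.ext
  filter_upwards [mulL_ae f (val g), mulL_ae g (val f), rep_ae f, rep_ae g] with x h1 h2 h3 h4
  rw [h1, h2, ← h3, ← h4, mul_comm]

/-- For factors in H² this is the classical product rule for C¹ representatives. Both sides depend
continuously on (f, g) ∈ H¹ × H¹, and H² is dense. -/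
theorem isWeakDeriv_mulL (f g : H1) :
    IsWeakDeriv (mulL f (val g)) (mulL f (der g) + mulL g (der f)) := by
  refine DenseRange.induction_on₂ (p := fun f g : H1 =>
    IsWeakDeriv (mulL f (val g)) (mulL f (der g) + mulL g (der f))) denseRange_incl ?_ ?_ f g
  · exact isClosed_isWeakDeriv.preimage (f := fun q : H1 × H1 =>
      (mulL q.1 (val q.2), mulL q.1 (der q.2) + mulL q.2 (der q.1))) (by fun_prop)
  · intro f g
    refine isWeakDeriv_of_hasDerivAt
      (fun x => (hasDerivAt_rep_incl f x).mul (hasDerivAt_rep_incl g x)) ?_ ?_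
    · filter_upwards [mulL_ae (incl f) (val (incl g)), rep_ae (incl g)] with x h1 h2
      rw [h1, ← h2]; rfl
    · filter_upwards [mulL_ae (incl f) (der (incl g)), mulL_ae (incl g) (der (incl f)),
        Lp.coeFn_add (mulL (incl f) (der (incl g))) (mulL (incl g) (der (incl f))),
        rep_ae (dx f), rep_ae (dx g)] with x h1 h2 h3 h4 h5
      rw [h3, Pi.add_apply, h1, h2, der_incl, der_incl, ← h4, ← h5]
      ring

/-- Multiplication in `H¹`. -/
def mulH1 : H1 →L[ℝ] H1 →L[ℝ] H1 :=
  LinearMap.mkContinuous₂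
    (LinearMap.mk₂ ℝ (fun f g => H1.mk _ _ (isWeakDeriv_mulL f g))
      (fun f f' g => by apply H1.ext_val; simp)
      (fun c f g => by apply H1.ext_val; simp)
      (fun f g g' => by apply H1.ext_val; simp)
      (fun c f g => by apply H1.ext_val; simp))
    (3 * normSymP) (fun f g => by
      refine (norm_H1_le _).trans ?_
      simp only [LinearMap.mk₂_apply, val_mk, der_mk]
      have hN := normSymP_nonneg
      have h1 := norm_mulL_le f (val g)
      have h2 := norm_mulL_le f (der g)
      have h3 := norm_mulL_le g (der f)
      have h4 : normSymP * ‖f‖ * ‖val g‖ ≤ normSymP * ‖f‖ * ‖g‖ := by gcongr; exact norm_val_le g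
      have h5 : normSymP * ‖f‖ * ‖der g‖ ≤ normSymP * ‖f‖ * ‖g‖ := by gcongr; exact norm_der_le g
      have h6 : normSymP * ‖g‖ * ‖der f‖ ≤ normSymP * ‖g‖ * ‖f‖ := by gcongr; exact norm_der_le f
      have h7 := norm_add_le (mulL f (der g)) (mulL g (der f))
      linarith)

theorem val_mulH1 (f g : H1) : val (mulH1 f g) = mulL f (val g) := rfl

theorem der_mulH1 (f g : H1) : der (mulH1 f g) = mulL f (der g) + mulL g (der f) := rfl

theorem rep_mulH1 (f g : H1) : rep (mulH1 f g) = fun x => rep f x * rep g x := by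
  refine rep_eq ((rep_continuous f).mul (rep_continuous g)) ?_
  filter_upwards [mulL_ae f (val g), rep_ae g] with x h1 h2
  rw [val_mulH1, h1, ← h2]

theorem norm_mulH1_le (f g : H1) : ‖mulH1 f g‖ ≤ 3 * normSymP * ‖f‖ * ‖g‖ := by
  have h : ‖mulH1‖ ≤ 3 * normSymP :=
    LinearMap.mkContinuous₂_norm_le _ (by have := normSymP_nonneg; positivity) _
  exact (mulH1.le_opNorm₂ f g).trans (by gcongr)

/-- Multiplication in `H²`. -/
def mulH2 : H2 →L[ℝ] H2 →L[ℝ] H2 :=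
  LinearMap.mkContinuous₂
    (LinearMap.mk₂ ℝ (fun f g => H2.mk (mulH1 (incl f) (incl g))
        (mulH1 (dx f) (incl g) + mulH1 (incl f) (dx g)) (by
          rw [der_mulH1, map_add, val_mulH1, val_mulH1, der_incl, der_incl,
            mulL_val_comm (dx f), add_comm]))
      (fun f f' g => by apply H2.ext_incl; simp)
      (fun c f g => by apply H2.ext_incl; simp)
      (fun f g g' => by apply H2.ext_incl; simp)
      (fun c f g => by apply H2.ext_incl; simp))
    (9 * normSymP) (fun f g => by
      refine (norm_H2_le _).trans ?_
      simp only [LinearMap.mk₂_apply, incl_mk, dx_mk]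
      have hN := normSymP_nonneg
      have h1 := norm_mulH1_le (incl f) (incl g)
      have h2 := norm_mulH1_le (dx f) (incl g)
      have h3 := norm_mulH1_le (incl f) (dx g)
      have h4 : 3 * normSymP * ‖incl f‖ * ‖incl g‖ ≤ 3 * normSymP * ‖f‖ * ‖g‖ := by
        gcongr
        exacts [norm_incl_le f, norm_incl_le g]
      have h5 : 3 * normSymP * ‖dx f‖ * ‖incl g‖ ≤ 3 * normSymP * ‖f‖ * ‖g‖ := by
        gcongr
        exacts [norm_dx_le f, norm_incl_le g]
      have h6 : 3 * normSymP * ‖incl f‖ * ‖dx g‖ ≤ 3 * normSymP * ‖f‖ * ‖g‖ := by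
        gcongr
        exacts [norm_incl_le f, norm_dx_le g]
      have h7 := norm_add_le (mulH1 (dx f) (incl g)) (mulH1 (incl f) (dx g))
      linarith)

theorem incl_mulH2 (f g : H2) : incl (mulH2 f g) = mulH1 (incl f) (incl g) := rfl

/-! ### Products and convolutions -/

open Convolution in
-- Transforms of H¹ functions are integrable, so the convolution theorem for L¹ applies to them; the
-- product of the representatives is then the inverse integral of the convolution.
theorem FT_mulH1 (f g : H1) : FT (val (mulH1 f g)) =ᵐ[volume]
    (FT (val f) : ℝ → ℂ) ⋆[ContinuousLinearMap.mul ℂ ℂ] (FT (val g) : ℝ → ℂ) := by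
  have hf := (integrable_FT_and_integral_le f).1
  have hg := (integrable_FT_and_integral_le g).1
  rw [FT_apply]
  refine fourier_ae_eq_of_fourierInv (hf.integrable_convolution _ hg) ?_
  filter_upwards [toC_ae (val (mulH1 f g)), rep_ae (mulH1 f g)] with x h1 h2
  rw [h1, ← h2, rep_mulH1, Complex.ofReal_mul, rep_eq_fourierInv, rep_eq_fourierInv,
    Real.fourierInv_eq_fourier_neg, Real.fourierInv_eq_fourier_neg,
    Real.fourierInv_eq_fourier_neg, Real.fourier_mul_convolution_eq hf hg]

/-- Cauchy-Schwarz with respect to the weight W, obtained by writing W G = W^{1/2} · (W^{1/2} G). -/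
theorem lintegral_mul_sq_le {W G : ℝ → ℝ≥0∞} (hW : AEMeasurable W) (hG : AEMeasurable G) :
    (∫⁻ m, W m * G m) ^ 2 ≤ (∫⁻ m, W m) * ∫⁻ m, W m * G m ^ 2 := by
  have h := ENNReal.lintegral_mul_le_Lp_mul_Lq volume Real.HolderConjugate.two_two
    (f := fun m => W m ^ (1 / 2 : ℝ)) (g := fun m => W m ^ (1 / 2 : ℝ) * G m)
    (hW.pow_const _) ((hW.pow_const _).mul hG)
  have hs : ∀ a : ℝ≥0∞, a ^ (1 / 2 : ℝ) * a ^ (1 / 2 : ℝ) = a := by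
    intro a
    rw [← ENNReal.rpow_add_of_nonneg _ _ (by norm_num) (by norm_num)]
    norm_num
  have hs2 : ∀ a : ℝ≥0∞, (a ^ (1 / 2 : ℝ)) ^ (2 : ℝ) = a := by
    intro a
    rw [← ENNReal.rpow_mul]
    norm_num
  have e1 : ∀ m, (((fun m => W m ^ (1 / 2 : ℝ)) * fun m => W m ^ (1 / 2 : ℝ) * G m) : ℝ → ℝ≥0∞) m
      = W m * G m := by
    intro m
    simp only [Pi.mul_apply]
    rw [← mul_assoc, hs]
  have e2 : ∀ m, (W m ^ (1 / 2 : ℝ) * G m) ^ (2 : ℝ) = W m * G m ^ 2 := by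
    intro m
    rw [ENNReal.mul_rpow_of_nonneg _ _ (by norm_num), hs2, ENNReal.rpow_two]
  simp only [e1, e2, hs2] at h
  calc (∫⁻ m, W m * G m) ^ 2
      ≤ ((∫⁻ m, W m) ^ (1 / 2 : ℝ) * (∫⁻ m, W m * G m ^ 2) ^ (1 / 2 : ℝ)) ^ 2 := by gcongr
    _ = _ := by
      rw [mul_pow, ← ENNReal.rpow_two, ← ENNReal.rpow_two, hs2, hs2]

/-- Young's inequality for the convolution of an integrable and a square integrable function. -/
theorem lintegral_convolution_sq_le {W G : ℝ → ℝ≥0∞} (hW : Measurable W) (hG : Measurable G) :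
    ∫⁻ k, (∫⁻ m, W m * G (k - m)) ^ 2 ≤ (∫⁻ m, W m) ^ 2 * ∫⁻ m, G m ^ 2 := by
  calc ∫⁻ k, (∫⁻ m, W m * G (k - m)) ^ 2
      ≤ ∫⁻ k, (∫⁻ m, W m) * ∫⁻ m, W m * G (k - m) ^ 2 := by
        refine lintegral_mono fun k => ?_
        exact lintegral_mul_sq_le hW.aemeasurable
          (hG.comp (measurable_const.sub measurable_id)).aemeasurable
    _ = (∫⁻ m, W m) * ∫⁻ k, ∫⁻ m, W m * G (k - m) ^ 2 := by
        rw [lintegral_const_mul]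
        refine Measurable.lintegral_prod_right' (f := fun p : ℝ × ℝ => W p.2 * G (p.1 - p.2) ^ 2) ?_
        exact (hW.comp measurable_snd).mul
          ((hG.comp (measurable_fst.sub measurable_snd)).pow_const _)
    _ = (∫⁻ m, W m) * ∫⁻ m, ∫⁻ k, W m * G (k - m) ^ 2 := by
        rw [lintegral_lintegral_swap]
        exact ((hW.comp measurable_snd).mul
          ((hG.comp (measurable_fst.sub measurable_snd)).pow_const _)).aemeasurable
    _ = (∫⁻ m, W m) * ∫⁻ m, W m * ∫⁻ k, G k ^ 2 := by
        congr 1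
        refine lintegral_congr fun m => ?_
        have hm : Measurable fun k => G (k - m) ^ 2 :=
          (hG.comp (measurable_id.sub measurable_const)).pow_const _
        rw [lintegral_const_mul _ hm,
          lintegral_sub_right_eq_self (fun k => G k ^ 2) m]
    _ = _ := by
        rw [lintegral_mul_const _ hW, ← mul_assoc, sq]

/-! ### The commutator of `Q` with a multiplication -/

/-- The commutator `[Q, α] : H² → H¹`. -/
def commQ (α : H2) : H2 →L[ℝ] H1 := QH.comp (mulH2 α) - (mulH1 (incl α)).comp QH

theorem commQ_apply (α f : H2) :
    commQ α f = QH (mulH2 α f) - mulH1 (incl α) (QH f) := rfl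

/-- q(k)² - q(l)² is a difference of squares in 2πk and 2πl; the factor |2πk + 2πl| ≤ q(k) + q(l) is
divided out. -/
theorem abs_qs_sub_le (k l : ℝ) : |qs k - qs l| ≤ |2 * Real.pi * (k - l)| := by
  have h1 := qs_sq k
  have h2 := qs_sq l
  have p1 := qs_pos k
  have p2 := qs_pos l
  have a1 := abs_le_qs k
  have a2 := abs_le_qs l
  have e : (qs k - qs l) * (qs k + qs l) =
      (2 * Real.pi * (k - l)) * (2 * Real.pi * k + 2 * Real.pi * l) := by nlinarith
  have e' : |qs k - qs l| * (qs k + qs l) ≤ |2 * Real.pi * (k - l)| * (qs k + qs l) := by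
    calc |qs k - qs l| * (qs k + qs l) = |(qs k - qs l) * (qs k + qs l)| := by
          rw [abs_mul, abs_of_pos (by positivity : 0 < qs k + qs l)]
      _ = |2 * Real.pi * (k - l)| * |2 * Real.pi * k + 2 * Real.pi * l| := by rw [e, abs_mul]
      _ ≤ _ := by
          gcongr
          exact (abs_add_le _ _).trans (by linarith)
  exact le_of_mul_le_mul_right e' (by positivity)

/-- The kernel estimate behind the commutator bound. With s = |2πm|, the Lipschitz bound gives |q(k)
- q(k-m)| ≤ s and, as q ≥ 1, also q(k) ≤ (1 + s) q(k-m). Finally s + s² ≤ 2(1 + s²) = 2 q(m)². The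
outer factor q(k), which stands for the H¹ norm of the output, is thus shifted to the two inputs. -/
theorem qs_mul_abs_qs_sub_le (k m : ℝ) :
    qs k * |qs k - qs (k - m)| ≤ 2 * qs m ^ 2 * qs (k - m) := by
  have h := abs_qs_sub_le k (k - m)
  rw [sub_sub_cancel] at h
  set s := |2 * Real.pi * m| with hs
  have hs0 : 0 ≤ s := abs_nonneg _
  have hsq : qs m ^ 2 = 1 + s ^ 2 := by rw [qs_sq, hs, sq_abs]
  have p2 := one_le_qs (k - m)
  have h1 : qs k ≤ qs (k - m) * (1 + s) := by
    have := (le_abs_self _).trans h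
    nlinarith
  calc qs k * |qs k - qs (k - m)| ≤ (qs (k - m) * (1 + s)) * s := by
        gcongr
    _ = ((1 + s) * s) * qs (k - m) := by ring
    _ ≤ 2 * qs m ^ 2 * qs (k - m) := by
        rw [hsq]
        refine mul_le_mul_of_nonneg_right ?_ (by linarith)
        nlinarith [sq_nonneg (s - 1)]

/-- The commutator of `Q` with the multiplication by an element of `H³` is bounded in `H¹`. -/
theorem norm_commQ_le {α : H2} {γ : H1} (hγ : der (dx α) = val γ) (f : H2) :
    ‖commQ α f‖ ≤ 2 * normSymP * ‖incl α - γ‖ * ‖incl f‖ := by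
  have hA := (integrable_FT_and_integral_le (incl α)).1
  have hf := (integrable_FT_and_integral_le (incl f)).1
  have hg := (integrable_FT_and_integral_le (QH f)).1
  set A : ℝ → ℂ := ⇑(FT (val (incl α))) with hAdef
  set F : ℝ → ℂ := ⇑(FT (val (incl f))) with hFdef
  set G : ℝ → ℂ := ⇑(FT (val (QH f))) with hGdef
  have hGF : ∀ᵐ k, G k = (qs k : ℂ) * F k := FT_QL2 (incl f)
  -- As γ = α'', the function `incl α - γ` is (1 - ∂ₓ²)α, so its transform carries the factor q(m)²
  -- of the kernel estimate.
  have hAγ : ∀ᵐ k, FT (val (incl α - γ)) k = (qs k : ℂ) ^ 2 * A k := by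
    rw [map_sub]
    filter_upwards [FT_sub_ae (val (incl α)) (val γ),
      (isWeakDeriv_iff _ _).1 (isWeakDeriv_val_der (incl α)),
      (isWeakDeriv_iff _ _).1 (isWeakDeriv_val_der (dx α))] with k h1 h2 h3
    rw [h1, ← hγ, h3, ← der_incl, h2, qs_sq']
    push_cast
    linear_combination (-(2 * Real.pi * k) ^ 2 * A k) * Complex.I_sq
  -- The L¹ factor in Young's inequality, 2 q² |α̂|. The L² factor is q f̂, whose norm is ‖f‖ in H¹.
  set W : ℝ → ℝ≥0∞ := fun m => 2 * ‖FT (val (incl α - γ)) m‖ₑ with hW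
  have hWm : Measurable W :=
    ((Lp.stronglyMeasurable (FT (val (incl α - γ)))).measurable.enorm).const_mul _
  have hGm : Measurable fun k => ‖G k‖ₑ := (Lp.stronglyMeasurable (FT (val (QH f)))).measurable.enorm
  have hbound : ∀ᵐ k, ‖FT (QL2 (commQ α f)) k‖ₑ ≤ ∫⁻ m, W m * ‖G (k - m)‖ₑ := by
    filter_upwards [FT_QL2 (commQ α f), FT_sub_ae (val (QH (mulH2 α f)))
      (val (mulH1 (incl α) (QH f))), FT_QL2 (incl (mulH2 α f)),
      FT_mulH1 (incl α) (incl f), FT_mulH1 (incl α) (QH f),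
      hA.ae_convolution_exists (ContinuousLinearMap.mul ℂ ℂ) hf,
      hA.ae_convolution_exists (ContinuousLinearMap.mul ℂ ℂ) hg] with k h1 h2 h3 h4 h5 i1 i2
    have i1' : Integrable fun m => A m * F (k - m) := i1
    have i2' : Integrable fun m => A m * G (k - m) := i2
    rw [h1, commQ_apply, map_sub, h2, val_QH, h3, incl_mulH2, h4, h5, convolution_def,
      convolution_def]
    simp only [ContinuousLinearMap.mul_apply']
    rw [← integral_const_mul, ← integral_sub (i1'.const_mul _) i2', ← integral_const_mul]
    refine (enorm_integral_le_lintegral_enorm _).trans (lintegral_mono_ae ?_)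
    -- The identity for G holds only almost everywhere, so it is transported along m ↦ k - m, which
    -- preserves null sets.
    have hsh : ∀ᵐ m, G (k - m) = (qs (k - m) : ℂ) * F (k - m) :=
      (quasiMeasurePreserving_sub_left volume k).ae hGF
    filter_upwards [hsh, hAγ] with m h6 h7
    rw [hW]
    simp only
    rw [h7, h6]
    have e : (qs k : ℂ) * (qs k * (A m * F (k - m)) - A m * (qs (k - m) * F (k - m))) =
        ((qs k * (qs k - qs (k - m)) : ℝ) : ℂ) * (A m * F (k - m)) := by push_cast; ring
    rw [e]
    have hr : ‖((qs k * (qs k - qs (k - m)) : ℝ) : ℂ) * (A m * F (k - m))‖ ≤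
        2 * ‖(qs m : ℂ) ^ 2 * A m‖ * ‖(qs (k - m) : ℂ) * F (k - m)‖ := by
      simp only [norm_mul, norm_pow, Complex.norm_real, Real.norm_eq_abs,
        abs_of_pos (qs_pos _)]
      calc qs k * |qs k - qs (k - m)| * (‖A m‖ * ‖F (k - m)‖)
          ≤ 2 * qs m ^ 2 * qs (k - m) * (‖A m‖ * ‖F (k - m)‖) := by
            exact mul_le_mul_of_nonneg_right (qs_mul_abs_qs_sub_le k m) (by positivity)
        _ = _ := by ring
    calc ‖((qs k * (qs k - qs (k - m)) : ℝ) : ℂ) * (A m * F (k - m))‖ₑ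
        = ENNReal.ofReal ‖((qs k * (qs k - qs (k - m)) : ℝ) : ℂ) * (A m * F (k - m))‖ :=
          (ofReal_norm _).symm
      _ ≤ ENNReal.ofReal (2 * ‖(qs m : ℂ) ^ 2 * A m‖ * ‖(qs (k - m) : ℂ) * F (k - m)‖) :=
          ENNReal.ofReal_le_ofReal hr
      _ = _ := by
          rw [ENNReal.ofReal_mul (by positivity), ENNReal.ofReal_mul (by positivity),
            ofReal_norm, ofReal_norm]
          simp
  have hn : ∀ g : LC, ENNReal.ofReal (‖g‖ ^ 2) = ∫⁻ k, ‖g k‖ₑ ^ 2 := by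
    intro g
    rw [ENNReal.ofReal_pow (norm_nonneg _), Lp.norm_def, ENNReal.ofReal_toReal (Lp.eLpNorm_ne_top g),
      eLpNorm_eq_lintegral_rpow_enorm_toReal (by norm_num) (by norm_num), ← ENNReal.rpow_two,
      ← ENNReal.rpow_mul]
    simp
  have hWi : ∫⁻ m, W m ≤ ENNReal.ofReal (2 * normSymP * ‖incl α - γ‖) := by
    obtain ⟨j1, j2⟩ := integrable_FT_and_integral_le (incl α - γ)
    rw [hW, lintegral_const_mul _
      (Lp.stronglyMeasurable (FT (val (incl α - γ)))).measurable.enorm,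
      ← ofReal_integral_norm_eq_lintegral_enorm j1, mul_assoc, ENNReal.ofReal_mul (by norm_num)]
    gcongr
    simp
  have hfin : ENNReal.ofReal (‖commQ α f‖ ^ 2) ≤
      ENNReal.ofReal ((2 * normSymP * ‖incl α - γ‖ * ‖incl f‖) ^ 2) := by
    have hN := normSymP_nonneg
    rw [← norm_QL2, ← norm_FT, hn]
    calc ∫⁻ k, ‖FT (QL2 (commQ α f)) k‖ₑ ^ 2
        ≤ ∫⁻ k, (∫⁻ m, W m * ‖G (k - m)‖ₑ) ^ 2 := by
          refine lintegral_mono_ae ?_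
          filter_upwards [hbound] with k hk
          gcongr
      _ ≤ (∫⁻ m, W m) ^ 2 * ∫⁻ m, ‖G m‖ₑ ^ 2 := lintegral_convolution_sq_le hWm hGm
      _ ≤ (ENNReal.ofReal (2 * normSymP * ‖incl α - γ‖)) ^ 2 * ENNReal.ofReal (‖incl f‖ ^ 2) := by
          rw [hGdef, ← hn, norm_FT, val_QH, norm_QL2]
          gcongr
      _ = _ := by
          rw [← ENNReal.ofReal_pow (by positivity), ← ENNReal.ofReal_mul (by positivity), mul_pow _ ‖incl f‖]
  rw [ENNReal.ofReal_le_ofReal_iff (by positivity)] at hfin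
  have hN := normSymP_nonneg
  exact (sq_le_sq₀ (norm_nonneg _) (by positivity)).1 hfin

/-- The commutator `[Q, α]`, extended to `H¹`. -/
def commExt (α : H2) : H1 →L[ℝ] H1 :=
  LinearMap.extendOfNorm (commQ α).toLinearMap incl.toLinearMap

/-- The extension by density is meaningful because the bound of `norm_commQ_le` involves only the H¹
norm of f; this is where α ∈ H³, witnessed by γ, is needed. -/
theorem commExt_incl {α : H2} {γ : H1} (hγ : der (dx α) = val γ) (f : H2) :
    commExt α (incl f) = commQ α f :=
  LinearMap.extendOfNorm_eq (f := (commQ α).toLinearMap) (e := incl.toLinearMap) denseRange_incl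
    ⟨_, norm_commQ_le hγ⟩ f

theorem norm_commExt_le {α : H2} {γ : H1} (hγ : der (dx α) = val γ) :
    ‖commExt α‖ ≤ 2 * normSymP * ‖incl α - γ‖ :=
  ContinuousLinearMap.opNorm_le_bound _ (by have := normSymP_nonneg; positivity)
    fun x => LinearMap.norm_extendOfNorm_apply_le (f := (commQ α).toLinearMap)
      (e := incl.toLinearMap) denseRange_incl _ (norm_commQ_le hγ) x

theorem commExt_sub {α α' : H2} {γ γ' : H1} (hγ : der (dx α) = val γ)
    (hγ' : der (dx α') = val γ') : commExt α - commExt α' = commExt (α - α') := by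
  have h : der (dx (α - α')) = val (γ - γ') := by simp [hγ, hγ']
  ext1 x
  refine denseRange_incl.induction_on (p := fun x =>
    (commExt α - commExt α') x = commExt (α - α') x) x (isClosed_eq (by fun_prop) (by fun_prop)) ?_
  intro f
  simp only [sub_apply]
  rw [commExt_incl hγ, commExt_incl hγ', commExt_incl h]
  simp only [commQ_apply, map_sub, sub_apply]
  abel

/-! ### First order differential operators -/

/-- The operator `f ↦ α f' + β f` from `H²` to `H¹`. -/
def opL (α β : H1) : H2 →L[ℝ] H1 := (mulH1 α).comp dx + (mulH1 β).comp incl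

/-- The operator `f ↦ α f' + β f` from `H¹` to `L²`. -/
def opLL2 (α β : H1) : H1 →L[ℝ] L2 := (mulL α).comp der + (mulL β).comp val

theorem opL_apply (α β : H1) (f : H2) : opL α β f = mulH1 α (dx f) + mulH1 β (incl f) := rfl

theorem opLL2_apply (α β f : H1) : opLL2 α β f = mulL α (der f) + mulL β (val f) := rfl

theorem opLL2_incl (α β : H1) (f : H2) : opLL2 α β (incl f) = val (opL α β f) := by
  rw [opLL2_apply, opL_apply, map_add, val_mulH1, val_mulH1, der_incl]

theorem rep_opL (α β : H1) (f : H2) :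
    rep (opL α β f) = fun x => rep α x * rep (dx f) x + rep β x * rep (incl f) x := by
  rw [opL_apply, rep_add, rep_mulH1, rep_mulH1]
  rfl

theorem norm_opL_apply_le (α β : H1) (f : H2) :
    ‖opL α β f‖ ≤ 3 * normSymP * (‖α‖ + ‖β‖) * ‖f‖ := by
  have hN := normSymP_nonneg
  rw [opL_apply]
  calc ‖mulH1 α (dx f) + mulH1 β (incl f)‖ ≤ ‖mulH1 α (dx f)‖ + ‖mulH1 β (incl f)‖ := norm_add_le _ _
    _ ≤ 3 * normSymP * ‖α‖ * ‖dx f‖ + 3 * normSymP * ‖β‖ * ‖incl f‖ :=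
        add_le_add (norm_mulH1_le _ _) (norm_mulH1_le _ _)
    _ ≤ 3 * normSymP * ‖α‖ * ‖f‖ + 3 * normSymP * ‖β‖ * ‖f‖ := by
        gcongr
        exacts [norm_dx_le f, norm_incl_le f]
    _ = _ := by ring

/-- The bounded operator `Q L Q⁻¹ - L` for `L f = α f' + β f`. -/
def opB (α β : H2) : H1 →L[ℝ] H1 :=
  (commExt α).comp (dx.comp QinvH) + QH.comp ((mulH2 β).comp QinvH) - mulH1 (incl β)

theorem opB_apply (α β : H2) (x : H1) : opB α β x =
    commExt α (dx (QinvH x)) + QH (mulH2 β (QinvH x)) - mulH1 (incl β) x := rfl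

theorem QH_QinvH (x : H1) : QH (QinvH x) = x := QE.apply_symm_apply x

/-- For x ∈ H² this is the algebra of [Q, α] and Q β Q⁻¹, with ∂ₓ commuting with Q⁻¹. Both sides are
continuous from H¹ to L², so it persists for all x ∈ H¹ although Lx need not lie in H¹ there. -/
theorem QL2_opL_QinvH {α : H2} {γ : H1} (hγ : der (dx α) = val γ) (β : H2) (x : H1) :
    QL2 (opL (incl α) (incl β) (QinvH x)) =
      opLL2 (incl α) (incl β) x + val (opB α β x) := by
  refine denseRange_incl.induction_on (p := fun x => QL2 (opL (incl α) (incl β) (QinvH x)) =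
    opLL2 (incl α) (incl β) x + val (opB α β x)) x
    (isClosed_eq (by fun_prop) (by fun_prop)) ?_
  intro f
  have h1 : opL (incl α) (incl β) (QinvH (incl f)) =
      incl (mulH2 α (QinvH (dx f)) + mulH2 β (QinvH (incl f))) := by
    rw [opL_apply, dx_QinvH_incl, map_add, incl_mulH2, incl_mulH2]
  rw [h1, ← val_QH, opB_apply, dx_QinvH_incl, commExt_incl hγ, commQ_apply, QH_QinvH, opLL2_incl,
    opL_apply, ← map_add]
  congr 1
  rw [map_add]
  abel

/-- Equality of operators including domains, for the maximal realization of L. Since Bx ∈ H¹, the L²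
identity shows that Q L Q⁻¹ x belongs to H¹ exactly when Lx does; injectivity of Q on H¹ identifies
L Q⁻¹ x with the H² element Q⁻¹ z. -/
theorem commutator_iff {α : H2} {γ : H1} (hγ : der (dx α) = val γ) (β : H2) (x z : H1) :
    (∃ y : H2, opLL2 (incl α) (incl β) (incl (QinvH x)) = val (incl y) ∧ QH y = z) ↔
      opLL2 (incl α) (incl β) x = val (z - opB α β x) := by
  have key := QL2_opL_QinvH hγ β x
  rw [opLL2_incl]
  constructor
  · rintro ⟨y, hy, rfl⟩
    rw [H1.ext_val hy, ← val_QH] at key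
    rw [map_sub, key, add_sub_cancel_right]
  · intro h
    rw [h, map_sub, sub_add_cancel] at key
    refine ⟨QinvH z, ?_, QH_QinvH z⟩
    congr 1
    apply QL2_injective
    rw [key, QL2_incl_QinvH]

/-- The operator is linear in (α, β), and bounded in the norms of α ∈ H³ and β ∈ H². This yields
both the uniform bound and the norm continuity of B in t. -/
theorem norm_opB_sub_le {α α' : H2} {γ γ' : H1} (hγ : der (dx α) = val γ)
    (hγ' : der (dx α') = val γ') (β β' : H2) :
    ‖opB α β - opB α' β'‖ ≤ 2 * normSymP * ‖incl (α - α') - (γ - γ')‖ * ‖dx.comp QinvH‖ +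
      ‖QH‖ * (‖mulH2‖ * ‖β - β'‖ * ‖QinvH‖) + ‖mulH1‖ * ‖β - β'‖ := by
  have h : der (dx (α - α')) = val (γ - γ') := by simp [hγ, hγ']
  have e : opB α β - opB α' β' = (commExt (α - α')).comp (dx.comp QinvH) +
      QH.comp ((mulH2 (β - β')).comp QinvH) - mulH1 (incl (β - β')) := by
    rw [← commExt_sub hγ hγ', opB, opB]
    ext1 x
    simp only [sub_apply, add_apply,
      ContinuousLinearMap.comp_apply, map_sub]
    abel
  have hN := normSymP_nonneg
  rw [e]
  refine (norm_sub_le _ _).trans (add_le_add ((norm_add_le _ _).trans (add_le_add ?_ ?_)) ?_)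
  · refine (ContinuousLinearMap.opNorm_comp_le _ _).trans ?_
    gcongr
    exact norm_commExt_le h
  · refine (ContinuousLinearMap.opNorm_comp_le _ _).trans ?_
    gcongr
    refine (ContinuousLinearMap.opNorm_comp_le _ _).trans ?_
    gcongr
    exact mulH2.le_opNorm _
  · refine (mulH1.le_opNorm _).trans ?_
    gcongr
    exact norm_incl_le _

theorem norm_opB_le {α : H2} {γ : H1} (hγ : der (dx α) = val γ) (β : H2) :
    ‖opB α β‖ ≤ 2 * normSymP * ‖incl α - γ‖ * ‖dx.comp QinvH‖ +
      ‖QH‖ * (‖mulH2‖ * ‖β‖ * ‖QinvH‖) + ‖mulH1‖ * ‖β‖ := by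
  have h0 : der (dx (0 : H2)) = val (0 : H1) := by simp
  have hc : commExt 0 = 0 := by simpa using (commExt_sub h0 h0).symm
  have hz : opB 0 0 = 0 := by ext1 x; simp [opB_apply, hc]
  simpa [hz] using norm_opB_sub_le hγ h0 β 0

/-! ### Families of bounded smooth functions -/

/-- A jointly continuous family of functions which are bounded locally uniformly in the parameter. -/
def BddFamily (F : ℝ → ℝ → ℝ) : Prop :=
  Continuous (Function.uncurry F) ∧ ∀ T : ℝ, ∃ C : ℝ, ∀ t, |t| ≤ T → ∀ x, |F t x| ≤ C

/-- Families of `k` times differentiable functions, which together with their derivatives up to the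
order `k` are jointly continuous, and bounded locally uniformly in the parameter. -/
def SmoothFamily : ℕ → (ℝ → ℝ → ℝ) → Prop
  | 0, F => BddFamily F
  | k + 1, F => BddFamily F ∧ (∀ t, Differentiable ℝ (F t)) ∧ SmoothFamily k fun t => deriv (F t)

theorem SmoothFamily.bdd : ∀ {k : ℕ} {F : ℝ → ℝ → ℝ}, SmoothFamily k F → BddFamily F
  | 0, _, h => h
  | _ + 1, _, h => h.1

theorem SmoothFamily.of_succ : ∀ {k : ℕ} {F : ℝ → ℝ → ℝ}, SmoothFamily (k + 1) F → SmoothFamily k F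
  | 0, _, h => h.1
  | _ + 1, _, h => ⟨h.1, h.2.1, of_succ h.2.2⟩

theorem SmoothFamily.mono {k l : ℕ} {F : ℝ → ℝ → ℝ} (h : SmoothFamily k F) (hl : l ≤ k) :
    SmoothFamily l F := by
  induction k, hl using Nat.le_induction with
  | base => exact h
  | succ n _ ih => exact ih h.of_succ

/-- Constructor from explicit derivatives. -/
theorem SmoothFamily.of_hasDerivAt {k : ℕ} {F G : ℝ → ℝ → ℝ} (h : BddFamily F)
    (hd : ∀ t x, HasDerivAt (F t) (G t x) x) (hG : SmoothFamily k G) : SmoothFamily (k + 1) F := by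
  refine ⟨h, fun t x => (hd t x).differentiableAt, ?_⟩
  have : (fun t => deriv (F t)) = G := funext fun t => funext fun x => (hd t x).deriv
  rw [this]
  exact hG

theorem SmoothFamily.hasDerivAt {k : ℕ} {F : ℝ → ℝ → ℝ} (h : SmoothFamily (k + 1) F) (t x : ℝ) :
    HasDerivAt (F t) (deriv (F t) x) x := (h.2.1 t x).hasDerivAt

theorem BddFamily.add {F G : ℝ → ℝ → ℝ} (hF : BddFamily F) (hG : BddFamily G) :
    BddFamily fun t x => F t x + G t x := by
  refine ⟨hF.1.add hG.1, fun T => ?_⟩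
  obtain ⟨C, hC⟩ := hF.2 T
  obtain ⟨C', hC'⟩ := hG.2 T
  exact ⟨C + C', fun t ht x => (abs_add_le _ _).trans (add_le_add (hC t ht x) (hC' t ht x))⟩

theorem BddFamily.mul {F G : ℝ → ℝ → ℝ} (hF : BddFamily F) (hG : BddFamily G) :
    BddFamily fun t x => F t x * G t x := by
  refine ⟨hF.1.mul hG.1, fun T => ?_⟩
  obtain ⟨C, hC⟩ := hF.2 T
  obtain ⟨C', hC'⟩ := hG.2 T
  refine ⟨|C| * |C'|, fun t ht x => ?_⟩
  rw [abs_mul]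
  exact mul_le_mul ((hC t ht x).trans (le_abs_self _)) ((hC' t ht x).trans (le_abs_self _))
    (abs_nonneg _) (abs_nonneg _)

theorem BddFamily.exp {F : ℝ → ℝ → ℝ} (hF : BddFamily F) :
    BddFamily fun t x => Real.exp (F t x) := by
  refine ⟨Real.continuous_exp.comp hF.1, fun T => ?_⟩
  obtain ⟨C, hC⟩ := hF.2 T
  refine ⟨Real.exp C, fun t ht x => ?_⟩
  rw [abs_of_pos (Real.exp_pos _)]
  exact Real.exp_le_exp.2 ((le_abs_self _).trans (hC t ht x))

theorem BddFamily.integral {F : ℝ → ℝ → ℝ} (hF : BddFamily F) :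
    BddFamily fun t x => ∫ s in (0 : ℝ)..t, F s x := by
  refine ⟨?_, fun T => ?_⟩
  · have h1 : Continuous (Function.uncurry fun (p : ℝ × ℝ) (s : ℝ) => F s p.2) :=
      hF.1.comp (continuous_snd.prodMk (continuous_snd.comp continuous_fst))
    exact intervalIntegral.continuous_parametric_intervalIntegral_of_continuous h1 continuous_fst
  · obtain ⟨C, hC⟩ := hF.2 T
    refine ⟨|C| * T, fun t ht x => ?_⟩
    have hs : ∀ s ∈ Set.uIoc 0 t, ‖F s x‖ ≤ |C| := fun s hs => by
      have h1 := abs_sub_left_of_mem_uIcc (uIoc_subset_uIcc hs)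
      rw [sub_zero, sub_zero] at h1
      exact (hC s (h1.trans ht) x).trans (le_abs_self _)
    calc |∫ s in (0 : ℝ)..t, F s x| ≤ |C| * |t - 0| :=
          intervalIntegral.norm_integral_le_of_norm_le_const hs
      _ ≤ |C| * T := by rw [sub_zero]; gcongr

theorem BddFamily.comp {F ψ : ℝ → ℝ → ℝ} (hF : BddFamily F)
    (hψ : Continuous (Function.uncurry ψ)) : BddFamily fun t x => F t (ψ t x) :=
  ⟨hF.1.comp (continuous_fst.prodMk hψ), fun T =>
    let ⟨C, hC⟩ := hF.2 T
    ⟨C, fun t ht _ => hC t ht _⟩⟩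

theorem BddFamily.reparam {F : ℝ → ℝ → ℝ} (hF : BddFamily F) {r : ℝ → ℝ} (hr : Continuous r) :
    BddFamily fun t => F (r t) := by
  refine ⟨hF.1.comp ((hr.comp continuous_fst).prodMk continuous_snd), fun T => ?_⟩
  obtain ⟨M, hM⟩ := isCompact_Icc.exists_bound_of_continuousOn (s := Icc (-T) T) hr.continuousOn
  obtain ⟨C, hC⟩ := hF.2 M
  exact ⟨C, fun t ht x => hC _ (hM t (abs_le.1 ht)) x⟩

theorem SmoothFamily.add : ∀ {k : ℕ} {F G : ℝ → ℝ → ℝ}, SmoothFamily k F → SmoothFamily k G →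
    SmoothFamily k fun t x => F t x + G t x
  | 0, _, _, hF, hG => BddFamily.add hF hG
  | _ + 1, _, _, hF, hG => .of_hasDerivAt (hF.1.add hG.1)
      (fun t x => (hF.hasDerivAt t x).add (hG.hasDerivAt t x)) (hF.2.2.add hG.2.2)

theorem SmoothFamily.mul : ∀ {k : ℕ} {F G : ℝ → ℝ → ℝ}, SmoothFamily k F → SmoothFamily k G →
    SmoothFamily k fun t x => F t x * G t x
  | 0, _, _, hF, hG => BddFamily.mul hF hG
  | _ + 1, _, _, hF, hG => .of_hasDerivAt (hF.1.mul hG.1)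
      (fun t x => (hF.hasDerivAt t x).mul (hG.hasDerivAt t x))
      ((hF.2.2.mul hG.of_succ).add (hF.of_succ.mul hG.2.2))

theorem SmoothFamily.exp : ∀ {k : ℕ} {F : ℝ → ℝ → ℝ}, SmoothFamily k F →
    SmoothFamily k fun t x => Real.exp (F t x)
  | 0, _, hF => BddFamily.exp hF
  | _ + 1, _, hF => .of_hasDerivAt hF.1.exp (fun t x => (hF.hasDerivAt t x).exp)
      (hF.of_succ.exp.mul hF.2.2)

theorem SmoothFamily.const (k : ℕ) (c : ℝ) : SmoothFamily k fun _ _ => c := by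
  induction k generalizing c with
  | zero => exact ⟨continuous_const, fun T => ⟨|c|, fun _ _ _ => le_rfl⟩⟩
  | succ k ih =>
    exact .of_hasDerivAt ⟨continuous_const, fun T => ⟨|c|, fun _ _ _ => le_rfl⟩⟩
      (fun t x => hasDerivAt_const x c) (ih 0)

theorem SmoothFamily.const_mul {k : ℕ} {F : ℝ → ℝ → ℝ} (c : ℝ) (hF : SmoothFamily k F) :
    SmoothFamily k fun t x => c * F t x := (SmoothFamily.const k c).mul hF

theorem SmoothFamily.neg {k : ℕ} {F : ℝ → ℝ → ℝ} (hF : SmoothFamily k F) :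
    SmoothFamily k fun t x => -F t x := by
  simpa using hF.const_mul (-1)

theorem hasDerivAt_integral_family {F : ℝ → ℝ → ℝ} (hF : SmoothFamily 1 F) (t x : ℝ) :
    HasDerivAt (fun x => ∫ s in (0 : ℝ)..t, F s x) (∫ s in (0 : ℝ)..t, deriv (F s) x) x := by
  obtain ⟨C, hC⟩ := hF.2.2.2 |t|
  have hc : ∀ y, Continuous fun s => F s y := fun y => hF.1.1.comp (continuous_id.prodMk continuous_const)
  have hc' : Continuous fun s => deriv (F s) x :=
    hF.2.2.1.comp (continuous_id.prodMk continuous_const)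
  refine (intervalIntegral.hasDerivAt_integral_of_dominated_loc_of_deriv_le (s := univ)
    (F := fun x s => F s x) (F' := fun x s => deriv (F s) x) (bound := fun _ => C)
    univ_mem ?_ ((hc x).intervalIntegrable _ _) hc'.aestronglyMeasurable ?_
    intervalIntegrable_const ?_).2
  · exact Eventually.of_forall fun y => (hc y).aestronglyMeasurable
  · refine ae_of_all _ fun s hs y _ => hC s ?_ y
    simpa using abs_sub_left_of_mem_uIcc (uIoc_subset_uIcc hs)
  · exact ae_of_all _ fun s _ y _ => hF.hasDerivAt s y

theorem SmoothFamily.integral : ∀ {k : ℕ} {F : ℝ → ℝ → ℝ}, SmoothFamily k F →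
    SmoothFamily k fun t x => ∫ s in (0 : ℝ)..t, F s x
  | 0, _, hF => BddFamily.integral hF
  | _ + 1, _, hF => .of_hasDerivAt hF.1.integral
      (fun t x => hasDerivAt_integral_family (hF.mono (by omega)) t x) hF.2.2.integral

/-- Only the derivative of ψ must be a bounded family: the flow itself is unbounded, so it is not a
`SmoothFamily`. -/
theorem SmoothFamily.comp : ∀ {k : ℕ} {F ψ : ℝ → ℝ → ℝ}, SmoothFamily (k + 1) F →
    Continuous (Function.uncurry ψ) → (∀ t, Differentiable ℝ (ψ t)) →
    SmoothFamily k (fun t => deriv (ψ t)) → SmoothFamily (k + 1) fun t x => F t (ψ t x)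
  | 0, _, ψ, hF, h1, h2, h3 => .of_hasDerivAt (hF.1.comp h1)
      (fun t x => (hF.hasDerivAt t (ψ t x)).comp x (h2 t x).hasDerivAt)
      (BddFamily.mul (BddFamily.comp hF.2.2 h1) h3)
  | _ + 1, _, ψ, hF, h1, h2, h3 => .of_hasDerivAt (hF.1.comp h1)
      (fun t x => (hF.hasDerivAt t (ψ t x)).comp x (h2 t x).hasDerivAt)
      ((comp hF.2.2 h1 h2 h3.of_succ).mul h3)

theorem SmoothFamily.reparam : ∀ {k : ℕ} {F : ℝ → ℝ → ℝ}, SmoothFamily k F → ∀ {r : ℝ → ℝ},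
    Continuous r → SmoothFamily k fun t => F (r t)
  | 0, _, hF, _, hr => BddFamily.reparam hF hr
  | _ + 1, _, hF, _, hr => ⟨hF.1.reparam hr, fun _ => hF.2.1 _, hF.2.2.reparam hr⟩

/-- Bounded functions with bounded derivatives up to the order `k`. -/
abbrev Cb (k : ℕ) (f : ℝ → ℝ) : Prop := SmoothFamily k fun _ => f

theorem MemCb.cb {n : ℕ} {f : ℝ → ℝ} (h : MemCb n f) : Cb n f := by
  induction n generalizing f with
  | zero =>
    obtain ⟨C, hC⟩ := h.2 0 le_rfl
    exact ⟨h.1.continuous.comp continuous_snd, fun _ => ⟨C, fun _ _ x => by simpa using hC x⟩⟩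
  | succ n ih =>
    obtain ⟨C, hC⟩ := h.2 0 (by omega)
    have h1 : ContDiff ℝ (n + 1 : ℕ) f := h.1
    have h2 := (contDiff_succ_iff_deriv (n := n)).1 (by exact_mod_cast h1)
    refine ⟨⟨h.1.continuous.comp continuous_snd, fun _ => ⟨C, fun _ _ x => by simpa using hC x⟩⟩,
      fun _ => h2.1, ih ⟨h2.2.2, fun m hm => ?_⟩⟩
    obtain ⟨C', hC'⟩ := h.2 (m + 1) (by omega)
    exact ⟨C', fun x => by rw [← iteratedDeriv_succ']; exact hC' x⟩

theorem Cb.continuous {k : ℕ} {f : ℝ → ℝ} (h : Cb k f) : Continuous f :=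
  (SmoothFamily.bdd h).1.comp (continuous_const (y := (0 : ℝ)) |>.prodMk continuous_id)

theorem Cb.bound {k : ℕ} {f : ℝ → ℝ} (h : Cb k f) : ∃ C, 0 ≤ C ∧ ∀ x, |f x| ≤ C := by
  obtain ⟨C, hC⟩ := (SmoothFamily.bdd h).2 0
  exact ⟨C, (abs_nonneg _).trans (hC 0 (by simp) 0), hC 0 (by simp)⟩

theorem SmoothFamily.freeze {k : ℕ} {F : ℝ → ℝ → ℝ} (h : SmoothFamily k F) (t : ℝ) : Cb k (F t) :=
  h.reparam (r := fun _ => t) continuous_const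

/-! ### The flow of a vector field -/

section Flow

variable {ξ : ℝ → ℝ}

theorem Cb.lipschitz (hξ : Cb 1 ξ) : ∃ K : ℝ≥0, LipschitzWith K ξ ∧ ∀ x, |deriv ξ x| ≤ K := by
  obtain ⟨C, h0, hC⟩ := Cb.bound (k := 0) (f := deriv ξ) hξ.2.2
  refine ⟨⟨C, h0⟩, lipschitzWith_of_nnnorm_deriv_le (hξ.2.1 0) fun x => hC x, hC⟩

/-- A field bounded by M moves a point by at most M(n+1) in time n+1. Picard-Lindelöf on a ball of
that radius therefore reaches the whole interval with no smallness condition. -/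
theorem exists_local_solution (hξ : Cb 1 ξ) (x : ℝ) (n : ℕ) : ∃ γ : ℝ → ℝ, γ 0 = x ∧
    ∀ t ∈ Ioo (-(n + 1 : ℝ)) (n + 1), HasDerivAt γ (ξ (γ t)) t := by
  obtain ⟨K, hK, -⟩ := hξ.lipschitz
  obtain ⟨M, hM0, hM⟩ := Cb.bound hξ
  have hn : (0 : ℝ) ≤ n + 1 := by positivity
  have hpl : IsPicardLindelof (fun _ => ξ) (tmin := -(n + 1 : ℝ)) (tmax := n + 1)
      ⟨0, by linarith, hn⟩ x (⟨M, hM0⟩ * ⟨n + 1, hn⟩) 0 ⟨M, hM0⟩ K := by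
    refine .of_time_independent (fun y _ => hM y) hK.lipschitzOnWith ?_
    simp
    rfl
  obtain ⟨γ, h1, h2⟩ := hpl.exists_eq_forall_mem_Icc_hasDerivWithinAt₀
  exact ⟨γ, h1, fun t ht => (h2 t (Ioo_subset_Icc_self ht)).hasDerivAt (Icc_mem_nhds ht.1 ht.2)⟩

theorem exists_solution (hξ : Cb 1 ξ) (x : ℝ) :
    ∃ γ : ℝ → ℝ, γ 0 = x ∧ ∀ s, HasDerivAt γ (ξ (γ s)) s := by
  obtain ⟨K, hK, -⟩ := hξ.lipschitz
  choose γ h0 h1 using exists_local_solution hξ x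
  have agree : ∀ m n : ℕ, m ≤ n → ∀ t ∈ Ioo (-(m + 1 : ℝ)) (m + 1), γ m t = γ n t := by
    intro m n hmn
    have hmn' : (m : ℝ) ≤ n := by exact_mod_cast hmn
    refine ODE_solution_unique_of_mem_Ioo (v := fun _ => ξ) (s := fun _ => univ) (t₀ := 0)
      (fun t _ => hK.lipschitzOnWith) ⟨by linarith [(Nat.cast_nonneg m : (0 : ℝ) ≤ m)], by positivity⟩
      (fun t ht => ⟨h1 m t ht, trivial⟩)
      (fun t ht => ⟨h1 n t ⟨by linarith [ht.1], by linarith [ht.2]⟩, trivial⟩) (by rw [h0, h0])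
  have hfl : ∀ t : ℝ, t ∈ Ioo (-((⌊|t|⌋₊ : ℝ) + 1)) (⌊|t|⌋₊ + 1) := fun t =>
    abs_lt.1 (Nat.lt_floor_add_one |t|)
  -- The local solution with index ⌊|t|⌋ lives on the interval of radius ⌊|t|⌋ + 1, which contains t
  -- in its interior. Near s the indices that occur are at most ⌊|s|⌋, so by `agree` the glued curve
  -- equals one local solution there.
  refine ⟨fun t => γ ⌊|t|⌋₊ t, by simp [h0], fun s => ?_⟩
  set N := ⌊|s|⌋₊ with hN
  have hev : (fun t => γ ⌊|t|⌋₊ t) =ᶠ[𝓝 s] γ N := by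
    filter_upwards [Ioo_mem_nhds (hfl s).1 (hfl s).2] with t ht
    refine agree _ _ ?_ t (hfl t)
    have h3 : |t| < N + 1 := abs_lt.2 ht
    have : ⌊|t|⌋₊ < N + 1 := (Nat.floor_lt (abs_nonneg _)).2 (by exact_mod_cast h3)
    omega
  exact (h1 N s (hfl s)).congr_of_eventuallyEq hev

theorem flow_zero (hξ : Cb 1 ξ) (x : ℝ) : flow ξ 0 x = x := by
  rw [flow, dif_pos (exists_solution hξ x)]
  exact (exists_solution hξ x).choose_spec.1

theorem hasDerivAt_flow (hξ : Cb 1 ξ) (t x : ℝ) :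
    HasDerivAt (fun t => flow ξ t x) (ξ (flow ξ t x)) t := by
  simp only [flow, dif_pos (exists_solution hξ x)]
  exact (exists_solution hξ x).choose_spec.2 t

theorem flow_unique (hξ : Cb 1 ξ) {γ : ℝ → ℝ} (h : ∀ s, HasDerivAt γ (ξ (γ s)) s) (t : ℝ) :
    γ t = flow ξ t (γ 0) := by
  obtain ⟨K, hK, -⟩ := hξ.lipschitz
  exact congrFun (ODE_solution_unique_univ (v := fun _ => ξ) (s := fun _ => univ) (t₀ := 0)
    (fun t => hK.lipschitzOnWith) (fun t => ⟨h t, trivial⟩)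
    (fun t => ⟨hasDerivAt_flow hξ t (γ 0), trivial⟩) (flow_zero hξ (γ 0)).symm) t

theorem flow_add (hξ : Cb 1 ξ) (s t x : ℝ) : flow ξ (s + t) x = flow ξ s (flow ξ t x) := by
  have h := flow_unique hξ (γ := fun s => flow ξ (s + t) x)
    (fun s => (hasDerivAt_flow hξ (s + t) x).comp_add_const s t) s
  simpa using h

theorem flow_neg_flow (hξ : Cb 1 ξ) (t x : ℝ) : flow ξ (-t) (flow ξ t x) = x := by
  rw [← flow_add hξ, neg_add_cancel, flow_zero hξ]

theorem flow_flow_neg (hξ : Cb 1 ξ) (t x : ℝ) : flow ξ t (flow ξ (-t) x) = x := by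
  rw [← flow_add hξ, add_neg_cancel, flow_zero hξ]

theorem continuous_flow_time (hξ : Cb 1 ξ) (x : ℝ) : Continuous fun t => flow ξ t x :=
  continuous_iff_continuousAt.2 fun t => (hasDerivAt_flow hξ t x).continuousAt

theorem abs_flow_sub_flow_le (hξ : Cb 1 ξ) {M : ℝ} (hM : ∀ x, |ξ x| ≤ M) (s t x : ℝ) :
    |flow ξ t x - flow ξ s x| ≤ M * |t - s| := by
  have := Convex.norm_image_sub_le_of_norm_hasDerivWithin_le (s := univ) (C := M)
    (f := fun t => flow ξ t x) (x := s) (y := t)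
    (fun t _ => (hasDerivAt_flow hξ t x).hasDerivWithinAt) (fun t _ => hM _) convex_univ
    trivial trivial
  exact this

/-- The difference quotient of a continuously differentiable function, as a continuous function. -/
def diffQuot (ξ : ℝ → ℝ) (a b : ℝ) : ℝ := ∫ r in (0 : ℝ)..1, deriv ξ (a + r * (b - a))

theorem diffQuot_mul (hξ : Cb 1 ξ) (a b : ℝ) : ξ b - ξ a = diffQuot ξ a b * (b - a) := by
  have hc : Continuous (deriv ξ) := Cb.continuous (k := 0) hξ.2.2
  have h := intervalIntegral.integral_unitInterval_deriv_eq_sub (𝕜 := ℝ) (z₀ := a) (z₁ := b - a)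
    (f := ξ) (f' := deriv ξ) (by fun_prop) (fun r _ => hξ.hasDerivAt 0 _)
  simp only [smul_eq_mul, add_sub_cancel] at h
  rw [diffQuot, ← h, mul_comm]

theorem diffQuot_self (a : ℝ) : diffQuot ξ a a = deriv ξ a := by simp [diffQuot]

theorem continuous_diffQuot (hξ : Cb 1 ξ) : Continuous (Function.uncurry (diffQuot ξ)) := by
  have hc : Continuous (deriv ξ) := Cb.continuous (k := 0) hξ.2.2
  exact intervalIntegral.continuous_parametric_intervalIntegral_of_continuous'
    (f := fun (p : ℝ × ℝ) r => deriv ξ (p.1 + r * (p.2 - p.1)))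
    (by simp only [Function.uncurry_def]; fun_prop) _ _

theorem abs_diffQuot_le {K : ℝ} (hK : ∀ x, |deriv ξ x| ≤ K) (a b : ℝ) : |diffQuot ξ a b| ≤ K := by
  have := intervalIntegral.norm_integral_le_of_norm_le_const (a := 0) (b := 1)
    (f := fun r => deriv ξ (a + r * (b - a))) (C := K) (fun r _ => hK _)
  simpa [diffQuot] using this

/-- The difference w of two trajectories solves the linear equation w' = θ(t) w, where θ is the
difference quotient of ξ along them. This exact formula gives the Lipschitz bound and the derivative
in the initial value at once. -/
theorem flow_sub_flow (hξ : Cb 1 ξ) (t x y : ℝ) : flow ξ t y - flow ξ t x =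
    (y - x) * Real.exp (∫ s in (0 : ℝ)..t, diffQuot ξ (flow ξ s x) (flow ξ s y)) := by
  set θ : ℝ → ℝ := fun s => diffQuot ξ (flow ξ s x) (flow ξ s y) with hθ
  have hc : Continuous θ := (continuous_diffQuot hξ).comp
    ((continuous_flow_time hξ x).prodMk (continuous_flow_time hξ y))
  -- Integrating factor: g has zero derivative and hence equals its initial value y - x.
  set g : ℝ → ℝ := fun t => (flow ξ t y - flow ξ t x) * Real.exp (-∫ s in (0 : ℝ)..t, θ s) with hg
  have hd : ∀ t, HasDerivAt g 0 t := by
    intro t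
    have h1 := (hasDerivAt_flow hξ t y).sub (hasDerivAt_flow hξ t x)
    have h2 : HasDerivAt (fun t => ∫ s in (0 : ℝ)..t, θ s) (θ t) t :=
      intervalIntegral.integral_hasDerivAt_right (hc.intervalIntegrable _ _)
        hc.stronglyMeasurable.stronglyMeasurableAtFilter hc.continuousAt
    have h3 := h1.mul h2.neg.exp
    convert! h3 using 1
    rw [diffQuot_mul hξ]
    simp only [hθ, Pi.sub_apply]
    ring
  have hconst : g t = g 0 := is_const_of_deriv_eq_zero
    (fun t => (hd t).differentiableAt) (fun t => (hd t).deriv) t 0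
  simp only [hg, intervalIntegral.integral_same, neg_zero, Real.exp_zero, mul_one,
    flow_zero hξ] at hconst
  rw [← hconst, mul_assoc, ← Real.exp_add, neg_add_cancel, Real.exp_zero, mul_one]

theorem abs_flow_sub_le (hξ : Cb 1 ξ) {K : ℝ} (hK : ∀ x, |deriv ξ x| ≤ K) (t x y : ℝ) :
    |flow ξ t y - flow ξ t x| ≤ Real.exp (K * |t|) * |y - x| := by
  rw [flow_sub_flow hξ, abs_mul, mul_comm, abs_of_pos (Real.exp_pos _)]
  gcongr
  have := intervalIntegral.norm_integral_le_of_norm_le_const (a := 0) (b := t)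
    (f := fun s => diffQuot ξ (flow ξ s x) (flow ξ s y)) (C := K) (fun r _ => abs_diffQuot_le hK _ _)
  rw [sub_zero] at this
  exact (le_abs_self _).trans this

theorem continuous_flow (hξ : Cb 1 ξ) : Continuous (Function.uncurry (flow ξ)) := by
  obtain ⟨K, -, hK⟩ := hξ.lipschitz
  obtain ⟨M, -, hM⟩ := Cb.bound hξ
  rw [continuous_iff_continuousAt]
  rintro ⟨t, x⟩
  rw [ContinuousAt, tendsto_iff_norm_sub_tendsto_zero]
  refine squeeze_zero (fun _ => norm_nonneg _)
    (g := fun p : ℝ × ℝ => M * |p.1 - t| + Real.exp (K * |t|) * |p.2 - x|) ?_ ?_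
  · rintro ⟨s, y⟩
    calc |flow ξ s y - flow ξ t x| = |(flow ξ s y - flow ξ t y) + (flow ξ t y - flow ξ t x)| := by
          ring_nf
      _ ≤ _ := (abs_add_le _ _).trans
          (add_le_add (abs_flow_sub_flow_le hξ hM t s y) (abs_flow_sub_le hξ hK t x y))
  · have : Continuous fun p : ℝ × ℝ => M * |p.1 - t| + Real.exp (K * |t|) * |p.2 - x| := by fun_prop
    simpa using this.tendsto (t, x)

/-- The derivative of the flow with respect to the initial value. -/
def flowDeriv (ξ : ℝ → ℝ) (t x : ℝ) : ℝ := Real.exp (∫ s in (0 : ℝ)..t, deriv ξ (flow ξ s x))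

/-- By `flow_sub_flow` the slope is the exponential of an integral that is continuous in y up to y =
x, where the difference quotient becomes ξ'. -/
theorem hasDerivAt_flow_space (hξ : Cb 1 ξ) (t x : ℝ) :
    HasDerivAt (flow ξ t) (flowDeriv ξ t x) x := by
  rw [hasDerivAt_iff_tendsto_slope]
  have h1 : Continuous fun y =>
      Real.exp (∫ s in (0 : ℝ)..t, diffQuot ξ (flow ξ s x) (flow ξ s y)) := by
    refine Real.continuous_exp.comp
      (intervalIntegral.continuous_parametric_intervalIntegral_of_continuous'
      (f := fun y s => diffQuot ξ (flow ξ s x) (flow ξ s y)) ?_ _ _)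
    exact (continuous_diffQuot hξ).comp (((continuous_flow_time hξ x).comp continuous_snd).prodMk
      ((continuous_flow hξ).comp (continuous_snd.prodMk continuous_fst)))
  have h2 := (h1.tendsto x).mono_left (nhdsWithin_le_nhds (s := {x}ᶜ))
  simp only [diffQuot_self] at h2
  refine h2.congr' ?_
  filter_upwards [self_mem_nhdsWithin] with y hy
  rw [slope_def_field, flow_sub_flow hξ, mul_div_cancel_left₀ _ (sub_ne_zero.2 hy)]

theorem deriv_flow_space (hξ : Cb 1 ξ) : (fun t => deriv (flow ξ t)) = flowDeriv ξ :=
  funext fun t => funext fun x => (hasDerivAt_flow_space hξ t x).deriv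

theorem differentiable_flow (hξ : Cb 1 ξ) (t : ℝ) : Differentiable ℝ (flow ξ t) :=
  fun x => (hasDerivAt_flow_space hξ t x).differentiableAt

/-- Bootstrap on log φ_t' = ∫₀ᵗ ξ'(φ_s) ds: k derivatives of the right side need only k - 1
derivatives of φ_s'. -/
theorem smoothFamily_flowDeriv {k : ℕ} (hξ : Cb (k + 1) ξ) : SmoothFamily k (flowDeriv ξ) := by
  induction k with
  | zero => exact ((BddFamily.comp hξ.2.2 (continuous_flow hξ)).integral).exp
  | succ k ih =>
    have h1 : Cb 1 ξ := hξ.mono (by omega)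
    refine (SmoothFamily.comp (F := fun _ => deriv ξ) hξ.2.2 (continuous_flow h1)
      (differentiable_flow h1) ?_).integral.exp
    rw [deriv_flow_space h1]
    exact ih hξ.of_succ

/-- Composition of a smooth family with the flow, run with a variable time. -/
theorem SmoothFamily.comp_flow {k : ℕ} {F : ℝ → ℝ → ℝ} (hF : SmoothFamily k F)
    (h1 : Cb 1 ξ) (hξ : Cb k ξ) {r : ℝ → ℝ} (hr : Continuous r) :
    SmoothFamily k fun t x => F t (flow ξ (r t) x) := by
  have hc : Continuous (Function.uncurry fun t => flow ξ (r t)) :=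
    (continuous_flow h1).comp ((hr.comp continuous_fst).prodMk continuous_snd)
  cases k with
  | zero => exact BddFamily.comp hF hc
  | succ k =>
    refine SmoothFamily.comp hF hc (fun t => differentiable_flow h1 _) ?_
    have : (fun t => deriv (flow ξ (r t))) = fun t => flowDeriv ξ (r t) :=
      funext fun t => congrFun (deriv_flow_space h1) (r t)
    rw [this]
    exact (smoothFamily_flowDeriv hξ).reparam hr

theorem abs_flowDeriv_le {K : ℝ} (hK : ∀ x, |deriv ξ x| ≤ K) (t x : ℝ) :
    |flowDeriv ξ t x| ≤ Real.exp (K * |t|) := by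
  rw [flowDeriv, abs_of_pos (Real.exp_pos _)]
  gcongr
  have := intervalIntegral.norm_integral_le_of_norm_le_const (a := 0) (b := t)
    (f := fun s => deriv ξ (flow ξ s x)) (C := K) (fun r _ => hK _)
  rw [sub_zero] at this
  exact (le_abs_self _).trans this

end Flow

/-! ### Strongly continuous families of operators -/

section SOC

variable {E F G : Type*} [NormedAddCommGroup E] [NormedSpace ℝ E] [NormedAddCommGroup F]
  [NormedSpace ℝ F] [NormedAddCommGroup G] [NormedSpace ℝ G]

/-- Families of bounded operators which are bounded locally uniformly in the parameter. -/
def LocBdd (T : ℝ → E →L[ℝ] F) : Prop := ∀ M : ℝ, ∃ C : ℝ, 0 ≤ C ∧ ∀ t, |t| ≤ M → ∀ x, ‖T t x‖ ≤ C * ‖x‖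

/-- Strongly continuous, locally bounded families of operators. -/
def SOC (T : ℝ → E →L[ℝ] F) : Prop := Continuous (fun p : ℝ × E => T p.1 p.2) ∧ LocBdd T

/-- Strong continuity of a locally bounded family has to be checked on a dense set only. -/
theorem SOC.of_dense {T : ℝ → E →L[ℝ] F} (hb : LocBdd T) {s : Set E} (hs : Dense s)
    (h : ∀ x ∈ s, Continuous fun t => T t x) : SOC T := by
  refine ⟨continuous_iff_continuousAt.2 ?_, hb⟩
  rintro ⟨t, x⟩
  obtain ⟨C, hC0, hC⟩ := hb (|t| + 1)
  rw [Metric.continuousAt_iff']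
  intro ε hε
  set δ := ε / (4 * (C + 1)) with hδ
  have hC1 : 0 < C + 1 := by linarith
  have hδ0 : 0 < δ := by positivity
  obtain ⟨y, hy, hys⟩ := Metric.mem_closure_iff.1 (hs x) δ hδ0
  have e1 : ∀ᶠ p : ℝ × E in 𝓝 (t, x), ‖p.2 - x‖ < δ := by
    have : Continuous fun p : ℝ × E => ‖p.2 - x‖ := by fun_prop
    have h2 := this.tendsto (t, x)
    simp only [sub_self, norm_zero] at h2
    exact h2.eventually (gt_mem_nhds hδ0)
  have e2 : ∀ᶠ p : ℝ × E in 𝓝 (t, x), |p.1| ≤ |t| + 1 := by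
    have : Continuous fun p : ℝ × E => |p.1| := by fun_prop
    exact (this.tendsto (t, x)).eventually (ge_mem_nhds (by simp))
  have e3 : ∀ᶠ p : ℝ × E in 𝓝 (t, x), ‖T p.1 y - T t y‖ < ε / 4 := by
    have : Continuous fun p : ℝ × E => ‖T p.1 y - T t y‖ :=
      (((h y hy).comp continuous_fst).sub continuous_const).norm
    have h2 := this.tendsto (t, x)
    simp only [sub_self, norm_zero] at h2
    exact h2.eventually (gt_mem_nhds (by positivity))
  filter_upwards [e1, e2, e3] with p h1 h2 h3
  have hCδ : C * δ < ε / 4 := by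
    rw [hδ, mul_div_assoc', div_lt_div_iff₀ (by positivity) (by norm_num)]
    nlinarith
  have hxy : ‖x - y‖ < δ := by rwa [dist_eq_norm] at hys
  have k1 : ‖T p.1 (p.2 - x)‖ ≤ C * δ := (hC _ h2 _).trans (by gcongr)
  have k2 : ‖T p.1 (x - y)‖ ≤ C * δ := (hC _ h2 _).trans (by gcongr)
  have k3 : ‖T t (x - y)‖ ≤ C * δ := (hC _ (by simp) _).trans (by gcongr)
  have e : T p.1 p.2 - T t x =
      T p.1 (p.2 - x) + T p.1 (x - y) + (T p.1 y - T t y) - T t (x - y) := by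
    simp only [map_sub]; abel
  rw [dist_eq_norm, e]
  calc _ ≤ ‖T p.1 (p.2 - x) + T p.1 (x - y) + (T p.1 y - T t y)‖ + ‖T t (x - y)‖ := norm_sub_le _ _
    _ ≤ ‖T p.1 (p.2 - x)‖ + ‖T p.1 (x - y)‖ + ‖T p.1 y - T t y‖ + ‖T t (x - y)‖ := by
        gcongr
        exact norm_add₃_le
    _ < ε := by linarith

theorem SOC.of_forall {T : ℝ → E →L[ℝ] F} (hb : LocBdd T) (h : ∀ x, Continuous fun t => T t x) :
    SOC T := .of_dense hb dense_univ fun x _ => h x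

theorem SOC.apply {T : ℝ → E →L[ℝ] F} (hT : SOC T) {X : Type*} [TopologicalSpace X] {r : X → ℝ}
    {g : X → E} (hr : Continuous r) (hg : Continuous g) : Continuous fun a => T (r a) (g a) :=
  hT.1.comp (hr.prodMk hg)

theorem SOC.apply_const {T : ℝ → E →L[ℝ] F} (hT : SOC T) (x : E) : Continuous fun t => T t x :=
  hT.apply continuous_id continuous_const

theorem LocBdd.comp {T : ℝ → F →L[ℝ] G} {S : ℝ → E →L[ℝ] F} (hT : LocBdd T) (hS : LocBdd S) :
    LocBdd fun t => (T t).comp (S t) := fun M => by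
  obtain ⟨C, hC0, hC⟩ := hT M
  obtain ⟨D, hD0, hD⟩ := hS M
  refine ⟨C * D, by positivity, fun t ht x => (hC t ht _).trans ?_⟩
  rw [mul_assoc]
  gcongr
  exact hD t ht x

theorem LocBdd.add {T S : ℝ → E →L[ℝ] F} (hT : LocBdd T) (hS : LocBdd S) :
    LocBdd fun t => T t + S t := fun M => by
  obtain ⟨C, hC0, hC⟩ := hT M
  obtain ⟨D, hD0, hD⟩ := hS M
  refine ⟨C + D, by positivity, fun t ht x => ?_⟩
  rw [add_mul]
  exact (norm_add_le _ _).trans (add_le_add (hC t ht x) (hD t ht x))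

theorem LocBdd.reparam {T : ℝ → E →L[ℝ] F} (hT : LocBdd T) {r : ℝ → ℝ} (hr : Continuous r) :
    LocBdd fun t => T (r t) := fun M => by
  obtain ⟨N, hN⟩ := isCompact_Icc.exists_bound_of_continuousOn (s := Icc (-M) M) hr.continuousOn
  obtain ⟨C, hC0, hC⟩ := hT N
  exact ⟨C, hC0, fun t ht x => hC _ (hN t (abs_le.1 ht)) x⟩

/-- Joint continuity in (t, x) is built into `SOC` precisely so that products of strongly continuous
families need no further argument. -/
theorem SOC.comp {T : ℝ → F →L[ℝ] G} {S : ℝ → E →L[ℝ] F} (hT : SOC T) (hS : SOC S) :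
    SOC fun t => (T t).comp (S t) := ⟨hT.apply continuous_fst hS.1, hT.2.comp hS.2⟩

theorem SOC.add {T S : ℝ → E →L[ℝ] F} (hT : SOC T) (hS : SOC S) :
    SOC fun t => T t + S t := ⟨hT.1.add hS.1, hT.2.add hS.2⟩

theorem SOC.reparam {T : ℝ → E →L[ℝ] F} (hT : SOC T) {r : ℝ → ℝ} (hr : Continuous r) :
    SOC fun t => T (r t) := ⟨hT.apply (hr.comp continuous_fst) continuous_snd, hT.2.reparam hr⟩

theorem SOC.const (T : E →L[ℝ] F) : SOC fun _ => T :=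
  ⟨T.continuous.comp continuous_snd, fun _ => ⟨‖T‖, norm_nonneg _, fun _ _ => T.le_opNorm⟩⟩

/-- A family with values in `H¹` given by strongly continuous components. -/
theorem SOC.of_components {T : ℝ → E →L[ℝ] H1} (h0 : SOC fun t => val.comp (T t))
    (h1 : SOC fun t => der.comp (T t)) : SOC T := by
  refine ⟨continuous_H1 h0.1 h1.1, fun M => ?_⟩
  obtain ⟨C, hC0, hC⟩ := h0.2 M
  obtain ⟨D, hD0, hD⟩ := h1.2 M
  refine ⟨C + D, by positivity, fun t ht x => (norm_H1_le _).trans ?_⟩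
  rw [add_mul]
  exact add_le_add (hC t ht x) (hD t ht x)

end SOC

/-! ### Multiplication and composition operators in `L²` -/

/-- Dominated convergence in `L²`. -/
theorem continuous_L2_of_dominated {g : ℝ → L2} {G : ℝ → ℝ → ℝ} (hg : ∀ t, g t =ᵐ[volume] G t)
    (hc : ∀ x, Continuous fun t => G t x)
    (hb : ∀ M : ℝ, ∃ B : ℝ → ℝ, MemLp B 2 ∧ ∀ t, |t| ≤ M → ∀ x, |G t x| ≤ B x) :
    Continuous g := by
  refine continuous_iff_continuousAt.2 fun s => ?_
  obtain ⟨B, hB, hB'⟩ := hb (|s| + 1)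
  rw [ContinuousAt, tendsto_iff_norm_sub_tendsto_zero]
  have hn : ∀ t, ‖g t - g s‖ ^ 2 = ∫ x, (G t x - G s x) ^ 2 := by
    intro t
    rw [← real_inner_self_eq_norm_sq, inner_L2]
    refine integral_congr_ae ?_
    filter_upwards [Lp.coeFn_sub (g t) (g s), hg t, hg s] with x h1 h2 h3
    rw [h1, Pi.sub_apply, h2, h3, sq]
  have hlim : Tendsto (fun t => ∫ x, (G t x - G s x) ^ 2) (𝓝 s) (𝓝 (∫ _x : ℝ, (0 : ℝ))) := by
    refine tendsto_integral_filter_of_dominated_convergence (fun x => 4 * B x ^ 2) ?_ ?_ ?_ ?_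
    · refine Eventually.of_forall fun t => ?_
      have h1 : ∀ t, AEStronglyMeasurable (G t) volume := fun t =>
        (Lp.aestronglyMeasurable (g t)).congr (hg t)
      exact ((h1 t).sub (h1 s)).pow 2
    · have : ∀ᶠ t in 𝓝 s, |t| ≤ |s| + 1 :=
        (continuous_abs.tendsto s).eventually (ge_mem_nhds (by simp))
      filter_upwards [this] with t ht
      refine ae_of_all _ fun x => ?_
      have k1 := abs_le.1 (hB' t ht x)
      have k2 := abs_le.1 (hB' s (by simp) x)
      rw [Real.norm_eq_abs, abs_of_nonneg (sq_nonneg _)]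
      nlinarith
    · exact (hB.integrable_sq).const_mul 4
    · refine ae_of_all _ fun x => ?_
      have h1 : Continuous fun t => (G t x - G s x) ^ 2 := ((hc x).sub continuous_const).pow 2
      simpa using h1.tendsto s
  rw [integral_zero] at hlim
  simp only [← hn] at hlim
  have := hlim.sqrt
  simpa [Real.sqrt_sq (norm_nonneg _)] using this

theorem Cb.isBddBy {k : ℕ} {p : ℝ → ℝ} (h : Cb k p) : ∃ C, IsBddBy p C := by
  obtain ⟨C, -, hC⟩ := Cb.bound h
  exact ⟨C, (Cb.continuous h).aestronglyMeasurable, hC⟩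

theorem Cb.mulLp_ae {k : ℕ} {p : ℝ → ℝ} (h : Cb k p) (f : L2) :
    mulLp p f =ᵐ[volume] fun x => p x * f x :=
  let ⟨_, hC⟩ := h.isBddBy
  StochCH.mulLp_ae hC f

theorem soc_mulLp {k : ℕ} {F : ℝ → ℝ → ℝ} (hF : SmoothFamily k F) : SOC fun t => mulLp (F t) := by
  have hb := hF.bdd
  have hc : ∀ t, Continuous (F t) := fun t => Cb.continuous (hF.freeze t)
  refine .of_forall (fun M => ?_) fun f => ?_
  · obtain ⟨C, hC⟩ := hb.2 M
    refine ⟨|C|, abs_nonneg _, fun t ht f => ?_⟩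
    exact norm_mulLp_apply_le ⟨(hc t).aestronglyMeasurable,
      fun x => (hC t ht x).trans (le_abs_self _)⟩ f
  · refine continuous_L2_of_dominated (fun t => (hF.freeze t).mulLp_ae f)
      (fun x => (hb.1.comp (continuous_id.prodMk continuous_const)).mul continuous_const)
      fun M => ?_
    obtain ⟨C, hC⟩ := hb.2 M
    refine ⟨fun x => C * |f x|, (Lp.memLp f).abs.const_mul C, fun t ht x => ?_⟩
    rw [abs_mul]
    exact mul_le_mul_of_nonneg_right (hC t ht x) (abs_nonneg _)

section Comp

variable {ξ : ℝ → ℝ}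

theorem measurable_flow (hξ : Cb 1 ξ) (t : ℝ) : Measurable (flow ξ t) :=
  (differentiable_flow hξ t).continuous.measurable

/-- The preimage of a set under φ_t is its image under φ_{-t}, a Lipschitz map with constant
e^{K|t|}. Lebesgue measure is one-dimensional Hausdorff measure, so measures grow by at most that
factor. -/
theorem map_flow_le (hξ : Cb 1 ξ) {K : ℝ} (hK : ∀ x, |deriv ξ x| ≤ K) (t : ℝ) :
    Measure.map (flow ξ t) volume ≤ ENNReal.ofReal (Real.exp (K * |t|)) • volume := by
  refine Measure.le_iff.2 fun s hs => ?_
  rw [Measure.map_apply (measurable_flow hξ t) hs]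
  have himg : flow ξ t ⁻¹' s = flow ξ (-t) '' s := by
    ext x
    constructor
    · intro hx
      exact ⟨flow ξ t x, hx, flow_neg_flow hξ t x⟩
    · rintro ⟨y, hy, rfl⟩
      rw [mem_preimage, flow_flow_neg hξ]
      exact hy
  have hL : LipschitzWith (Real.exp (K * |t|)).toNNReal (flow ξ (-t)) :=
    LipschitzWith.of_dist_le_mul fun x y => by
      rw [Real.dist_eq, Real.dist_eq, Real.coe_toNNReal _ (Real.exp_pos _).le]
      simpa using abs_flow_sub_le hξ hK (-t) y x
  have := hL.hausdorffMeasure_image_le (d := 1) zero_le_one s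
  rw [hausdorffMeasure_real, ENNReal.rpow_one] at this
  rw [himg]
  exact this

theorem memLp_comp_flow (hξ : Cb 1 ξ) (t : ℝ) (f : L2) :
    MemLp (fun x => f (flow ξ t x)) 2 volume := by
  obtain ⟨K, -, hK⟩ := hξ.lipschitz
  exact ((Lp.memLp f).of_measure_le_smul ENNReal.ofReal_ne_top (map_flow_le hξ hK t)).comp_of_map
    (measurable_flow hξ t).aemeasurable

theorem quasiMeasurePreserving_flow (hξ : Cb 1 ξ) (t : ℝ) :
    Measure.QuasiMeasurePreserving (flow ξ t) volume volume := by
  obtain ⟨K, -, hK⟩ := hξ.lipschitz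
  exact ⟨measurable_flow hξ t, Measure.absolutelyContinuous_of_le_smul (map_flow_le hξ hK t)⟩

theorem norm_toLp_comp_flow_le (hξ : Cb 1 ξ) {K : ℝ} (hK : ∀ x, |deriv ξ x| ≤ K) (t : ℝ) (f : L2) :
    ‖(memLp_comp_flow hξ t f).toLp‖ ≤ Real.exp (K * |t|) * ‖f‖ := by
  have hK0 : 0 ≤ K := (abs_nonneg _).trans (hK 0)
  have hE : 1 ≤ Real.exp (K * |t|) := Real.one_le_exp (by positivity)
  have hle := map_flow_le hξ hK t
  have hac : AEStronglyMeasurable f (Measure.map (flow ξ t) volume) :=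
    (Lp.aestronglyMeasurable f).mono_ac (Measure.absolutelyContinuous_of_le_smul hle)
  have h1 : eLpNorm (fun x => f (flow ξ t x)) 2 volume ≤
      ENNReal.ofReal (Real.exp (K * |t|)) * eLpNorm f 2 volume := by
    calc eLpNorm (fun x => f (flow ξ t x)) 2 volume
        = eLpNorm f 2 (Measure.map (flow ξ t) volume) :=
          (eLpNorm_map_measure hac (measurable_flow hξ t).aemeasurable).symm
      _ ≤ ENNReal.ofReal (Real.exp (K * |t|)) ^ (1 / 2 : ℝ≥0∞).toReal • eLpNorm f 2 volume :=
          eLpNorm_le_of_measure_le_smul hle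
      _ ≤ _ := by
          rw [smul_eq_mul]
          gcongr
          -- The natural factor is the square root of e^{K|t|}; since e^{K|t|} ≥ 1, exponent one is
          -- a harmless and simpler bound.
          calc ENNReal.ofReal (Real.exp (K * |t|)) ^ (1 / 2 : ℝ≥0∞).toReal
              ≤ ENNReal.ofReal (Real.exp (K * |t|)) ^ (1 : ℝ) := by
                refine ENNReal.rpow_le_rpow_of_exponent_le ?_ (by norm_num)
                rw [← ENNReal.ofReal_one]
                exact ENNReal.ofReal_le_ofReal hE
            _ = _ := ENNReal.rpow_one _
  rw [Lp.norm_toLp, Lp.norm_def]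
  refine (ENNReal.toReal_mono (ENNReal.mul_ne_top ENNReal.ofReal_ne_top (Lp.eLpNorm_ne_top f))
    h1).trans_eq ?_
  rw [ENNReal.toReal_mul, ENNReal.toReal_ofReal (Real.exp_pos _).le]

/-- Composition with the flow in `L²`. -/
def compL (hξ : Cb 1 ξ) (t : ℝ) : L2 →L[ℝ] L2 :=
  LinearMap.mkContinuous
    { toFun := fun f => (memLp_comp_flow hξ t f).toLp
      map_add' := fun f g => by
        apply Lp.ext
        filter_upwards [(memLp_comp_flow hξ t (f + g)).coeFn_toLp,
          (memLp_comp_flow hξ t f).coeFn_toLp, (memLp_comp_flow hξ t g).coeFn_toLp,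
          (quasiMeasurePreserving_flow hξ t).ae (Lp.coeFn_add f g),
          Lp.coeFn_add (memLp_comp_flow hξ t f).toLp (memLp_comp_flow hξ t g).toLp]
          with x h1 h2 h3 h4 h5
        rw [h1, h5, Pi.add_apply, h2, h3, h4, Pi.add_apply]
      map_smul' := fun c f => by
        apply Lp.ext
        filter_upwards [(memLp_comp_flow hξ t (c • f)).coeFn_toLp,
          (memLp_comp_flow hξ t f).coeFn_toLp,
          (quasiMeasurePreserving_flow hξ t).ae (Lp.coeFn_smul c f),
          Lp.coeFn_smul c (memLp_comp_flow hξ t f).toLp] with x h1 h2 h3 h4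
        rw [RingHom.id_apply, h1, h4, Pi.smul_apply, h2, h3, Pi.smul_apply] }
    (Real.exp (hξ.lipschitz.choose * |t|))
    (norm_toLp_comp_flow_le hξ hξ.lipschitz.choose_spec.2 t)

theorem compL_ae (hξ : Cb 1 ξ) (t : ℝ) (f : L2) :
    compL hξ t f =ᵐ[volume] fun x => f (flow ξ t x) := (memLp_comp_flow hξ t f).coeFn_toLp

theorem compL_ae_of_ae (hξ : Cb 1 ξ) (t : ℝ) {f : L2} {g : ℝ → ℝ} (h : g =ᵐ[volume] f) :
    compL hξ t f =ᵐ[volume] fun x => g (flow ξ t x) := by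
  filter_upwards [compL_ae hξ t f, (quasiMeasurePreserving_flow hξ t).ae h] with x h1 h2
  rw [h1, h2]

theorem norm_compL_apply_le (hξ : Cb 1 ξ) {K : ℝ} (hK : ∀ x, |deriv ξ x| ≤ K) (t : ℝ) (f : L2) :
    ‖compL hξ t f‖ ≤ Real.exp (K * |t|) * ‖f‖ := norm_toLp_comp_flow_le hξ hK t f

theorem dense_hasCompactSupport :
    Dense {f : L2 | ∃ g : ℝ → ℝ, Continuous g ∧ HasCompactSupport g ∧ g =ᵐ[volume] f} := by
  intro f
  rw [Metric.mem_closure_iff]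
  intro ε hε
  obtain ⟨g, h1, h2, h3, h4⟩ := (Lp.memLp f).exists_hasCompactSupport_eLpNorm_sub_le
    (by norm_num) (ε := ENNReal.ofReal (ε / 2)) (by simpa using hε)
  refine ⟨h4.toLp, ⟨g, h3, h1, h4.coeFn_toLp.symm⟩, ?_⟩
  rw [Lp.dist_def]
  have : eLpNorm (f - h4.toLp g : ℝ → ℝ) 2 volume ≤ ENNReal.ofReal (ε / 2) := by
    refine (eLpNorm_congr_ae ?_).trans_le h2
    filter_upwards [h4.coeFn_toLp] with x hx
    simp [hx]
  refine (ENNReal.toReal_mono ENNReal.ofReal_ne_top this).trans_lt ?_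
  rw [ENNReal.toReal_ofReal (by positivity)]
  linarith

/-- On continuous functions of compact support, dominated convergence applies: trajectories move by
at most N|t|, so for |t| ≤ M all f ∘ φ_t are supported in one ball of radius ρ + N M. -/
theorem soc_compL (hξ : Cb 1 ξ) : SOC (compL hξ) := by
  obtain ⟨K, -, hK⟩ := hξ.lipschitz
  obtain ⟨N, hN0, hN⟩ := Cb.bound hξ
  refine .of_dense (fun M => ⟨Real.exp (K * M), (Real.exp_pos _).le, fun t ht f =>
    (norm_compL_apply_le hξ hK t f).trans (by gcongr)⟩) dense_hasCompactSupport ?_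
  rintro f ⟨g, hg, hgc, hgf⟩
  refine continuous_L2_of_dominated (fun t => compL_ae_of_ae hξ t hgf)
    (fun x => hg.comp (continuous_flow_time hξ x)) fun M => ?_
  obtain ⟨C, hC⟩ := hg.bounded_above_of_compact_support hgc
  obtain ⟨ρ, hρ⟩ := hgc.isCompact.isBounded.subset_closedBall (0 : ℝ)
  have hC0 : 0 ≤ C := (norm_nonneg _).trans (hC 0)
  refine ⟨(Metric.closedBall 0 (ρ + N * M)).indicator fun _ => C,
    memLp_indicator_const 2 measurableSet_closedBall C
      (Or.inr measure_closedBall_lt_top.ne), fun t ht x => ?_⟩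
  by_cases hx : x ∈ Metric.closedBall (0 : ℝ) (ρ + N * M)
  · rw [indicator_of_mem hx]
    exact hC _
  · rw [indicator_of_notMem hx]
    have : g (flow ξ t x) = 0 := by
      by_contra h0
      have h1 := hρ (subset_tsupport g h0)
      rw [Metric.mem_closedBall, dist_zero_right, Real.norm_eq_abs] at h1 hx
      apply hx
      have h2 := abs_flow_sub_flow_le hξ hN t 0 x
      rw [flow_zero hξ, zero_sub, abs_neg] at h2
      have h3 : N * |t| ≤ N * M := by gcongr
      calc |x| = |(x - flow ξ t x) + flow ξ t x| := by ring_nf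
        _ ≤ |x - flow ξ t x| + |flow ξ t x| := abs_add_le _ _
        _ ≤ ρ + N * M := by linarith
    rw [this, abs_zero]

end Comp

/-! ### Multiplication and composition operators in `H¹` -/

theorem isWeakDeriv_mul {p : ℝ → ℝ} (hp : Cb 1 p) (f : H1) :
    IsWeakDeriv (mulLp p (val f)) (mulLp p (der f) + mulLp (deriv p) (val f)) := by
  have hp' : Cb 0 (deriv p) := hp.2.2
  refine denseRange_incl.induction_on (p := fun f : H1 =>
    IsWeakDeriv (mulLp p (val f)) (mulLp p (der f) + mulLp (deriv p) (val f))) f ?_ ?_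
  · exact isClosed_isWeakDeriv.preimage (f := fun f : H1 =>
      (mulLp p (val f), mulLp p (der f) + mulLp (deriv p) (val f))) (by fun_prop)
  · intro f
    refine isWeakDeriv_of_hasDerivAt
      (fun x => (hp.hasDerivAt 0 x).mul (hasDerivAt_rep_incl f x)) ?_ ?_
    · filter_upwards [hp.mulLp_ae (val (incl f)), rep_ae (incl f)] with x h1 h2
      rw [h1, ← h2]; rfl
    · filter_upwards [hp.mulLp_ae (der (incl f)), hp'.mulLp_ae (val (incl f)),
        Lp.coeFn_add (mulLp p (der (incl f))) (mulLp (deriv p) (val (incl f))),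
        rep_ae (incl f), rep_ae (dx f)] with x h1 h2 h3 h4 h5
      rw [h3, Pi.add_apply, h1, h2, der_incl, ← h4, ← h5]
      ring

/-- Multiplication by a function of the class `C_b^1` in `H¹`. -/
def mulOp {p : ℝ → ℝ} (hp : Cb 1 p) : H1 →L[ℝ] H1 :=
  liftH1 ((mulLp p).comp val) ((mulLp p).comp der + (mulLp (deriv p)).comp val)
    (isWeakDeriv_mul hp)

theorem val_mulOp {p : ℝ → ℝ} (hp : Cb 1 p) (f : H1) : val (mulOp hp f) = mulLp p (val f) := rfl

theorem der_mulOp {p : ℝ → ℝ} (hp : Cb 1 p) (f : H1) :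
    der (mulOp hp f) = mulLp p (der f) + mulLp (deriv p) (val f) := rfl

theorem rep_mulOp {p : ℝ → ℝ} (hp : Cb 1 p) (f : H1) :
    rep (mulOp hp f) = fun x => p x * rep f x := by
  refine rep_eq ((Cb.continuous hp).mul (rep_continuous f)) ?_
  filter_upwards [hp.mulLp_ae (val f), rep_ae f] with x h1 h2
  rw [val_mulOp, h1, ← h2]

theorem soc_mulOp {F : ℝ → ℝ → ℝ} (hF : SmoothFamily 1 F) : SOC fun t => mulOp (hF.freeze t) :=
  .of_components ((soc_mulLp hF).comp (.const val))
    (((soc_mulLp hF).comp (.const der)).add ((soc_mulLp hF.2.2).comp (.const val)))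

section Comp

variable {ξ : ℝ → ℝ}

theorem cb_flowDeriv (hξ : Cb 1 ξ) (t : ℝ) : Cb 0 (flowDeriv ξ t) :=
  (smoothFamily_flowDeriv hξ).freeze t

theorem isWeakDeriv_comp (hξ : Cb 1 ξ) (t : ℝ) (f : H1) :
    IsWeakDeriv (compL hξ t (val f)) (mulLp (flowDeriv ξ t) (compL hξ t (der f))) := by
  refine denseRange_incl.induction_on (p := fun f : H1 =>
    IsWeakDeriv (compL hξ t (val f)) (mulLp (flowDeriv ξ t) (compL hξ t (der f)))) f ?_ ?_
  · exact isClosed_isWeakDeriv.preimage (f := fun f : H1 =>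
      (compL hξ t (val f), mulLp (flowDeriv ξ t) (compL hξ t (der f)))) (by fun_prop)
  · intro f
    refine isWeakDeriv_of_hasDerivAt (fun x => (hasDerivAt_rep_incl f (flow ξ t x)).comp x
      (hasDerivAt_flow_space hξ t x)) ?_ ?_
    · exact (compL_ae_of_ae hξ t (rep_ae _)).symm
    · rw [der_incl]
      filter_upwards [compL_ae_of_ae hξ t (rep_ae (dx f)),
        (cb_flowDeriv hξ t).mulLp_ae (compL hξ t (val (dx f)))] with x h1 h2
      rw [h2, h1, mul_comm]

/-- Composition with the flow in `H¹`. -/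
def compOp (hξ : Cb 1 ξ) (t : ℝ) : H1 →L[ℝ] H1 :=
  liftH1 ((compL hξ t).comp val) ((mulLp (flowDeriv ξ t)).comp ((compL hξ t).comp der))
    (isWeakDeriv_comp hξ t)

theorem val_compOp (hξ : Cb 1 ξ) (t : ℝ) (f : H1) : val (compOp hξ t f) = compL hξ t (val f) := rfl

theorem der_compOp (hξ : Cb 1 ξ) (t : ℝ) (f : H1) :
    der (compOp hξ t f) = mulLp (flowDeriv ξ t) (compL hξ t (der f)) := rfl

theorem rep_compOp (hξ : Cb 1 ξ) (t : ℝ) (f : H1) :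
    rep (compOp hξ t f) = fun x => rep f (flow ξ t x) :=
  rep_eq ((rep_continuous f).comp (differentiable_flow hξ t).continuous)
    (compL_ae_of_ae hξ t (rep_ae f)).symm

theorem soc_compOp (hξ : Cb 1 ξ) : SOC (compOp hξ) :=
  .of_components ((soc_compL hξ).comp (.const val))
    ((soc_mulLp (smoothFamily_flowDeriv hξ)).comp ((soc_compL hξ).comp (.const der)))

end Comp

/-! ### Families of operators into Sobolev spaces -/

section SFam

variable {X : Type*} [NormedAddCommGroup X] [NormedSpace ℝ X]

/-- Strongly continuous families of operators with values in `H^{k+1}`. -/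
def SobFamily : ℕ → (ℝ → X →L[ℝ] H1) → Prop
  | 0, T => SOC T
  | k + 1, T => SOC T ∧ ∃ T' : ℝ → X →L[ℝ] H1,
      (∀ t v, der (T t v) = val (T' t v)) ∧ SobFamily k T'

theorem SobFamily.soc : ∀ {k : ℕ} {T : ℝ → X →L[ℝ] H1}, SobFamily k T → SOC T
  | 0, _, h => h
  | _ + 1, _, h => h.1

theorem SobFamily.of_succ : ∀ {k : ℕ} {T : ℝ → X →L[ℝ] H1}, SobFamily (k + 1) T → SobFamily k T
  | 0, _, h => h.1
  | _ + 1, _, ⟨h, T', h1, h2⟩ => ⟨h, T', h1, of_succ h2⟩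

theorem SobFamily.add : ∀ {k : ℕ} {T S : ℝ → X →L[ℝ] H1}, SobFamily k T → SobFamily k S →
    SobFamily k fun t => T t + S t
  | 0, _, _, hT, hS => SOC.add hT hS
  | _ + 1, _, _, ⟨hT, T', h1, h2⟩, ⟨hS, S', h3, h4⟩ =>
    ⟨hT.add hS, fun t => T' t + S' t, fun t v => by
      rw [add_apply, add_apply, map_add, map_add, h1, h3], h2.add h4⟩

/-- Values in H^{k+1} have k + 1 weak derivatives, hence as many derivatives of the factor are
required. The recursion is the product rule. -/
theorem SobFamily.mul : ∀ {k : ℕ} {T : ℝ → X →L[ℝ] H1} {F : ℝ → ℝ → ℝ}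
    (hF : SmoothFamily (k + 1) F), SobFamily k T →
    SobFamily k fun t => (mulOp ((hF.mono (Nat.le_add_left 1 k)).freeze t)).comp (T t)
  | 0, _, _, hF, hT => (soc_mulOp hF).comp hT
  | k + 1, T, F, hF, ⟨hT, T', h1, h2⟩ => by
    have hF1 : SmoothFamily 1 F := hF.mono (by omega)
    have hF1' : SmoothFamily 1 fun t => deriv (F t) := hF.2.2.mono (by omega)
    refine ⟨(soc_mulOp hF1).comp hT, fun t => (mulOp (hF1.freeze t)).comp (T' t) +
      (mulOp (hF1'.freeze t)).comp (T t), fun t v => ?_, ?_⟩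
    · simp only [add_apply, ContinuousLinearMap.comp_apply, map_add, der_mulOp, val_mulOp, h1]
    · exact (mul hF.of_succ h2).add (mul hF.2.2 (of_succ ⟨hT, T', h1, h2⟩))

theorem SobFamily.comp_flow {ξ : ℝ → ℝ} (hξ : Cb 1 ξ) {r : ℝ → ℝ} (hr : Continuous r) :
    ∀ {k : ℕ} {T : ℝ → X →L[ℝ] H1} (_ : Cb (k + 1) ξ), SobFamily k T →
    SobFamily k fun t => (compOp hξ (r t)).comp (T t)
  | 0, _, _, hT => ((soc_compOp hξ).reparam hr).comp hT
  | k + 1, T, hk, ⟨hT, T', h1, h2⟩ => by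
    have hD : SmoothFamily (k + 1) fun t => flowDeriv ξ (r t) :=
      (smoothFamily_flowDeriv hk).reparam hr
    refine ⟨((soc_compOp hξ).reparam hr).comp hT, _, fun t v => ?_,
      SobFamily.mul hD (comp_flow hξ hr hk.of_succ h2)⟩
    simp only [ContinuousLinearMap.comp_apply, val_mulOp, der_compOp, val_compOp, h1]

theorem SobFamily.const_smul (c : ℝ) : ∀ {k : ℕ} {T : ℝ → X →L[ℝ] H1}, SobFamily k T →
    SobFamily k fun t => c • T t
  | 0, T, hT => SOC.comp (.const (c • ContinuousLinearMap.id ℝ H1)) hT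
  | _ + 1, T, ⟨hT, T', h1, h2⟩ => ⟨SOC.comp (.const (c • ContinuousLinearMap.id ℝ H1)) hT,
      fun t => c • T' t, fun t v => by
        simp only [smul_apply, map_smul, h1], h2.const_smul c⟩

/-- The values of a family with values in `H^{k+1}` are of the class `C_b^k`. -/
theorem SobFamily.cb : ∀ {k : ℕ} {T : ℝ → X →L[ℝ] H1}, SobFamily k T → ∀ t v, Cb k (rep (T t v))
  | 0, T, _, t, v => ⟨(rep_continuous _).comp continuous_snd, fun _ =>
      ⟨_, fun _ _ x => abs_rep_le (T t v) x⟩⟩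
  | _ + 1, T, ⟨_, T', h1, h2⟩, t, v => .of_hasDerivAt (G := fun _ => rep (T' t v))
      ⟨(rep_continuous _).comp continuous_snd, fun _ => ⟨_, fun _ _ x => abs_rep_le (T t v) x⟩⟩
      (fun _ x => hasDerivAt_rep (rep_continuous _) (by rw [h1]; exact rep_ae _) x) (h2.cb t v)

/-- A family with values in `H²`. -/
theorem SobFamily.exists_H2 {T : ℝ → X →L[ℝ] H1} (hT : SobFamily 1 T) :
    ∃ S : ℝ → X →L[ℝ] H2, SOC S ∧ ∀ t v, incl (S t v) = T t v := by
  obtain ⟨h0, T', h1, h2⟩ := hT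
  refine ⟨fun t => liftH2 (T t) (T' t) (h1 t), ⟨?_, fun M => ?_⟩, fun t v => rfl⟩
  · have : Continuous fun p : ℝ × X => (liftH2 (T p.1) (T' p.1) (h1 p.1) p.2).1 :=
      (WithLp.prodContinuousLinearEquiv 2 ℝ H1 H1).symm.continuous.comp (h0.1.prodMk h2.1)
    exact this.subtype_mk _
  · obtain ⟨C, hC0, hC⟩ := h0.2 M
    obtain ⟨D, hD0, hD⟩ := (SobFamily.soc (k := 0) h2).2 M
    refine ⟨C + D, by positivity, fun t ht x => (norm_H2_le _).trans ?_⟩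
    rw [add_mul]
    exact add_le_add (hC t ht x) (hD t ht x)

theorem sobFamily_incl : SobFamily 1 fun _ => incl :=
  ⟨.const _, fun _ => dx, fun _ v => der_incl v, .const _⟩

end SFam

/-! ### The group `U` in `H¹` -/

section Group

variable {ξ η : ℝ → ℝ}

/-- The exponent `c(t,x)` in the definition of `U`. -/
def expo (ξ η : ℝ → ℝ) (t x : ℝ) : ℝ := ∫ r in (0 : ℝ)..t, η (flow ξ (-r) x)

/-- The substitution r = t - s removes t from the integrand, which makes the cocycle property and
the differentiation in t direct. -/
theorem U_apply (ξ η : ℝ → ℝ) (t : ℝ) (f : ℝ → ℝ) (x : ℝ) :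
    U ξ η t f x = Real.exp (expo ξ η t x) * f (flow ξ (-t) x) := by
  have := intervalIntegral.integral_comp_sub_left (a := 0) (b := t)
    (fun r => η (flow ξ (-r) x)) t
  simp only [neg_sub, sub_self, sub_zero] at this
  rw [U, expo, this]

theorem smoothFamily_expo {k : ℕ} (h1 : Cb 1 ξ) (hξ : Cb k ξ) (hη : Cb k η) :
    SmoothFamily k (expo ξ η) :=
  (SmoothFamily.comp_flow (F := fun _ => η) hη h1 hξ continuous_neg).integral

theorem smoothFamily_weight {k : ℕ} (h1 : Cb 1 ξ) (hξ : Cb k ξ) (hη : Cb k η) :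
    SmoothFamily k fun t x => Real.exp (expo ξ η t x) := (smoothFamily_expo h1 hξ hη).exp

/-- The cocycle identity of the exponent, which is exactly what the group law of `U` requires. -/
theorem expo_add (h1 : Cb 1 ξ) (hη : Cb 1 η) (s t x : ℝ) :
    expo ξ η (s + t) x = expo ξ η s x + expo ξ η t (flow ξ (-s) x) := by
  have hc : Continuous fun r => η (flow ξ (-r) x) :=
    (Cb.continuous hη).comp ((continuous_flow_time h1 x).comp continuous_neg)
  rw [expo, ← intervalIntegral.integral_add_adjacent_intervals (b := s)
    (hc.intervalIntegrable _ _) (hc.intervalIntegrable _ _), expo, expo]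
  congr 1
  have := intervalIntegral.integral_comp_add_right (a := 0) (b := t)
    (fun r => η (flow ξ (-r) x)) s
  rw [zero_add, add_comm t s] at this
  rw [← this]
  refine intervalIntegral.integral_congr fun r _ => ?_
  rw [neg_add, flow_add h1]

theorem expo_zero (x : ℝ) : expo ξ η 0 x = 0 := by simp [expo]

theorem expo_neg (h1 : Cb 1 ξ) (hη : Cb 1 η) (t x : ℝ) :
    expo ξ η t x + expo ξ η (-t) (flow ξ (-t) x) = 0 := by
  rw [← expo_add h1 hη, add_neg_cancel, expo_zero]

/-- The group `U` in `L²`. -/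
def UL (hξ : Cb 1 ξ) (η : ℝ → ℝ) (t : ℝ) : L2 →L[ℝ] L2 :=
  (mulLp fun x => Real.exp (expo ξ η t x)).comp (compL hξ (-t))

/-- The group `U` in `H¹`. -/
def UH (hξ : Cb 1 ξ) (hη : Cb 1 η) (t : ℝ) : H1 →L[ℝ] H1 :=
  (mulOp ((smoothFamily_weight hξ hξ hη).freeze t)).comp (compOp hξ (-t))

theorem val_UH (hξ : Cb 1 ξ) (hη : Cb 1 η) (t : ℝ) (f : H1) :
    val (UH hξ hη t f) = UL hξ η t (val f) := rfl

theorem der_UH (hξ : Cb 1 ξ) (hη : Cb 1 η) (t : ℝ) (f : H1) : der (UH hξ hη t f) =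
    mulLp (fun x => Real.exp (expo ξ η t x)) (mulLp (flowDeriv ξ (-t)) (compL hξ (-t) (der f))) +
      mulLp (deriv fun x => Real.exp (expo ξ η t x)) (compL hξ (-t) (val f)) := rfl

theorem rep_UH (hξ : Cb 1 ξ) (hη : Cb 1 η) (t : ℝ) (f : H1) :
    rep (UH hξ hη t f) = U ξ η t (rep f) := by
  funext x
  rw [U_apply, UH, ContinuousLinearMap.comp_apply, rep_mulOp, rep_compOp]

theorem soc_UH (hξ : Cb 1 ξ) (hη : Cb 1 η) : SOC (UH hξ hη) :=
  (soc_mulOp (smoothFamily_weight hξ hξ hη)).comp ((soc_compOp hξ).reparam continuous_neg)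

theorem soc_UL (hξ : Cb 1 ξ) (hη : Cb 1 η) : SOC (UL hξ η) :=
  (soc_mulLp (smoothFamily_weight hξ hξ hη)).comp ((soc_compL hξ).reparam continuous_neg)

theorem UH_zero (hξ : Cb 1 ξ) (hη : Cb 1 η) : UH hξ hη 0 = ContinuousLinearMap.id ℝ H1 := by
  ext1 f
  apply H1.ext_rep
  funext x
  rw [rep_UH, U_apply, expo_zero, neg_zero, flow_zero hξ, Real.exp_zero, one_mul]
  rfl

theorem UH_add (hξ : Cb 1 ξ) (hη : Cb 1 η) (s t : ℝ) :
    UH hξ hη (s + t) = (UH hξ hη s).comp (UH hξ hη t) := by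
  ext1 f
  apply H1.ext_rep
  funext x
  rw [ContinuousLinearMap.comp_apply, rep_UH, rep_UH, rep_UH, U_apply, U_apply, U_apply,
    expo_add hξ hη, Real.exp_add, neg_add_rev, flow_add hξ, mul_assoc]

theorem UH_add_apply (hξ : Cb 1 ξ) (hη : Cb 1 η) (s t : ℝ) (f : H1) :
    UH hξ hη (s + t) f = UH hξ hη s (UH hξ hη t f) := by
  rw [UH_add]
  rfl

theorem UH_neg_apply (hξ : Cb 1 ξ) (hη : Cb 1 η) (t : ℝ) (f : H1) :
    UH hξ hη (-t) (UH hξ hη t f) = f := by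
  rw [← UH_add_apply, neg_add_cancel, UH_zero]
  rfl

theorem UH_apply_neg (hξ : Cb 1 ξ) (hη : Cb 1 η) (t : ℝ) (f : H1) :
    UH hξ hη t (UH hξ hη (-t) f) = f := by
  simpa using UH_neg_apply hξ hη (-t) f

/-- The group `U` respects Sobolev regularity. -/
theorem SobFamily.UH {X : Type*} [NormedAddCommGroup X] [NormedSpace ℝ X] {k : ℕ}
    {T : ℝ → X →L[ℝ] H1} (hT : SobFamily k T) (hξ : Cb 1 ξ) (hη : Cb 1 η) (hξk : Cb (k + 1) ξ)
    (hηk : Cb (k + 1) η) {r : ℝ → ℝ} (hr : Continuous r) :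
    SobFamily k fun t => (UH hξ hη (r t)).comp (T t) :=
  SobFamily.mul ((smoothFamily_weight hξ hξk hηk).reparam hr)
    (SobFamily.comp_flow hξ hr.neg hξk hT)

/-- The group `U` in `H²`. -/
theorem exists_UH2 (hξ : Cb 1 ξ) (hη : Cb 1 η) (hξ2 : Cb 2 ξ) (hη2 : Cb 2 η) :
    ∃ S : ℝ → H2 →L[ℝ] H2, SOC S ∧ ∀ t f, incl (S t f) = UH hξ hη t (incl f) :=
  (sobFamily_incl.UH hξ hη hξ2 hη2 continuous_id).exists_H2

end Group

/-! ### The norm of the group `U` in `H¹` -/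

section Norm

variable {ξ η : ℝ → ℝ}

theorem abs_expo_le {K : ℝ} (hK : ∀ x, |η x| ≤ K) (t x : ℝ) : |expo ξ η t x| ≤ K * |t| := by
  have := intervalIntegral.norm_integral_le_of_norm_le_const (a := 0) (b := t)
    (f := fun r => η (flow ξ (-r) x)) (C := K) (fun r _ => hK _)
  rwa [sub_zero] at this

theorem abs_deriv_expo_le (hξ : Cb 1 ξ) (hη : Cb 1 η) {K : ℝ} (hK : ∀ x, |deriv ξ x| ≤ K)
    (hK' : ∀ x, |deriv η x| ≤ K) (t x : ℝ) :
    |deriv (expo ξ η t) x| ≤ K * Real.exp (K * |t|) * |t| := by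
  have hK0 : 0 ≤ K := (abs_nonneg _).trans (hK 0)
  have h1 := hasDerivAt_integral_family
    (SmoothFamily.comp_flow (F := fun _ => η) hη hξ hξ continuous_neg) t x
  have h2 : deriv (expo ξ η t) x = _ := h1.deriv
  rw [h2]
  have := intervalIntegral.norm_integral_le_of_norm_le_const (a := 0) (b := t)
    (f := fun r => deriv (fun x => η (flow ξ (-r) x)) x) (C := K * Real.exp (K * |t|)) ?_
  · rwa [sub_zero] at this
  · intro r hr
    have hd : HasDerivAt (fun x => η (flow ξ (-r) x))
        (deriv η (flow ξ (-r) x) * flowDeriv ξ (-r) x) x :=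
      (hη.hasDerivAt 0 _).comp x (hasDerivAt_flow_space hξ (-r) x)
    have hr' : |-r| ≤ |t| := by
      have h1 := abs_sub_left_of_mem_uIcc (uIoc_subset_uIcc hr)
      rwa [sub_zero, sub_zero, ← abs_neg] at h1
    rw [hd.deriv, norm_mul]
    refine mul_le_mul (hK' _) ((abs_flowDeriv_le hK _ _).trans ?_) (norm_nonneg _) hK0
    gcongr

/-- No constant may stand in front of the exponential, so every factor must tend to 1 as s → 0.
Weight, flow derivative and composition each cost e^{Ks}, the derivative of the weight adds the
off-diagonal term Ks ‖f‖_{L²}, and 1 + Ks ≤ e^{Ks} absorbs it; four factors in all. -/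
theorem norm_UH_apply_le (hξ : Cb 1 ξ) (hη : Cb 1 η) {K : ℝ} (hK : ∀ x, |deriv ξ x| ≤ K)
    (hK' : ∀ x, |η x| ≤ K) (hK'' : ∀ x, |deriv η x| ≤ K) {s : ℝ} (hs : 0 ≤ s) (f : H1) :
    ‖UH hξ hη s f‖ ≤ Real.exp (4 * K * s) * ‖f‖ := by
  have hK0 : 0 ≤ K := (abs_nonneg _).trans (hK 0)
  set e := Real.exp (K * s) with he
  have he1 : 1 ≤ e := Real.one_le_exp (by positivity)
  have hsm := smoothFamily_weight hξ hξ hη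
  have hexp : ∀ x, Real.exp (expo ξ η s x) ≤ e := fun x => by
    have := abs_expo_le (ξ := ξ) hK' s x
    rw [abs_of_nonneg hs] at this
    exact Real.exp_le_exp.2 ((le_abs_self _).trans this)
  have b1 : IsBddBy (fun x => Real.exp (expo ξ η s x)) e :=
    ⟨(Cb.continuous (hsm.freeze s)).aestronglyMeasurable, fun x => by
      rw [Real.norm_eq_abs, abs_of_pos (Real.exp_pos _)]
      exact hexp x⟩
  have b2 : IsBddBy (flowDeriv ξ (-s)) e :=
    ⟨(Cb.continuous (cb_flowDeriv hξ (-s))).aestronglyMeasurable, fun x => by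
      have := abs_flowDeriv_le hK (-s) x
      rwa [abs_neg, abs_of_nonneg hs] at this⟩
  have b3 : IsBddBy (deriv fun x => Real.exp (expo ξ η s x)) (e * (K * e * s)) := by
    refine ⟨(Cb.continuous (k := 0) (hsm.freeze s).2.2).aestronglyMeasurable, fun x => ?_⟩
    have hd := ((smoothFamily_expo hξ hξ hη).hasDerivAt s x).exp
    rw [hd.deriv, norm_mul, Real.norm_eq_abs, abs_of_pos (Real.exp_pos _)]
    have := abs_deriv_expo_le hξ hη hK hK'' s x
    rw [abs_of_nonneg hs] at this
    exact mul_le_mul (hexp x) this (norm_nonneg _) (by positivity)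
  have hcomp : ∀ g, ‖compL hξ (-s) g‖ ≤ e * ‖g‖ := fun g => by
    have := norm_compL_apply_le hξ hK (-s) g
    rwa [abs_neg, abs_of_nonneg hs] at this
  set a := ‖val f‖ with ha
  set b := ‖der f‖ with hb
  have ha0 : 0 ≤ a := norm_nonneg _
  have hb0 : 0 ≤ b := norm_nonneg _
  have hv : ‖val (UH hξ hη s f)‖ ≤ e ^ 3 * a := by
    rw [val_UH, UL, ContinuousLinearMap.comp_apply]
    calc _ ≤ e * (e * a) := (norm_mulLp_apply_le b1 _).trans (by gcongr; exact hcomp _)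
      _ ≤ e ^ 3 * a := by
        have : e ^ 2 ≤ e ^ 3 := pow_le_pow_right₀ he1 (by norm_num)
        nlinarith
  have hd : ‖der (UH hξ hη s f)‖ ≤ e ^ 3 * (b + K * s * a) := by
    rw [der_UH]
    refine (norm_add_le _ _).trans ?_
    have h1 : ‖mulLp (fun x => Real.exp (expo ξ η s x))
        (mulLp (flowDeriv ξ (-s)) (compL hξ (-s) (der f)))‖ ≤ e * (e * (e * b)) :=
      (norm_mulLp_apply_le b1 _).trans (by
        gcongr
        exact (norm_mulLp_apply_le b2 _).trans (by gcongr; exact hcomp _))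
    have h2 : ‖mulLp (deriv fun x => Real.exp (expo ξ η s x)) (compL hξ (-s) (val f))‖ ≤
        e * (K * e * s) * (e * a) :=
      (norm_mulLp_apply_le b3 _).trans (by gcongr; exact hcomp _)
    calc _ ≤ e * (e * (e * b)) + e * (K * e * s) * (e * a) := add_le_add h1 h2
      _ = _ := by ring
  have hks : 0 ≤ K * s := by positivity
  have hsq : ‖UH hξ hη s f‖ ^ 2 ≤ (e ^ 3 * (1 + K * s) * ‖f‖) ^ 2 := by
    have hf := norm_sq_H1 f
    rw [norm_sq_H1, mul_pow _ ‖f‖, hf, ← ha, ← hb]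
    have h1 : ‖val (UH hξ hη s f)‖ ^ 2 ≤ (e ^ 3 * a) ^ 2 := by gcongr
    have h2 : ‖der (UH hξ hη s f)‖ ^ 2 ≤ (e ^ 3 * (b + K * s * a)) ^ 2 := by gcongr
    refine (add_le_add h1 h2).trans ?_
    rw [mul_pow _ a, mul_pow _ (b + _), mul_pow _ (1 + _), ← mul_add, mul_assoc (_ ^ 2)]
    -- The lower triangular matrix with ones on the diagonal and κ = K s below it has Euclidean norm
    -- at most 1 + κ.
    have hab : a ^ 2 + (b + K * s * a) ^ 2 ≤ (1 + K * s) ^ 2 * (a ^ 2 + b ^ 2) := by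
      nlinarith [mul_nonneg hks (sq_nonneg (a - b)), mul_nonneg hks (sq_nonneg a),
        mul_nonneg hks (sq_nonneg b), mul_nonneg (mul_nonneg hks hks) (sq_nonneg b)]
    exact mul_le_mul_of_nonneg_left hab (sq_nonneg _)
  have hle : ‖UH hξ hη s f‖ ≤ e ^ 3 * (1 + K * s) * ‖f‖ :=
    (sq_le_sq₀ (norm_nonneg _) (by positivity)).1 hsq
  refine hle.trans ?_
  gcongr
  calc e ^ 3 * (1 + K * s) ≤ e ^ 3 * e := by
        gcongr
        rw [add_comm]
        exact Real.add_one_le_exp _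
    _ = Real.exp (4 * K * s) := by
        rw [← pow_succ, he, ← Real.exp_nat_mul]
        congr 1
        push_cast
        ring

end Norm

/-! ### First order operators as generators -/

instance : CompleteSpace H2 :=
  (completeSpace_congr (e := QE.toEquiv) QE.isUniformEmbedding).2 inferInstance

/-- Evaluation at a point as a functional on `H¹`. -/
def evalL (x : ℝ) : H1 →L[ℝ] ℝ :=
  LinearMap.mkContinuous
    { toFun := fun f => rep f x
      map_add' := fun f g => by rw [rep_add]; rfl
      map_smul' := fun c f => by rw [rep_smul]; rfl } normSymP (fun f => abs_rep_le f x)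

theorem evalL_apply (x : ℝ) (f : H1) : evalL x f = rep f x := rfl

/-- The mean value of a continuous function over a small interval. -/
theorem tendsto_mean {E : Type*} [NormedAddCommGroup E] [NormedSpace ℝ E] [CompleteSpace E]
    {g : ℝ → E} (hg : Continuous g) :
    Tendsto (fun h : ℝ => h⁻¹ • ∫ s in (0 : ℝ)..h, g s) (𝓝[>] 0) (𝓝 (g 0)) := by
  have hd : HasDerivAt (fun h => ∫ s in (0 : ℝ)..h, g s) (g 0) 0 :=
    intervalIntegral.integral_hasDerivAt_right (hg.intervalIntegrable _ _)
      hg.stronglyMeasurable.stronglyMeasurableAtFilter hg.continuousAt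
  have := hd.tendsto_slope_zero_right
  simpa using this

section Generator

variable {α β : H1}

/-- For f ∈ H² the function s ↦ (T_s f)(x) is differentiable along the characteristic through x,
with derivative -(T_s L f)(x). Integrating and comparing pointwise, evaluation being continuous on
H¹, gives the identity in H¹. -/
theorem UH_incl_sub (hα : Cb 1 (rep α)) (hβ : Cb 1 fun x => -rep β x) (f : H2) (h : ℝ) :
    UH hα hβ h (incl f) - incl f = -∫ s in (0 : ℝ)..h, UH hα hβ s (opL α β f) := by
  set T := UH hα hβ with hT
  have hc : Continuous fun s => T s (opL α β f) := (soc_UH hα hβ).apply_const _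
  apply H1.ext_rep
  funext x
  have hd : ∀ s, HasDerivAt (fun s => rep (T s (incl f)) x) (-rep (T s (opL α β f)) x) s := by
    intro s
    have hη : Continuous fun r => -rep β (flow (rep α) (-r) x) :=
      (Cb.continuous hβ).comp ((continuous_flow_time hα x).comp continuous_neg)
    have h1 : HasDerivAt (fun s => expo (rep α) (fun x => -rep β x) s x)
        (-rep β (flow (rep α) (-s) x)) s :=
      intervalIntegral.integral_hasDerivAt_right (hη.intervalIntegrable _ _)
        hη.stronglyMeasurable.stronglyMeasurableAtFilter hη.continuousAt
    have h2 : HasDerivAt (fun s => flow (rep α) (-s) x) (-rep α (flow (rep α) (-s) x)) s := by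
      have := (hasDerivAt_flow hα (-s) x).comp s (hasDerivAt_neg s)
      rwa [mul_neg_one] at this
    have h3 := h1.exp.mul ((hasDerivAt_rep_incl f (flow (rep α) (-s) x)).comp s h2)
    have e : (fun s => rep (T s (incl f)) x) = fun s =>
        Real.exp (expo (rep α) (fun x => -rep β x) s x) * rep (incl f) (flow (rep α) (-s) x) := by
      funext s
      rw [hT, rep_UH, U_apply]
    rw [e]
    convert! h3 using 1
    rw [hT, rep_UH, U_apply, rep_opL]
    simp only [Function.comp]
    ring
  have hev : evalL x (∫ s in (0 : ℝ)..h, T s (opL α β f)) =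
      ∫ s in (0 : ℝ)..h, rep (T s (opL α β f)) x :=
    ((evalL x).intervalIntegral_comp_comm (hc.intervalIntegrable _ _)).symm
  have hcx : Continuous fun s => rep (T s (opL α β f)) x := (evalL x).continuous.comp hc
  have hftc := intervalIntegral.integral_eq_sub_of_hasDerivAt (a := 0) (b := h) (fun s _ => hd s)
    (hcx.neg.intervalIntegrable _ _)
  rw [intervalIntegral.integral_neg] at hftc
  rw [rep_sub, rep_neg, Pi.sub_apply, Pi.neg_apply, ← evalL_apply x (∫ s in (0 : ℝ)..h, _), hev,
    hftc, hT, UH_zero]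
  rfl

/-- For x ∈ H¹ the function Lx is only in L², so the H² identity is extended by density in L², where
T_s also acts. If Lx = y ∈ H¹, both sides lie in H¹ and equality in L² suffices. -/
theorem UH_sub_of_opLL2 (hα : Cb 1 (rep α)) (hβ : Cb 1 fun x => -rep β x) {x y : H1}
    (hxy : opLL2 α β x = val y) (h : ℝ) :
    UH hα hβ h x - x = -∫ s in (0 : ℝ)..h, UH hα hβ s y := by
  have hsoc := soc_UL hα hβ
  have hci : ∀ y, Continuous fun s => UH hα hβ s y := (soc_UH hα hβ).apply_const
  have hval : ∀ y, val (∫ s in (0 : ℝ)..h, UH hα hβ s y) =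
      ∫ s in (0 : ℝ)..h, UL hα (fun x => -rep β x) s (val y) := fun y =>
    (val.intervalIntegral_comp_comm ((hci y).intervalIntegrable _ _)).symm
  have key : ∀ x : H1, UL hα (fun x => -rep β x) h (val x) - val x =
      -∫ s in (0 : ℝ)..h, UL hα (fun x => -rep β x) s (opLL2 α β x) := by
    intro x
    refine denseRange_incl.induction_on (p := fun x => UL hα (fun x => -rep β x) h (val x) - val x =
      -∫ s in (0 : ℝ)..h, UL hα (fun x => -rep β x) s (opLL2 α β x)) x
      (isClosed_eq (by fun_prop) (Continuous.neg ?_)) fun f => ?_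
    · exact intervalIntegral.continuous_parametric_intervalIntegral_of_continuous'
        (f := fun (x : H1) s => UL hα (fun x => -rep β x) s (opLL2 α β x))
        (hsoc.apply continuous_snd ((opLL2 α β).continuous.comp continuous_fst)) _ _
    · have := congrArg val (UH_incl_sub hα hβ f h)
      rwa [map_sub, val_UH, map_neg, hval, ← opLL2_incl] at this
  apply H1.ext_val
  rw [map_sub, val_UH, map_neg, hval, key, hxy]

theorem tendsto_of_opLL2 (hα : Cb 1 (rep α)) (hβ : Cb 1 fun x => -rep β x) {x y : H1}
    (hxy : opLL2 α β x = val y) :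
    Tendsto (fun h : ℝ => h⁻¹ • (UH hα hβ h x - x)) (𝓝[>] 0) (𝓝 (-y)) := by
  have h1 := (tendsto_mean ((soc_UH hα hβ).apply_const y)).neg
  simp only [UH_zero] at h1
  refine h1.congr fun h => ?_
  rw [UH_sub_of_opLL2 hα hβ hxy, smul_neg]

/-- The graph of the operator `f ↦ α f' + β f` with domain `H²` in `H¹`. -/
def graphL (α β : H1) : Submodule ℝ (H1 × H1) := LinearMap.range (incl.prod (opL α β)).toLinearMap

theorem mem_graphL {α β : H1} {p : H1 × H1} : p ∈ graphL α β ↔ ∃ f, (incl f, opL α β f) = p :=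
  Iff.rfl

theorem opLL2_of_mem_closure {x y : H1} (h : (x, y) ∈ (graphL α β).topologicalClosure) :
    opLL2 α β x = val y := by
  have hcl : IsClosed {p : H1 × H1 | opLL2 α β p.1 = val p.2} :=
    isClosed_eq (by fun_prop) (by fun_prop)
  have hsub : (graphL α β : Set (H1 × H1)) ⊆ {p | opLL2 α β p.1 = val p.2} := by
    rintro p hp
    obtain ⟨f, rfl⟩ := mem_graphL.1 hp
    exact opLL2_incl α β f
  exact closure_minimal hsub hcl h

/-- H² is a core of the generator: it is dense and invariant under the semigroup. The class C_b² of
the coefficients is needed for the invariance. -/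
theorem mem_closure_graphL_of_tendsto (hα : Cb 2 (rep α)) (hβ : Cb 2 fun x => -rep β x) {x y : H1}
    (h : Tendsto (fun h : ℝ => h⁻¹ • (UH hα.of_succ hβ.of_succ h x - x)) (𝓝[>] 0) (𝓝 (-y))) :
    (x, y) ∈ (graphL α β).topologicalClosure := by
  set hα1 : Cb 1 (rep α) := hα.of_succ
  set hβ1 : Cb 1 (fun x => -rep β x) := hβ.of_succ
  set T := UH hα1 hβ1 with hT
  have hsoc : SOC T := soc_UH hα1 hβ1
  obtain ⟨S, hS, hST⟩ := exists_UH2 hα1 hβ1 hα hβ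
  -- L commutes with T_s on H²: both sides, up to sign, are limits of the same difference quotients,
  -- since T_h T_s = T_s T_h.
  have hcomm : ∀ s (f : H2), opL α β (S s f) = T s (opL α β f) := by
    intro s f
    have l1 := tendsto_of_opLL2 hα1 hβ1 (opLL2_incl α β (S s f))
    have l2 := ((T s).continuous.tendsto _).comp (tendsto_of_opLL2 hα1 hβ1 (opLL2_incl α β f))
    have e : ∀ h : ℝ, h⁻¹ • (UH hα1 hβ1 h (incl (S s f)) - incl (S s f)) =
        (T s ∘ fun h : ℝ => h⁻¹ • (UH hα1 hβ1 h (incl f) - incl f)) h := by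
      intro h
      rw [hST, Function.comp_apply, map_smul, map_sub, hT, ← UH_add_apply,
        ← UH_add_apply, add_comm]
    have := tendsto_nhds_unique l1 (l2.congr fun h => (e h).symm)
    rw [map_neg, neg_inj] at this
    exact this
  -- For f ∈ H² the integral ∫₀ʰ T_s f ds can be taken in H², where L passes under it and gives f -
  -- T_h f. The closed condition then extends to all x ∈ H¹.
  have hmem : ∀ (h : ℝ) (x : H1), (∫ s in (0 : ℝ)..h, T s x, x - T h x) ∈
      (graphL α β).topologicalClosure := by
    intro h x
    refine denseRange_incl.induction_on (p := fun x => (∫ s in (0 : ℝ)..h, T s x, x - T h x) ∈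
      (graphL α β).topologicalClosure) x ?_ fun f => ?_
    · refine (Submodule.isClosed_topologicalClosure _).preimage (f := fun x : H1 =>
        (∫ s in (0 : ℝ)..h, T s x, x - T h x)) (Continuous.prodMk ?_ (by fun_prop))
      exact intervalIntegral.continuous_parametric_intervalIntegral_of_continuous'
        (f := fun (x : H1) s => T s x) (hsoc.apply continuous_snd continuous_fst) _ _
    · refine Submodule.le_topologicalClosure _ (mem_graphL.2 ⟨∫ s in (0 : ℝ)..h, S s f, ?_⟩)
      have hi : IntervalIntegrable (fun s => S s f) volume 0 h :=
        (hS.apply_const f).intervalIntegrable _ _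
      have e1 : incl (∫ s in (0 : ℝ)..h, S s f) = ∫ s in (0 : ℝ)..h, T s (incl f) := by
        rw [← incl.intervalIntegral_comp_comm hi]
        simp only [hST]
        rfl
      have e2 : opL α β (∫ s in (0 : ℝ)..h, S s f) = incl f - T h (incl f) := by
        rw [← (opL α β).intervalIntegral_comp_comm hi]
        simp only [hcomm]
        rw [← neg_sub, UH_incl_sub hα1 hβ1, neg_neg]
      rw [e1, e2]
  have hlim : Tendsto (fun h : ℝ => h⁻¹ • (∫ s in (0 : ℝ)..h, T s x, x - T h x)) (𝓝[>] 0)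
      (𝓝 (x, y)) := by
    have l1 := tendsto_mean (hsoc.apply_const x)
    rw [hT, UH_zero] at l1
    have l2 := h.neg
    rw [neg_neg] at l2
    refine (l1.prodMk_nhds l2).congr fun h => ?_
    rw [Prod.smul_mk, ← smul_neg, neg_sub]
  exact (Submodule.isClosed_topologicalClosure _).mem_of_tendsto hlim
    (Eventually.of_forall fun h => Submodule.smul_mem _ _ (hmem h x))

/-- The minimal and the maximal realization of L in H¹ coincide. Membership in the closure becomes
an equation in L², with no approximating sequences left. -/
theorem mem_closure_graphL_iff (hα : Cb 2 (rep α)) (hβ : Cb 2 fun x => -rep β x) {x y : H1} :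
    (x, y) ∈ (graphL α β).topologicalClosure ↔ opLL2 α β x = val y :=
  ⟨opLL2_of_mem_closure, fun h =>
    mem_closure_graphL_of_tendsto hα hβ (tendsto_of_opLL2 hα.of_succ hβ.of_succ h)⟩

theorem mem_closure_graphL_iff_tendsto (hα : Cb 2 (rep α)) (hβ : Cb 2 fun x => -rep β x)
    {x y : H1} : (x, y) ∈ (graphL α β).topologicalClosure ↔
      Tendsto (fun h : ℝ => h⁻¹ • (UH hα.of_succ hβ.of_succ h x - x)) (𝓝[>] 0) (𝓝 (-y)) :=
  ⟨fun h => tendsto_of_opLL2 hα.of_succ hβ.of_succ (opLL2_of_mem_closure h),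
    mem_closure_graphL_of_tendsto hα hβ⟩

end Generator

/-! ### The coefficients of the conjugated operators -/

/-- Elliptic regularity from (∂ₓQ⁻²w)' = Q⁻²w - w: once Q⁻²w is as regular as w, so is this right
side, and two antiderivatives gain two orders. The induction on k supplies the first condition. -/
theorem SobFamily.invQ2 {X : Type*} [NormedAddCommGroup X] [NormedSpace ℝ X] {k : ℕ}
    {W : ℝ → X →L[ℝ] H1} (hW : SobFamily k W) :
    SobFamily (k + 2) (fun t => StochCH.invQ2.comp (val.comp (W t))) ∧
      SobFamily (k + 1) (fun t => dxInvQ2.comp (val.comp (W t))) := by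
  have hsub : ∀ {k : ℕ}, SobFamily k (fun t => StochCH.invQ2.comp (val.comp (W t))) →
      SobFamily k W → SobFamily (k + 2) (fun t => StochCH.invQ2.comp (val.comp (W t))) ∧
        SobFamily (k + 1) (fun t => dxInvQ2.comp (val.comp (W t))) := by
    intro k h h'
    have h1 : SobFamily (k + 1) (fun t => dxInvQ2.comp (val.comp (W t))) :=
      ⟨(SOC.const _).comp ((SOC.const _).comp h'.soc),
        fun t => StochCH.invQ2.comp (val.comp (W t)) + (-1 : ℝ) • W t, fun t v => by
          simp [der_dxInvQ2, sub_eq_add_neg], h.add (h'.const_smul (-1))⟩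
    exact ⟨⟨(SOC.const _).comp ((SOC.const _).comp h'.soc), _, fun t v => der_invQ2 _, h1⟩, h1⟩
  induction k with
  | zero => exact hsub (k := 0) ((SOC.const _).comp ((SOC.const _).comp hW)) hW
  | succ k ih => exact hsub (ih hW.of_succ).1.of_succ hW

/-- A family with values in `H³`. -/
theorem SobFamily.exists_H3 {X : Type*} [NormedAddCommGroup X] [NormedSpace ℝ X]
    {T : ℝ → X →L[ℝ] H1} (hT : SobFamily 2 T) :
    ∃ (S : ℝ → X →L[ℝ] H2) (G : ℝ → X →L[ℝ] H1), SOC S ∧ SOC G ∧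
      (∀ t v, incl (S t v) = T t v) ∧ ∀ t v, der (dx (S t v)) = val (G t v) := by
  obtain ⟨S, hS, hST⟩ := hT.of_succ.exists_H2
  obtain ⟨-, T', h1, -, G, h2, h3⟩ := hT
  refine ⟨S, G, hS, h3, hST, fun t v => ?_⟩
  rw [← h2]
  congr 1
  apply H1.ext_val
  rw [← h1, ← hST, der_incl]

section Coefficients

variable {ξ η : ℝ → ℝ} (hξ : Cb 4 ξ) (hη : Cb 3 η)

theorem Cb.one {k : ℕ} {f : ℝ → ℝ} (h : Cb (k + 1) f) : Cb 1 f := h.mono (Nat.le_add_left 1 k)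

/-- `a = Q⁻² U_t⁻¹ v`. -/
def solA (t : ℝ) : H1 →L[ℝ] H1 := invQ2.comp (val.comp (UH hξ.one hη.one (-t)))

/-- `a' = ∂ₓ Q⁻² U_t⁻¹ v`. -/
def solA' (t : ℝ) : H1 →L[ℝ] H1 := dxInvQ2.comp (val.comp (UH hξ.one hη.one (-t)))

theorem smoothFamily_dexpo (hξ : Cb 4 ξ) (hη : Cb 3 η) :
    SmoothFamily 2 fun t => deriv (expo ξ η (-t)) :=
  (smoothFamily_expo hξ.one hξ.of_succ hη).2.2.reparam continuous_neg

/-- The coefficient of `∂ₓ` in `U_t A(U_t⁻¹ v) U_t⁻¹`. -/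
def coefA (t : ℝ) : H1 →L[ℝ] H1 := (compOp hξ.one (-t)).comp
  ((mulOp (((smoothFamily_flowDeriv hξ).freeze t).mono (Nat.le_add_left 1 2))).comp (solA hξ hη t))

/-- The coefficient of order zero in `U_t A(U_t⁻¹ v) U_t⁻¹`. -/
def coefB (t : ℝ) : H1 →L[ℝ] H1 := (compOp hξ.one (-t)).comp
  ((2 : ℝ) • solA' hξ hη t +
    (mulOp (((smoothFamily_dexpo hξ hη).freeze t).of_succ)).comp (solA hξ hη t))

theorem rep_coefA (t : ℝ) (v : H1) (x : ℝ) : rep (coefA hξ hη t v) x =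
    flowDeriv ξ t (flow ξ (-t) x) * rep (solA hξ hη t v) (flow ξ (-t) x) := by
  rw [coefA, ContinuousLinearMap.comp_apply, rep_compOp, ContinuousLinearMap.comp_apply, rep_mulOp]

theorem rep_coefB (t : ℝ) (v : H1) (x : ℝ) : rep (coefB hξ hη t v) x =
    2 * rep (solA' hξ hη t v) (flow ξ (-t) x) +
      deriv (expo ξ η (-t)) (flow ξ (-t) x) * rep (solA hξ hη t v) (flow ξ (-t) x) := by
  rw [coefB, ContinuousLinearMap.comp_apply, rep_compOp, add_apply, smul_apply, rep_add, rep_smul,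
    ContinuousLinearMap.comp_apply, rep_mulOp]
  rfl

/-- Order 2 means values in H³, already for v ∈ H¹. The factor φ_t' must then have three bounded
derivatives, which uses ξ ∈ C_b⁴ fully. -/
theorem sobFamily_coefA : SobFamily 2 (coefA hξ hη) := by
  have hW : SobFamily 0 fun t => UH hξ.one hη.one (-t) :=
    (soc_UH hξ.one hη.one).reparam continuous_neg
  exact SobFamily.comp_flow hξ.one continuous_neg hξ.of_succ
    (SobFamily.mul (smoothFamily_flowDeriv hξ) hW.invQ2.1)

/-- Values in H² require two derivatives of ∂ₓc, hence three of the exponent c; this uses η ∈ C_b³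
fully. -/
theorem sobFamily_coefB : SobFamily 1 (coefB hξ hη) := by
  have hW : SobFamily 0 fun t => UH hξ.one hη.one (-t) :=
    (soc_UH hξ.one hη.one).reparam continuous_neg
  exact SobFamily.comp_flow hξ.one continuous_neg hξ.of_succ.of_succ
    ((hW.invQ2.2.const_smul 2).add
      (SobFamily.mul (smoothFamily_dexpo hξ hη) hW.invQ2.1.of_succ))

theorem cb_coefA (t : ℝ) (v : H1) : Cb 2 (rep (coefA hξ hη t v)) :=
  (sobFamily_coefA hξ hη).cb t v

/-- The semigroup argument needs C_b², while β ∈ H² would give only C_b¹. For v ∈ H² the functions a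
and a' are smooth enough, and ∂ₓc, being merely C_b², is handled as a bounded function instead of a
multiplier on H³. -/
theorem cb_coefB (t : ℝ) (v : H2) : Cb 2 (rep (coefB hξ hη t (incl v))) := by
  have hW : SobFamily 1 fun t => (UH hξ.one hη.one (-t)).comp incl :=
    sobFamily_incl.UH hξ.one hη.one hξ.of_succ.of_succ hη.of_succ continuous_neg
  have h1 : Cb 2 (rep (solA hξ hη t (incl v))) := (hW.invQ2.1.cb t v).of_succ
  have h2 : Cb 2 (rep (solA' hξ hη t (incl v))) := hW.invQ2.2.cb t v
  have h3 := SmoothFamily.comp_flow (F := fun _ y => 2 * rep (solA' hξ hη t (incl v)) y +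
      deriv (expo ξ η (-t)) y * rep (solA hξ hη t (incl v)) y)
    ((SmoothFamily.const_mul 2 h2).add (((smoothFamily_dexpo hξ hη).freeze t).mul h1))
    hξ.one hξ.of_succ.of_succ (r := fun _ => -t) continuous_const
  have e : rep (coefB hξ hη t (incl v)) = fun x => 2 * rep (solA' hξ hη t (incl v)) (flow ξ (-t) x) +
      deriv (expo ξ η (-t)) (flow ξ (-t) x) * rep (solA hξ hη t (incl v)) (flow ξ (-t) x) :=
    funext fun x => rep_coefB hξ hη t (incl v) x
  rw [e]
  exact h3

/-- Chain and product rule for f = e^{c(-t,·)} g ∘ φ_t, evaluated at y = φ_{-t}(x). The weights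
e^{c(t,x)} and e^{c(-t,y)} cancel by the cocycle identity. -/
theorem rep_opL_conj (t : ℝ) (v f g : H2) (hfg : incl f = UH hξ.one hη.one (-t) (incl g)) :
    rep (opL (coefA hξ hη t (incl v)) (coefB hξ hη t (incl v)) g) =
      U ξ η t (opA (U ξ η (-t) (rep (incl v))) f) := by
  have hw : U ξ η (-t) (rep (incl v)) =ᵐ[volume] val (UH hξ.one hη.one (-t) (incl v)) := by
    rw [← rep_UH hξ.one hη.one]
    exact rep_ae _
  have ha : invQsq (U ξ η (-t) (rep (incl v))) = rep (solA hξ hη t (incl v)) := invQsq_eq hw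
  have ha' : deriv (invQsq (U ξ η (-t) (rep (incl v)))) = rep (solA' hξ hη t (incl v)) :=
    deriv_invQsq_eq hw
  have hf : rep (incl f) = fun y => Real.exp (expo ξ η (-t) y) * rep (incl g) (flow ξ t y) := by
    funext y
    rw [hfg, rep_UH, U_apply, neg_neg]
  have hf' : ∀ y, rep (dx f) y = Real.exp (expo ξ η (-t) y) * deriv (expo ξ η (-t)) y *
      rep (incl g) (flow ξ t y) +
      Real.exp (expo ξ η (-t) y) * (rep (dx g) (flow ξ t y) * flowDeriv ξ t y) := by
    intro y
    have h1 := ((smoothFamily_expo hξ.one hξ.one hη.one).hasDerivAt (-t) y).exp.mul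
      ((hasDerivAt_rep_incl g (flow ξ t y)).comp y (hasDerivAt_flow_space hξ.one t y))
    have h2 := hasDerivAt_rep_incl f y
    rw [hf] at h2
    exact h2.unique h1
  funext x
  have hexp : Real.exp (expo ξ η t x) * Real.exp (expo ξ η (-t) (flow ξ (-t) x)) = 1 := by
    rw [← Real.exp_add, expo_neg hξ.one hη.one, Real.exp_zero]
  simp only [rep_opL]
  rw [rep_coefA, rep_coefB, U_apply, opA, ha', ha, hf', hf]
  simp only [flow_flow_neg hξ.one]
  set y := flow ξ (-t) x
  linear_combination (-(rep (solA hξ hη t (incl v)) y * (deriv (expo ξ η (-t)) y * rep (incl g) x +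
    rep (dx g) x * flowDeriv ξ t y) + 2 * rep (solA' hξ hη t (incl v)) y * rep (incl g) x)) * hexp

/-- Both U_t and U_{-t} preserve H², so the conjugated operator has domain exactly H². -/
theorem conjGraph_eq (t : ℝ) (v : H2) : conjGraph ξ η t v =
    graphL (coefA hξ hη t (incl v)) (coefB hξ hη t (incl v)) := by
  obtain ⟨S, -, hS⟩ := exists_UH2 hξ.one hη.one hξ.of_succ.of_succ hη.of_succ
  ext ⟨x, y⟩
  rw [mem_graphL]
  constructor
  · rintro ⟨f, hf, hy⟩
    have hx : incl (S t f) = x := by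
      rw [← rep_UH hξ.one hη.one] at hf
      rw [hS, H1.ext_rep hf, UH_apply_neg]
    refine ⟨S t f, Prod.ext hx (H1.ext_rep ?_)⟩
    rw [rep_opL_conj hξ hη t v f (S t f) (by rw [hS, UH_neg_apply])]
    exact hy.symm
  · rintro ⟨g, hg⟩
    obtain ⟨rfl, rfl⟩ := Prod.mk.inj hg
    refine ⟨S (-t) g, ?_, ?_⟩
    · rw [hS, rep_UH]
    · exact rep_opL_conj hξ hη t v _ g (hS (-t) g)

theorem graph_hatA (t : ℝ) (v : H2) : (hatA ξ η t v).graph =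
    (graphL (coefA hξ hη t (incl v)) (coefB hξ hη t (incl v))).topologicalClosure := by
  have h1 : (conjGraph ξ η t v).toLinearPMap.graph =
      graphL (coefA hξ hη t (incl v)) (coefB hξ hη t (incl v)) := by
    rw [Submodule.toLinearPMap_graph_eq _ (conjGraph_single_valued ξ η t v), conjGraph_eq hξ hη]
  -- The closure of the graph stays inside {(x, y) : Lx = y in L²}, which forces y = 0 when x = 0.
  have h2 : (conjGraph ξ η t v).toLinearPMap.IsClosable := by
    refine ⟨((graphL (coefA hξ hη t (incl v))
      (coefB hξ hη t (incl v))).topologicalClosure).toLinearPMap, ?_⟩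
    rw [h1, Submodule.toLinearPMap_graph_eq]
    rintro ⟨x, y⟩ hp (rfl : x = 0)
    have := opLL2_of_mem_closure hp
    rw [map_zero] at this
    exact H1.ext_val (by rw [← this, map_zero])
  rw [hatA, ← h2.graph_closure_eq_closure_graph, h1]

theorem cb_neg_coefB (t : ℝ) (v : H2) : Cb 2 fun x => -rep (coefB hξ hη t (incl v)) x :=
  SmoothFamily.neg (cb_coefB hξ hη t v)

theorem mem_graph_hatA_iff (t : ℝ) (v : H2) (x y : H1) : (x, y) ∈ (hatA ξ η t v).graph ↔
    opLL2 (coefA hξ hη t (incl v)) (coefB hξ hη t (incl v)) x = val y := by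
  rw [graph_hatA hξ hη]
  exact mem_closure_graphL_iff (cb_coefA hξ hη t _) (cb_neg_coefB hξ hη t v)

theorem incl_mem_graph_hatA (t : ℝ) (v u : H2) :
    (incl u, opL (coefA hξ hη t (incl v)) (coefB hξ hη t (incl v)) u) ∈ (hatA ξ η t v).graph :=
  (mem_graph_hatA_iff hξ hη t v _ _).2 (opLL2_incl _ _ u)

theorem incl_mem_domain_hatA (hξ : Cb 4 ξ) (hη : Cb 3 η) (t : ℝ) (v u : H2) : incl u ∈ (hatA ξ η t v).domain :=
  LinearPMap.mem_domain_of_mem_graph (incl_mem_graph_hatA hξ hη t v u)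

theorem hatA_apply (t : ℝ) (v u : H2) (h : incl u ∈ (hatA ξ η t v).domain) :
    hatA ξ η t v ⟨incl u, h⟩ = opL (coefA hξ hη t (incl v)) (coefB hξ hη t (incl v)) u :=
  (hatA ξ η t v).mem_graph_snd_inj ((hatA ξ η t v).mem_graph ⟨incl u, h⟩)
    (incl_mem_graph_hatA hξ hη t v u) rfl

theorem isGenerator_neg_hatA (t : ℝ) (v : H2) : IsGenerator (-(hatA ξ η t v))
    (UH (cb_coefA hξ hη t (incl v)).of_succ (cb_neg_coefB hξ hη t v).of_succ) := by
  intro x y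
  have h1 : (x, y) ∈ (-(hatA ξ η t v)).graph ↔ (x, -y) ∈ (hatA ξ η t v).graph := by
    simp only [LinearPMap.mem_graph_iff]
    constructor
    · rintro ⟨z, hz, hy⟩
      refine ⟨z, hz, ?_⟩
      rw [← hy, LinearPMap.neg_apply, neg_neg]
    · rintro ⟨z, hz, hy⟩
      refine ⟨z, hz, ?_⟩
      rw [LinearPMap.neg_apply, hy, neg_neg]
  rw [h1, graph_hatA hξ hη, mem_closure_graphL_iff_tendsto (cb_coefA hξ hη t (incl v))
    (cb_neg_coefB hξ hη t v), neg_neg]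

end Coefficients

/-! ### Kato's condition -/

section Kato

variable {ξ η : ℝ → ℝ}

theorem quasi_accretive_hatA (hξ : Cb 4 ξ) (hη : Cb 3 η) (τ R : ℝ) : ∃ κ : ℝ, ∀ t ∈ Icc (-τ) τ, ∀ v : H2,
    ∃ T : ℝ → H1 →L[ℝ] H1, IsC0Semigroup T ∧ IsGenerator (-(hatA ξ η t v)) T ∧
      (‖v‖ ≤ R → ∀ s, 0 ≤ s → ‖T s‖ ≤ Real.exp (κ * s)) := by
  obtain ⟨SA, hSA, hA⟩ := (sobFamily_coefA hξ hη).of_succ.exists_H2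
  obtain ⟨SB, hSB, hB⟩ := (sobFamily_coefB hξ hη).exists_H2
  obtain ⟨C, hC0, hC⟩ := hSA.2 τ
  obtain ⟨D, hD0, hD⟩ := hSB.2 τ
  have hN := normSymP_nonneg
  -- One constant bounds |α'|, |β| and |β'|: the H² norms of α and β are at most C R and D R, and
  -- `normSymP` is the embedding constant. The factor 4 is that of `norm_UH_apply_le`.
  refine ⟨4 * (normSymP * ((C + D) * R)), fun t ht v => ⟨_, ⟨UH_zero _ _,
    fun s r _ _ => UH_add _ _ s r, fun x => ((soc_UH _ _).apply_const x).continuousOn⟩,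
    isGenerator_neg_hatA hξ hη t v, fun hv s hs => ?_⟩⟩
  have ht' : |t| ≤ τ := abs_le.2 ht
  have hv' : ‖incl v‖ ≤ R := (norm_incl_le v).trans hv
  have kA : ‖SA t (incl v)‖ ≤ (C + D) * R :=
    (hC t ht' _).trans (by gcongr; linarith)
  have kB : ‖SB t (incl v)‖ ≤ (C + D) * R :=
    (hD t ht' _).trans (by gcongr; linarith)
  refine ContinuousLinearMap.opNorm_le_bound _ (Real.exp_pos _).le fun f => ?_
  refine norm_UH_apply_le _ _ (fun x => ?_) (fun x => ?_) (fun x => ?_) hs f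
  · rw [← hA, deriv_rep_incl]
    refine (abs_rep_le _ x).trans ?_
    gcongr
    exact (norm_dx_le _).trans kA
  · rw [abs_neg, ← hB]
    refine (abs_rep_le _ x).trans ?_
    gcongr
    exact (norm_incl_le _).trans kB
  · have e : deriv (fun x => -rep (coefB hξ hη t (incl v)) x) x =
        -rep (dx (SB t (incl v))) x := by
      rw [← hB]
      exact (hasDerivAt_rep_incl _ x).neg.deriv
    rw [e, abs_neg]
    refine (abs_rep_le _ x).trans ?_
    gcongr
    exact (norm_dx_le _).trans kB

theorem commutator_hatA (hξ : Cb 4 ξ) (hη : Cb 3 η) (τ R : ℝ) : ∃ B : ℝ → H2 → (H1 →L[ℝ] H1),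
    (∀ t ∈ Icc (-τ) τ, ∀ v : H2, ∀ x z : H1,
      (∃ y : H2, (incl (QE.symm x), incl y) ∈ (hatA ξ η t v).graph ∧ QE y = z) ↔
        (x, z - B t v x) ∈ (hatA ξ η t v).graph) ∧
    (∀ v : H2, StronglyMeasurable (fun t : Icc (-τ) τ => B t v)) ∧
    ∃ l : ℝ, ∀ t ∈ Icc (-τ) τ, ∀ v : H2, ‖v‖ ≤ R → ‖B t v‖ ≤ l := by
  obtain ⟨SA, G, hSA, hG, hA, hAG⟩ := (sobFamily_coefA hξ hη).exists_H3
  obtain ⟨SB, hSB, hB⟩ := (sobFamily_coefB hξ hη).exists_H2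
  have hN := normSymP_nonneg
  refine ⟨fun t v => opB (SA t (incl v)) (SB t (incl v)), ?_, fun v => ?_, ?_⟩
  · intro t _ v x z
    simp only [mem_graph_hatA_iff hξ hη]
    rw [← hA, ← hB]
    exact commutator_iff (hAG t (incl v)) (SB t (incl v)) x z
  · have hc : Continuous fun t => opB (SA t (incl v)) (SB t (incl v)) := by
      refine continuous_iff_continuousAt.2 fun s => ?_
      rw [ContinuousAt, tendsto_iff_norm_sub_tendsto_zero]
      refine squeeze_zero (fun _ => norm_nonneg _)
        (fun t => norm_opB_sub_le (hAG t (incl v)) (hAG s (incl v)) _ _) ?_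
      have c1 := hSA.apply_const (incl v)
      have c2 := hSB.apply_const (incl v)
      have c3 := hG.apply_const (incl v)
      have c4 : Continuous fun t =>
          2 * normSymP * ‖incl (SA t (incl v) - SA s (incl v)) - (G t (incl v) - G s (incl v))‖ *
            ‖dx.comp QinvH‖ +
          ‖QH‖ * (‖mulH2‖ * ‖SB t (incl v) - SB s (incl v)‖ * ‖QinvH‖) +
          ‖mulH1‖ * ‖SB t (incl v) - SB s (incl v)‖ := by fun_prop
      simpa using c4.tendsto s
    exact (hc.comp continuous_subtype_val).stronglyMeasurable
  · obtain ⟨C, hC0, hC⟩ := hSA.2 τ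
    obtain ⟨D, hD0, hD⟩ := hSB.2 τ
    obtain ⟨M, hM0, hM⟩ := hG.2 τ
    refine ⟨2 * normSymP * (C * R + M * R) * ‖dx.comp QinvH‖ +
      ‖QH‖ * (‖mulH2‖ * (D * R) * ‖QinvH‖) + ‖mulH1‖ * (D * R), fun t ht v hv => ?_⟩
    have ht' : |t| ≤ τ := abs_le.2 ht
    have hv' : ‖incl v‖ ≤ R := (norm_incl_le v).trans hv
    refine (norm_opB_le (hAG t (incl v)) _).trans ?_
    have k1 : ‖SB t (incl v)‖ ≤ D * R := (hD t ht' _).trans (by gcongr)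
    have k2 : ‖incl (SA t (incl v)) - G t (incl v)‖ ≤ C * R + M * R := by
      refine (norm_sub_le _ _).trans (add_le_add ?_ ?_)
      · exact (norm_incl_le _).trans ((hC t ht' _).trans (by gcongr))
      · exact (hM t ht' _).trans (by gcongr)
    gcongr

/-- L depends boundedly on its coefficients in H¹, so for fixed v strong continuity of the
coefficient maps already yields operator norm continuity. -/
theorem continuous_hatA (hξ : Cb 4 ξ) (hη : Cb 3 η) (v : H2) :
    Continuous fun t => opL (coefA hξ hη t (incl v)) (coefB hξ hη t (incl v)) := by
  have c1 := (sobFamily_coefA hξ hη).soc.apply_const (incl v)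
  have c2 := (sobFamily_coefB hξ hη).soc.apply_const (incl v)
  exact ((mulH1.continuous.comp c1).clm_comp continuous_const).add
    ((mulH1.continuous.comp c2).clm_comp continuous_const)

theorem opL_sub_opL (α α' β β' : H1) (u : H2) :
    opL α β u - opL α' β' u = opL (α - α') (β - β') u := by
  simp only [opL_apply, map_sub, sub_apply]
  abel

theorem lipschitz_hatA (hξ : Cb 4 ξ) (hη : Cb 3 η) (τ : ℝ) : ∃ μ : ℝ, ∀ t ∈ Icc (-τ) τ, ∀ v₁ v₂ u : H2,
    ‖opL (coefA hξ hη t (incl v₁)) (coefB hξ hη t (incl v₁)) u -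
      opL (coefA hξ hη t (incl v₂)) (coefB hξ hη t (incl v₂)) u‖ ≤
      μ * ‖incl (v₁ - v₂)‖ * ‖u‖ := by
  obtain ⟨C, hC0, hC⟩ := (sobFamily_coefA hξ hη).soc.2 τ
  obtain ⟨D, hD0, hD⟩ := (sobFamily_coefB hξ hη).soc.2 τ
  have hN := normSymP_nonneg
  refine ⟨3 * normSymP * (C + D), fun t ht v₁ v₂ u => ?_⟩
  have ht' : |t| ≤ τ := abs_le.2 ht
  rw [opL_sub_opL, ← map_sub, ← map_sub, ← map_sub]
  refine (norm_opL_apply_le _ _ _).trans ?_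
  rw [mul_assoc (3 * normSymP) (C + D), add_mul]
  gcongr
  exacts [hC t ht' _, hD t ht' _]

theorem katoCondition_hatA (hξ : Cb 4 ξ) (hη : Cb 3 η) (τ R : ℝ) :
    KatoCondition incl QE (Icc (-τ) τ) R (hatA ξ η) where
  embedding := incl_injective
  dense := denseRange_incl
  domain t _ v y := incl_mem_domain_hatA hξ hη t v y
  quasi_accretive := quasi_accretive_hatA hξ hη τ R
  commutator := commutator_hatA hξ hη τ R
  continuity v := ⟨_, fun t _ y => incl_mem_graph_hatA hξ hη t v y,
    (continuous_hatA hξ hη v).continuousOn⟩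
  lipschitz := by
    obtain ⟨μ, hμ⟩ := lipschitz_hatA hξ hη τ
    refine ⟨μ, fun t ht v₁ v₂ u _ _ => ?_⟩
    rw [hatA_apply hξ hη, hatA_apply hξ hη]
    exact hμ t ht v₁ v₂ u

end Kato

end StochCH

end

theorem mainTheorem4 (ξ η : ℝ → ℝ) (hξ : StochCH.MemCb 4 ξ) (hη : StochCH.MemCb 3 η)
    (τ R : ℝ) (hτ : 0 < τ) (hR : 0 < R) :
    ∃ Q : StochCH.H2 ≃L[ℝ] StochCH.H1,
      (∀ f : StochCH.H2,
        StochCH.IsQ (StochCH.rep (StochCH.incl f)) (StochCH.rep (Q f))) ∧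
      StochCH.KatoCondition StochCH.incl Q (Set.Icc (-τ) τ) R (StochCH.hatA ξ η) := by
  exact ⟨StochCH.QE, StochCH.isQ_QE, StochCH.katoCondition_hatA hξ.cb hη.cb τ R⟩
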